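/- **Setting.** Let $T'>0$, $n\ge 1$, and let $\alpha_0(t)=0$, $\alpha_n(t)=t$ and $\alpha_1,\dots,\alpha_{n-1}\in C^1[0,T']$ with $\alpha_i(0)=0$, $0<\alpha_1(t)<\dots<\alpha_{n-1}(t)<t$ for $0<t\le T'$ and $0<\alpha_1'(0)<\dots<\alpha_{n-1}'(0)<1$. Let $K_i(t,s)$ ($i=1,\dots,n$) be real functions, continuous on the closed sector $\{0\le t\le T',\ \alpha_{i-1}(t)\le s\le\alpha_i(t)\}$, and differentiable in $t$ in its interior with derivative $K_i^{(1)}=\partial K_i/\partial t$ that extends continuously to the closed sector; let $f\in C^1[0,T']$. Consider $$\sum_{i=1}^n\int_{\alpha_{i-1}(t)}^{\alpha_i(t)}K_i(t,s)\,u(s)\,ds=f(t),\qquad 0<t\le T', \tag{3}$$ in the sense of distributions, where the unit mass $\delta$ at $s=0$ is counted in the first sector, so that the left-hand side for $u=a\delta+x$ is $aK_1(t,0)+\sum_i\int_{\alpha_{i-1}(t)}^{\alpha_i(t)}K_i(t,s)x(s)\,ds$. Put $a=f(0)/K_1(0,0)$ and $$F(x)(t)=K_n(t,t)x(t)+\sum_{i=1}^{n-1}\alpha_i'(t)\{K_i(t,\alpha_i(t))-K_{i+1}(t,\alpha_i(t))\}x(\alpha_i(t))+\sum_{i=1}^n\int_{\alpha_{i-1}(t)}^{\alpha_i(t)}K_i^{(1)}(t,s)x(s)\,ds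 .$$ **Theorem 2.** Let $0\le N^*<N$ be integers, $f(0)\ne0$, $K_1(0,0)\neq 0$, and assume: (B) There are polynomials $\mathcal P_i(t,s)$, $f^N(t)$, $\alpha_i^N(t)$ of (total) degree at most $N$ such that, as $t,s\to+0$ (with $(t,s)$ in the $i$-th sector), $K_i-\mathcal P_i=O((t+s)^{N+1})$, $f-f^N=O(t^{N+1})$, $\alpha_i-\alpha_i^N=O(t^{N+1})$, and these expansions may be differentiated once in $t$: $K_i^{(1)}-\partial_t\mathcal P_i=O((t+s)^{N})$, $f'-(f^N)'=O(t^{N})$, $\alpha_i'-(\alpha_i^N)'=O(t^{N})$. (C) $j_1,\dots,j_\nu$ are all the distinct zeros in $\{0,1,\dots,N\}$ of the characteristic function $$B(j)=K_n(0,0)+\sum_{i=1}^{n-1}(\alpha_i'(0))^{1+j}\,(K_i(0,0)-K_{i+1}(0,0)),$$ and $k_1,\dots,k_\nu$ are their multiplicities (as zeros of the function $B$ of a real variable). (D) $K_n(t,t)\ne0$ on $[0,T']$, and for some $0<\varepsilon<1$ and $q<1$ one has $|\alpha_i'(t)|\le\varepsilon$ on $[0,T']$ and $\alpha_i(t)/t\le\varepsilon$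 on $(0,T']$ for $i=1,\dots,n-1$, and $$\varepsilon^{N^*}\sum_{i=1}^{n-1}\bigl|\alpha_i'(t)K_n^{-1}(t,t)\{K_i(t,\alpha_i(t))-K_{i+1}(t,\alpha_i(t))\}\bigr|\le q\qquad(0<t<T').$$ Then equation (3) has a family of solutions, depending on $\sum_{i=1}^{\nu}k_i$ arbitrary real constants $c$, $$u_c=\frac{f(0)}{K_1(0,0)}\,\delta+\hat x_c(t)+t^{N^*}v_c(t),\qquad \hat x_c(t)=\sum_{j=0}^N x_{j}(\ln t)\,t^j, \tag{10}$$ where the $x_j=x_{j,c}$ are polynomials in $\ln t$ depending affinely on $c\in\mathbb R^{\sum k_i}$, distinct $c$ give distinct solutions $u_c$, and $v_c$ is continuous on $[0,T']$. Moreover, as $t\to+0$, $$F(\hat x_c)(t)-f'(t)+K_1^{(1)}(t,0)\frac{f(0)}{K_1(0,0)}=o(t^{N-1});$$ given $\hat x_c$, the function $v_c$ is the unique continuous function on $[0,T']$ for which $u_c$ solves (3), and it is the uniform limit on $(0,T']$ of the successive approximations $v_0=\gamma$, $v_{m}=-(M+K)v_{m-1}+\gamma$, where $$\gamma(t)=\Bigl\{f'(t)-K_1^{(1)}(t,0)\tfrac{f(0)}{K_1(0,0)}-F(\hat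 x_c)(t)\Bigr\}\bigl(t^{N^*}K_n(t,t)\bigr)^{-1},$$ $$(M+K)v(t)=K_n^{-1}(t,t)\Bigl[\sum_{i=1}^{n-1}\alpha_i'(t)\Bigl(\frac{\alpha_i(t)}t\Bigr)^{N^*}\{K_i(t,\alpha_i(t))-K_{i+1}(t,\alpha_i(t))\}v(\alpha_i(t))+\sum_{i=1}^n\int_{\alpha_{i-1}(t)}^{\alpha_i(t)}K_i^{(1)}(t,s)\Bigl(\frac st\Bigr)^{N^*}v(s)\,ds\Bigr].$$ Finally, the regular part $x_c=\hat x_c+t^{N^*}v_c$ satisfies $|x_c(t)-\hat x_c(t)|=O(t^{N^*})$ as $t\to+0$. -/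

import Mathlib

open Set Filter Topology MeasureTheory Asymptotics
open scoped Distributions Polynomial

/-- The data of the equation `∑ᵢ ∫_{α_{i-1}(t)}^{α_i(t)} K_i(t,s) u(s) ds = f(t)`, together with
the derivatives `α_i'`, `∂K_i/∂t`, `f'`. Curves are indexed by `0, …, n`, kernels by `1, …, n`;
other indices play no role. -/
structure VolterraData where
  /-- number of kernels -/
  n : ℕ
  /-- the curves `s = α_i(t)`, with `α_0(t) = 0` and `α_n(t) = t` -/
  α : ℕ → ℝ → ℝ
  /-- the derivatives `α_i'` -/
  α' : ℕ → ℝ → ℝ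
  /-- the kernels `K_i(t,s)` -/
  K : ℕ → ℝ → ℝ → ℝ
  /-- the derivatives `K_i^{(1)}(t,s) = ∂K_i/∂t (t,s)` -/
  Kt : ℕ → ℝ → ℝ → ℝ
  /-- the right-hand side -/
  f : ℝ → ℝ
  /-- its derivative -/
  f' : ℝ → ℝ

namespace VolterraData

/-- The closed sector of pairs `(t,s)` with `0 ≤ t ≤ T'` and `α_{i-1}(t) ≤ s ≤ α_i(t)`. -/
def closedSector (P : VolterraData) (T' : ℝ) (i : ℕ) : Set (ℝ × ℝ) :=
  {q | q.1 ∈ Icc 0 T' ∧ P.α (i - 1) q.1 ≤ q.2 ∧ q.2 ≤ P.α i q.1}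

/-- Standing assumptions on `[0, T']`. -/
structure Standing (P : VolterraData) (T' : ℝ) : Prop where
  T'_pos : 0 < T'
  n_pos : 1 ≤ P.n
  α_zero : ∀ t ∈ Icc 0 T', P.α 0 t = 0
  α_last : ∀ t ∈ Icc 0 T', P.α P.n t = t
  α_at_zero : ∀ i ≤ P.n, P.α i 0 = 0
  α_lt : ∀ i < P.n, ∀ t ∈ Ioc 0 T', P.α i t < P.α (i + 1) t
  α_deriv : ∀ i ≤ P.n, ∀ t ∈ Icc 0 T', HasDerivWithinAt (P.α i) (P.α' i t) (Icc 0 T') t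
  α'_cont : ∀ i ≤ P.n, ContinuousOn (P.α' i) (Icc 0 T')
  α'_lt : ∀ i < P.n, P.α' i 0 < P.α' (i + 1) 0
  K_cont : ∀ i ∈ Finset.Icc 1 P.n,
    ContinuousOn (fun q : ℝ × ℝ => P.K i q.1 q.2) (P.closedSector T' i)
  K_deriv : ∀ i ∈ Finset.Icc 1 P.n, ∀ t ∈ Ioo 0 T', ∀ s ∈ Ioo (P.α (i - 1) t) (P.α i t),
    HasDerivAt (fun τ => P.K i τ s) (P.Kt i t s) t
  Kt_cont : ∀ i ∈ Finset.Icc 1 P.n,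
    ContinuousOn (fun q : ℝ × ℝ => P.Kt i q.1 q.2) (P.closedSector T' i)
  f_deriv : ∀ t ∈ Icc 0 T', HasDerivWithinAt P.f (P.f' t) (Icc 0 T') t
  f'_cont : ContinuousOn P.f' (Icc 0 T')

/-- Condition (B): Taylor polynomials of degree at most `N` for `K_i`, `f`, `α_i`, which may be
differentiated once. -/
structure CondB (P : VolterraData) (T' : ℝ) (N : ℕ) : Prop where
  K_taylor : ∀ i ∈ Finset.Icc 1 P.n, ∃ p : MvPolynomial (Fin 2) ℝ, p.totalDegree ≤ N ∧
    (fun q : ℝ × ℝ => P.K i q.1 q.2 - MvPolynomial.eval ![q.1, q.2] p)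
      =O[𝓝[P.closedSector T' i] (0, 0)] (fun q => (q.1 + q.2) ^ (N + 1)) ∧
    (fun q : ℝ × ℝ => P.Kt i q.1 q.2 - MvPolynomial.eval ![q.1, q.2] (MvPolynomial.pderiv 0 p))
      =O[𝓝[P.closedSector T' i] (0, 0)] (fun q => (q.1 + q.2) ^ N)
  f_taylor : ∃ p : ℝ[X], p.natDegree ≤ N ∧
    (fun t => P.f t - p.eval t) =O[𝓝[>] 0] (fun t => t ^ (N + 1)) ∧
    (fun t => P.f' t - p.derivative.eval t) =O[𝓝[>] 0] (fun t => t ^ N)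
  α_taylor : ∀ i ∈ Finset.Icc 1 (P.n - 1), ∃ p : ℝ[X], p.natDegree ≤ N ∧
    (fun t => P.α i t - p.eval t) =O[𝓝[>] 0] (fun t => t ^ (N + 1)) ∧
    (fun t => P.α' i t - p.derivative.eval t) =O[𝓝[>] 0] (fun t => t ^ N)

/-- The characteristic function
`B(z) = K_n(0,0) + ∑_{i=1}^{n-1} α_i'(0)^{1+z} (K_i(0,0) - K_{i+1}(0,0))`. -/
noncomputable def B (P : VolterraData) (z : ℝ) : ℝ :=
  P.K P.n 0 0 + ∑ i ∈ Finset.Icc 1 (P.n - 1),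
    P.α' i 0 ^ (1 + z) * (P.K i 0 0 - P.K (i + 1) 0 0)

/-- Condition (C): `j_1, …, j_ν` are the distinct zeros of `B` in `{0, …, N}`, of multiplicities
`k_1, …, k_ν`. -/
structure CondC (P : VolterraData) (N : ℕ) {ν : ℕ} (j k : Fin ν → ℕ) : Prop where
  inj : Function.Injective j
  zeros : ∀ m : ℕ, (m ≤ N ∧ P.B m = 0) ↔ ∃ i, j i = m
  mult : ∀ i, (∀ l < k i, iteratedDeriv l P.B (j i) = 0) ∧ iteratedDeriv (k i) P.B (j i) ≠ 0

/-- Condition (D), where `|A(t)|` is the sum of the absolute values of the coefficients of the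
functional operator `A`. -/
structure CondD (P : VolterraData) (T' ε q : ℝ) (Nstar : ℕ) : Prop where
  ε_pos : 0 < ε
  ε_lt_one : ε < 1
  α'_le : ∀ i ∈ Finset.Icc 1 (P.n - 1), ∀ t ∈ Icc 0 T', |P.α' i t| ≤ ε
  α_div_le : ∀ i ∈ Finset.Icc 1 (P.n - 1), ∀ t ∈ Ioc 0 T', P.α i t / t ≤ ε
  Kn_ne_zero : ∀ t ∈ Icc 0 T', P.K P.n t t ≠ 0
  q_lt_one : q < 1
  contraction : ∀ t ∈ Ioo 0 T',
    ε ^ Nstar * ∑ i ∈ Finset.Icc 1 (P.n - 1),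
      |P.α' i t * (P.K P.n t t)⁻¹ * (P.K i t (P.α i t) - P.K (i + 1) t (P.α i t))| ≤ q

/-- The differentiated operator
`F(x)(t) = K_n(t,t) x(t) + ∑ α_i'(t) {K_i(t,α_i(t)) - K_{i+1}(t,α_i(t))} x(α_i(t))
  + ∑ ∫_{α_{i-1}(t)}^{α_i(t)} K_i^{(1)}(t,s) x(s) ds`. -/
noncomputable def F (P : VolterraData) (x : ℝ → ℝ) (t : ℝ) : ℝ :=
  P.K P.n t t * x t
    + ∑ i ∈ Finset.Icc 1 (P.n - 1),
        P.α' i t * (P.K i t (P.α i t) - P.K (i + 1) t (P.α i t)) * x (P.α i t)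
    + ∑ i ∈ Finset.Icc 1 P.n, ∫ s in (P.α (i - 1) t)..(P.α i t), P.Kt i t s * x s

/-- The coefficient `a = f(0) / K_1(0,0)` of the Dirac delta function. -/
noncomputable def a (P : VolterraData) : ℝ := P.f 0 / P.K 1 0 0

/-- The right-hand side of the equation `F(x) = f' - ∂K_1/∂t(t,0) f(0)/K_1(0,0)` for the regular
part. -/
noncomputable def rhs (P : VolterraData) (t : ℝ) : ℝ := P.f' t - P.Kt 1 t 0 * P.a

/-- The operator `M + K` of the equation `v + (M + K) v = γ` that results from the substitution
`x = x̂ + t^{N*} v`. -/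
noncomputable def MK (P : VolterraData) (Nstar : ℕ) (v : ℝ → ℝ) (t : ℝ) : ℝ :=
  (P.K P.n t t)⁻¹ *
    (∑ i ∈ Finset.Icc 1 (P.n - 1), P.α' i t * (P.α i t / t) ^ Nstar *
        (P.K i t (P.α i t) - P.K (i + 1) t (P.α i t)) * v (P.α i t)
      + ∑ i ∈ Finset.Icc 1 P.n,
          ∫ s in (P.α (i - 1) t)..(P.α i t), P.Kt i t s * (s / t) ^ Nstar * v s)

/-- The right-hand side `γ` of the equation `v + (M + K) v = γ`. -/
noncomputable def γ (P : VolterraData) (Nstar : ℕ) (xhat : ℝ → ℝ) (t : ℝ) : ℝ :=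
  (P.rhs t - P.F xhat t) / (t ^ Nstar * P.K P.n t t)

/-- Successive approximations `v_0 = γ`, `v_{m+1} = -(M + K) v_m + γ`. -/
noncomputable def approx (P : VolterraData) (Nstar : ℕ) (xhat : ℝ → ℝ) : ℕ → ℝ → ℝ
  | 0 => P.γ Nstar xhat
  | m + 1 => fun t => -P.MK Nstar (P.approx Nstar xhat m) t + P.γ Nstar xhat t

/-- The operator `t ↦ ∑ᵢ ∫_{[α_{i-1}(t), α_i(t))} K_i(t,s) dμ(s)` on measures. A mass at `s = 0`
is counted in the first sector `0 ≤ s < α_1(t)`. -/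
noncomputable def volterra (P : VolterraData) (μ : Measure ℝ) (t : ℝ) : ℝ :=
  ∑ i ∈ Finset.Icc 1 P.n, ∫ s in Ico (P.α (i - 1) t) (P.α i t), P.K i t s ∂μ

end VolterraData

/-- The open half-line `(-∞, T')`. -/
def halfLine (T' : ℝ) : TopologicalSpace.Opens ℝ := ⟨Iio T', isOpen_Iio⟩

/-- The regular distribution on `(-∞, T')` given by the function `x` on `(0, T')`, extended by
zero to the negative half-line: `φ ↦ ∫₀^{T'} φ(t) x(t) dt`. -/
noncomputable def regularDist (T' : ℝ) (x : ℝ → ℝ) : 𝓓'(halfLine T', ℝ) where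
  toFun φ := TestFunction.integralAgainstBilinCLM (ContinuousLinearMap.mul ℝ ℝ) volume
    ((Ioo 0 T').indicator x) φ
  map_add' φ ψ := map_add _ φ ψ
  map_smul' c φ := map_smul _ c φ
  cont := ContinuousLinearMap.continuous _

/-- The distribution `u` is the difference `μ₁ - μ₂` of two finite measures on `[0, T')`. -/
structure RepresentedBy {T' : ℝ} (u : 𝓓'(halfLine T', ℝ)) (μ₁ μ₂ : Measure ℝ) : Prop where
  finite₁ : IsFiniteMeasure μ₁
  finite₂ : IsFiniteMeasure μ₂
  supp₁ : μ₁ (Ico 0 T')ᶜ = 0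
  supp₂ : μ₂ (Ico 0 T')ᶜ = 0
  apply_eq : ∀ φ : 𝓓(halfLine T', ℝ), u φ = ∫ s, φ s ∂μ₁ - ∫ s, φ s ∂μ₂

/-- The distribution `u` on `(-∞, T')`, supported in `[0, T')`, solves the equation
`∫₀ᵗ K(t,s) u(s) ds = f(t)`, as an equality of distributions (both sides being extended by zero
to negative `t`). The left-hand side is defined for `u` of order zero, i.e. for
(signed) measures. -/
def VolterraData.IsSolution (P : VolterraData) {T' : ℝ} (u : 𝓓'(halfLine T', ℝ)) : Prop :=
  ∃ μ₁ μ₂ : Measure ℝ, RepresentedBy u μ₁ μ₂ ∧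
    regularDist T' (fun t => P.volterra μ₁ t - P.volterra μ₂ t) = regularDist T' P.f

/-- The log-power polynomial `∑_{i=0}^N x_i(ln t) t^i`. -/
noncomputable def logPower {N : ℕ} (p : Fin (N + 1) → ℝ[X]) (t : ℝ) : ℝ :=
  ∑ i, (p i).eval (Real.log t) * t ^ (i : ℕ)

/-- The generalized function `a δ(t) + x(t)`. -/
noncomputable def deltaPlus (T' a : ℝ) (x : ℝ → ℝ) : 𝓓'(halfLine T', ℝ) :=
  a • Distribution.delta 0 + regularDist T' x

/-! The equation is differentiated. Boundary terms of neighbouring sectors combine into jumps of the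
kernels along the curves, and the regular part has to satisfy `F x = rhs`. Since `a * K_1(0,0) =
f(0)`, nothing is lost in differentiating (`hasDerivAt_lhs`, `lhs_eq_of_F_eq`, `F_eq_of_lhs_eq`).

Near zero, `α_i(t)` behaves like `α_i'(0) t`, so composition with `α_i` shifts `ln t` by `ln
α_i'(0)`, while each integral gains a power of `t`. Hence `F` maps `t^m y(ln t)` to `t^m (charOp m
y)(ln t)` plus terms of higher order (`F_logTerm_sub_mem_logExp`). Formally `charOp m` is `∑
B^{(l)}(m)/l! · (d/du)^l`. If `B` vanishes to order `κ` at `m`, this operator kills `1, u, …,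
u^{κ-1}` and is still onto the polynomials (`charOp_X_pow`, `charOp_surjective`). So the asymptotic
equation can be solved one power of `t` after another (`exists_asymptotic_solution`), and each zero
of `B` contributes as many free constants as its multiplicity (`exists_asymptotic_family`).

Putting `x = x̂ + t^{N*} v` gives `v + (M + K) v = γ`, where `γ` tends to zero because `N* ≤ N - 1`.
Condition (D) bounds the functional part of `M + K` by `q < 1`, and a weight `e^{λt}` makes the
Volterra part as small as desired. The operator is therefore a contraction
(`exists_MK_contraction`), which yields existence, uniqueness and uniform convergence of the
approximations (`exists_limit_approx`, `eqOn_of_add_MK_eq`).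

Condition (D) also forces `B(m) ≠ 0` for integers `m ≥ N*` (`CondD.B_ne_zero`). Two different
members of the family thus first differ at an order below `N*`, where no term `t^{N*} v` can
compensate.

The distributional equation reduces to the pointwise one because the representing measures are
unique up to a common summand and both sides are continuous (`isSolution_deltaPlus_iff`). -/

/-! ### Geometry of the sectors and continuity of sector integrals. -/

namespace VolterraData.Standing

variable {P : VolterraData} {T' : ℝ}

theorem α_mono (hP : P.Standing T') {i j : ℕ} (hij : i ≤ j) (hj : j ≤ P.n) {t : ℝ}
    (ht : t ∈ Icc 0 T') : P.α i t ≤ P.α j t := by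
  induction j, hij using Nat.le_induction with
  | base => exact le_rfl
  | succ j hij ih =>
    refine (ih (by omega)).trans ?_
    rcases ht.1.eq_or_lt with h | h
    · rw [← h, hP.α_at_zero j (by omega), hP.α_at_zero (j + 1) hj]
    · exact (hP.α_lt j (by omega) t ⟨h, ht.2⟩).le

theorem α_nonneg (hP : P.Standing T') {i : ℕ} (hi : i ≤ P.n) {t : ℝ} (ht : t ∈ Icc 0 T') :
    0 ≤ P.α i t := by
  rw [← hP.α_zero t ht]; exact hP.α_mono (Nat.zero_le i) hi ht

theorem α_le_self (hP : P.Standing T') {i : ℕ} (hi : i ≤ P.n) {t : ℝ} (ht : t ∈ Icc 0 T') :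
    P.α i t ≤ t := by
  conv_rhs => rw [← hP.α_last t ht]
  exact hP.α_mono hi le_rfl ht

theorem α_pos (hP : P.Standing T') {i : ℕ} (h1 : 1 ≤ i) (hi : i ≤ P.n) {t : ℝ}
    (ht : t ∈ Ioc 0 T') : 0 < P.α i t := by
  have ht' : t ∈ Icc 0 T' := ⟨ht.1.le, ht.2⟩
  rw [← hP.α_zero t ht']
  exact (hP.α_lt 0 hP.n_pos t ht).trans_le (hP.α_mono h1 hi ht')

theorem α_continuousOn (hP : P.Standing T') {i : ℕ} (hi : i ≤ P.n) :
    ContinuousOn (P.α i) (Icc 0 T') :=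
  fun t ht => (hP.α_deriv i hi t ht).continuousWithinAt

theorem α_hasDerivAt (hP : P.Standing T') {i : ℕ} (hi : i ≤ P.n) {t : ℝ} (ht : t ∈ Ioo 0 T') :
    HasDerivAt (P.α i) (P.α' i t) t :=
  (hP.α_deriv i hi t ⟨ht.1.le, ht.2.le⟩).hasDerivAt (Icc_mem_nhds ht.1 ht.2)

theorem α'_last (hP : P.Standing T') {t : ℝ} (ht : t ∈ Icc 0 T') : P.α' P.n t = 1 := by
  have h1 := hP.α_deriv P.n le_rfl t ht
  have h2 : HasDerivWithinAt (P.α P.n) 1 (Icc 0 T') t :=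
    (hasDerivWithinAt_id t _).congr (fun s hs => hP.α_last s hs) (hP.α_last t ht)
  exact (uniqueDiffOn_Icc hP.T'_pos t ht).eq_deriv _ h1 h2

theorem α'_zero (hP : P.Standing T') {t : ℝ} (ht : t ∈ Icc 0 T') : P.α' 0 t = 0 := by
  have h1 := hP.α_deriv 0 (Nat.zero_le _) t ht
  have h2 : HasDerivWithinAt (P.α 0) 0 (Icc 0 T') t :=
    (hasDerivWithinAt_const t _ (0 : ℝ)).congr (fun s hs => hP.α_zero s hs) (hP.α_zero t ht)
  exact (uniqueDiffOn_Icc hP.T'_pos t ht).eq_deriv _ h1 h2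

theorem zero_mem (hP : P.Standing T') : (0 : ℝ) ∈ Icc 0 T' := ⟨le_rfl, hP.T'_pos.le⟩

theorem α'_zero_mono (hP : P.Standing T') {i j : ℕ} (hij : i < j) (hj : j ≤ P.n) :
    P.α' i 0 < P.α' j 0 := by
  induction j, hij using Nat.le_induction with
  | base => exact hP.α'_lt i (by omega)
  | succ j hij ih => exact (ih (by omega)).trans (hP.α'_lt j (by omega))

theorem α'_zero_pos (hP : P.Standing T') {i : ℕ} (h1 : 1 ≤ i) (hi : i ≤ P.n) :
    0 < P.α' i 0 := by
  simpa only [hP.α'_zero hP.zero_mem] using hP.α'_zero_mono h1 hi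

theorem isCompact_closedSector (hP : P.Standing T') {i : ℕ} (hi : i ≤ P.n) :
    IsCompact (P.closedSector T' i) := by
  have hfst : ∀ {f : ℝ → ℝ}, ContinuousOn f (Icc 0 T') →
      ContinuousOn (fun q : ℝ × ℝ => f q.1) (Icc 0 T' ×ˢ Icc 0 T') := fun hf =>
    hf.comp continuousOn_fst (fun q hq => hq.1)
  have hc : IsClosed (Icc 0 T' ×ˢ Icc 0 T' : Set (ℝ × ℝ)) := isClosed_Icc.prod isClosed_Icc
  have h1 := hc.isClosed_le (hfst (hP.α_continuousOn (i := i - 1) (by omega))) continuousOn_snd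
  have h2 := hc.isClosed_le continuousOn_snd (hfst (hP.α_continuousOn hi))
  refine IsCompact.of_isClosed_subset
    (s := (Icc 0 T' ×ˢ Icc 0 T' : Set (ℝ × ℝ))) (isCompact_Icc.prod isCompact_Icc) ?_
    (fun q hq => ?_)
  · convert h1.inter h2 using 1
    ext q
    constructor
    · rintro ⟨hq, ha, hb⟩
      have : q ∈ (Icc 0 T' ×ˢ Icc 0 T' : Set (ℝ × ℝ)) :=
        ⟨hq, (hP.α_nonneg (by omega) hq).trans ha, hb.trans ((hP.α_le_self hi hq).trans hq.2)⟩
      exact ⟨⟨this, ha⟩, ⟨this, hb⟩⟩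
    · rintro ⟨⟨h, ha⟩, ⟨_, hb⟩⟩
      exact ⟨h.1, ha, hb⟩
  · obtain ⟨hq, ha, hb⟩ := hq
    exact ⟨hq, (hP.α_nonneg (by omega) hq).trans ha, hb.trans ((hP.α_le_self hi hq).trans hq.2)⟩

theorem exists_bound (hP : P.Standing T') {g : ℕ → ℝ → ℝ → ℝ}
    (hg : ∀ i ∈ Finset.Icc 1 P.n,
      ContinuousOn (fun q : ℝ × ℝ => g i q.1 q.2) (P.closedSector T' i)) :
    ∃ M, 0 ≤ M ∧ ∀ i ∈ Finset.Icc 1 P.n, ∀ q ∈ P.closedSector T' i, |g i q.1 q.2| ≤ M := by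
  have h : ∀ i ∈ Finset.Icc 1 P.n, ∃ M, ∀ q ∈ P.closedSector T' i, |g i q.1 q.2| ≤ M :=
    fun i hi => (hP.isCompact_closedSector (Finset.mem_Icc.1 hi).2).exists_bound_of_continuousOn
      (hg i hi)
  choose! M hM using h
  refine ⟨∑ i ∈ Finset.Icc 1 P.n, |M i|, Finset.sum_nonneg fun _ _ => abs_nonneg _,
    fun i hi q hq => (hM i hi q hq).trans ((le_abs_self _).trans ?_)⟩
  exact Finset.single_le_sum (f := fun i => |M i|) (fun _ _ => abs_nonneg _) hi

theorem mem_closedSector_upper (hP : P.Standing T') {i : ℕ} (hi : i ≤ P.n) {t : ℝ}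
    (ht : t ∈ Icc 0 T') : (t, P.α i t) ∈ P.closedSector T' i :=
  ⟨ht, hP.α_mono (by omega) hi ht, le_rfl⟩

theorem mem_closedSector_lower (hP : P.Standing T') {i : ℕ} (hi : i ≤ P.n) {t : ℝ}
    (ht : t ∈ Icc 0 T') : (t, P.α (i - 1) t) ∈ P.closedSector T' i :=
  ⟨ht, le_rfl, hP.α_mono (by omega) hi ht⟩

theorem continuousOn_upper (hP : P.Standing T') {i : ℕ} (hi : i ≤ P.n) {g : ℝ → ℝ → ℝ}
    (hg : ContinuousOn (fun q : ℝ × ℝ => g q.1 q.2) (P.closedSector T' i)) :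
    ContinuousOn (fun t => g t (P.α i t)) (Icc 0 T') :=
  hg.comp (f := fun t => (t, P.α i t)) (continuousOn_id.prodMk (hP.α_continuousOn hi))
    (fun _ ht => hP.mem_closedSector_upper hi ht)

theorem continuousOn_lower (hP : P.Standing T') {i : ℕ} (hi : i ≤ P.n) {g : ℝ → ℝ → ℝ}
    (hg : ContinuousOn (fun q : ℝ × ℝ => g q.1 q.2) (P.closedSector T' i)) :
    ContinuousOn (fun t => g t (P.α (i - 1) t)) (Icc 0 T') :=
  hg.comp (f := fun t => (t, P.α (i - 1) t))
    (continuousOn_id.prodMk (hP.α_continuousOn (by omega)))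
    (fun _ ht => hP.mem_closedSector_lower hi ht)

theorem continuousOn_slice {i : ℕ} {g : ℝ → ℝ → ℝ}
    (hg : ContinuousOn (fun q : ℝ × ℝ => g q.1 q.2) (P.closedSector T' i)) {t : ℝ}
    (ht : t ∈ Icc 0 T') : ContinuousOn (g t) (Icc (P.α (i - 1) t) (P.α i t)) :=
  hg.comp (f := fun s => (t, s)) (by fun_prop) (fun _ hs => ⟨ht, hs.1, hs.2⟩)

/-- The coefficient `K_i(t,α_i(t)) - K_{i+1}(t,α_i(t))` is continuous. -/
theorem continuousOn_jump (hP : P.Standing T') {i : ℕ} (hi : i ∈ Finset.Icc 1 (P.n - 1)) :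
    ContinuousOn (fun t => P.K i t (P.α i t) - P.K (i + 1) t (P.α i t)) (Icc 0 T') := by
  rw [Finset.mem_Icc] at hi
  refine (hP.continuousOn_upper (by omega) (hP.K_cont i (by simp; omega))).sub ?_
  exact hP.continuousOn_lower (i := i + 1) (by omega) (hP.K_cont (i + 1) (by simp; omega))

theorem continuousOn_diag (hP : P.Standing T') :
    ContinuousOn (fun t => P.K P.n t t) (Icc 0 T') :=
  (hP.continuousOn_upper le_rfl (hP.K_cont P.n (by simpa using hP.n_pos))).congr
    (fun t ht => by simp only; rw [hP.α_last t ht])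

theorem Ioc_subset (hP : P.Standing T') {i : ℕ} (hi : i ≤ P.n) {t : ℝ} (ht : t ∈ Icc 0 T') :
    Ioc (P.α (i - 1) t) (P.α i t) ⊆ Ioc 0 t :=
  Ioc_subset_Ioc (hP.α_nonneg (by omega) ht) (hP.α_le_self hi ht)

theorem integrableOn_mul (hP : P.Standing T') {i : ℕ} (hi : i ≤ P.n) {g : ℝ → ℝ → ℝ}
    (hg : ContinuousOn (fun q : ℝ × ℝ => g q.1 q.2) (P.closedSector T' i))
    {x : ℝ → ℝ} (hx : IntegrableOn x (Ioc 0 T')) {t : ℝ} (ht : t ∈ Icc 0 T') :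
    IntegrableOn (fun s => g t s * x s) (Ioc (P.α (i - 1) t) (P.α i t)) := by
  have hx' : IntegrableOn x (Icc (P.α (i - 1) t) (P.α i t)) := by
    rw [integrableOn_Icc_iff_integrableOn_Ioc]
    exact hx.mono_set ((hP.Ioc_subset hi ht).trans (Ioc_subset_Ioc_right ht.2))
  exact (hx'.continuousOn_mul (continuousOn_slice hg ht) isCompact_Icc).mono_set Ioc_subset_Icc_self

theorem intervalIntegrable_mul (hP : P.Standing T') {i : ℕ} (hi : i ≤ P.n) {g : ℝ → ℝ → ℝ}
    (hg : ContinuousOn (fun q : ℝ × ℝ => g q.1 q.2) (P.closedSector T' i))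
    {x : ℝ → ℝ} (hx : IntegrableOn x (Ioc 0 T')) {t : ℝ} (ht : t ∈ Icc 0 T') :
    IntervalIntegrable (fun s => g t s * x s) volume (P.α (i - 1) t) (P.α i t) := by
  rw [intervalIntegrable_iff_integrableOn_Ioc_of_le (hP.α_mono (by omega) hi ht)]
  exact hP.integrableOn_mul hi hg hx ht

/-- Dominated convergence on the fixed interval `(0, T']` with the sector as an indicator. For fixed
`s` the integrand is continuous at `t₀` unless `s` is one of the two end points at `t₀`, a null set.
Only integrability of `x` enters, so logarithmic singularities at zero are admitted. -/
theorem continuousOn_sectorIntegral (hP : P.Standing T') {i : ℕ} (hi : i ≤ P.n) {g : ℝ → ℝ → ℝ}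
    (hg : ContinuousOn (fun q : ℝ × ℝ => g q.1 q.2) (P.closedSector T' i))
    {x : ℝ → ℝ} (hx : IntegrableOn x (Ioc 0 T')) :
    ContinuousOn (fun t => ∫ s in (P.α (i - 1) t)..(P.α i t), g t s * x s) (Icc 0 T') := by
  obtain ⟨M, hM⟩ := (hP.isCompact_closedSector hi).exists_bound_of_continuousOn hg
  have hM' : ∀ q ∈ P.closedSector T' i, ‖g q.1 q.2‖ ≤ |M| := fun q hq =>
    (hM q hq).trans (le_abs_self M)
  have hle : ∀ t ∈ Icc 0 T', P.α (i - 1) t ≤ P.α i t := fun t ht => hP.α_mono (by omega) hi ht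
  have key : ∀ t ∈ Icc 0 T', (∫ s in (P.α (i - 1) t)..(P.α i t), g t s * x s) =
      ∫ s in Ioc 0 T', (Ioc (P.α (i - 1) t) (P.α i t)).indicator (fun s => g t s * x s) s := by
    intro t ht
    rw [intervalIntegral.integral_of_le (hle t ht), setIntegral_indicator measurableSet_Ioc,
      inter_eq_self_of_subset_right
        ((hP.Ioc_subset hi ht).trans (Ioc_subset_Ioc_right ht.2))]
  refine ContinuousOn.congr (fun t₀ ht₀ => ?_) key
  refine continuousWithinAt_of_dominated (bound := fun s => |M| * ‖x s‖) ?_ ?_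
    (hx.norm.const_mul _) ?_
  · filter_upwards [self_mem_nhdsWithin] with t ht
    have := (integrable_indicator_iff measurableSet_Ioc).2 (hP.integrableOn_mul hi hg hx ht)
    exact this.aestronglyMeasurable.restrict
  · filter_upwards [self_mem_nhdsWithin] with t ht
    refine Eventually.of_forall fun s => ?_
    by_cases hs : s ∈ Ioc (P.α (i - 1) t) (P.α i t)
    · rw [indicator_of_mem hs, norm_mul]
      exact mul_le_mul_of_nonneg_right (hM' (t, s) ⟨ht, hs.1.le, hs.2⟩) (norm_nonneg _)
    · rw [indicator_of_notMem hs, norm_zero]; positivity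
  · have hA := hP.α_continuousOn (i := i - 1) (by omega) t₀ ht₀
    have hB := hP.α_continuousOn hi t₀ ht₀
    have hne : ∀ c : ℝ, ∀ᵐ s ∂(volume.restrict (Ioc 0 T')), s ≠ c := fun c =>
      ae_restrict_of_ae (Measure.ae_ne volume c)
    filter_upwards [hne (P.α (i - 1) t₀), hne (P.α i t₀)] with s hsA hsB
    rcases lt_or_gt_of_ne hsA with h | h
    · refine (continuousWithinAt_const (b := (0 : ℝ))).congr_of_eventuallyEq ?_ ?_
      · filter_upwards [hA.eventually (lt_mem_nhds h)] with t ht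
        exact indicator_of_notMem (fun hs => absurd hs.1 (not_lt.2 ht.le)) _
      · exact indicator_of_notMem (fun hs => absurd hs.1 (not_lt.2 h.le)) _
    rcases lt_or_gt_of_ne hsB with h' | h'
    · have hev : ∀ᶠ t in 𝓝[Icc 0 T'] t₀, s ∈ Ioc (P.α (i - 1) t) (P.α i t) := by
        filter_upwards [hA.eventually (gt_mem_nhds h), hB.eventually (lt_mem_nhds h')] with t h1 h2
        exact ⟨h1, h2.le⟩
      have hq : ContinuousWithinAt (fun q : ℝ × ℝ => g q.1 q.2) (P.closedSector T' i) (t₀, s) :=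
        hg (t₀, s) ⟨ht₀, h.le, h'.le⟩
      have : ContinuousWithinAt (fun t => g t s * x s) (Icc 0 T') t₀ := by
        refine ContinuousWithinAt.mul ?_ continuousWithinAt_const
        refine Tendsto.comp (f := fun t => (t, s)) hq (tendsto_nhdsWithin_iff.2 ⟨?_, ?_⟩)
        · exact tendsto_nhdsWithin_of_tendsto_nhds (by fun_prop : Continuous fun t => (t, s)).continuousAt
        · filter_upwards [hev, self_mem_nhdsWithin] with t h1 h2
          exact ⟨h2, h1.1.le, h1.2⟩
      refine this.congr_of_eventuallyEq ?_ (indicator_of_mem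
        (show s ∈ Ioc (P.α (i - 1) t₀) (P.α i t₀) from ⟨h, h'.le⟩) _)
      filter_upwards [hev] with t ht
      exact indicator_of_mem ht _
    · refine (continuousWithinAt_const (b := (0 : ℝ))).congr_of_eventuallyEq ?_ ?_
      · filter_upwards [hB.eventually (gt_mem_nhds h')] with t ht
        exact indicator_of_notMem (fun hs => absurd hs.2 (not_le.2 ht)) _
      · exact indicator_of_notMem (fun hs => absurd hs.2 (not_le.2 h')) _

end VolterraData.Standing

/-! ### Leibniz rules for moving ends of integration. -/

/-- Leibniz rule for an integral with a moving upper end, when the integrand is differentiable in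
the parameter only strictly below the moving end. -/
theorem hasDerivAt_integral_moving_upper {g g' : ℝ → ℝ → ℝ} {B x : ℝ → ℝ} {B' c d t₀ δ : ℝ}
    (hδ : 0 < δ) (hcB : ∀ t ∈ Icc (t₀ - δ) (t₀ + δ), c < B t)
    (hBd : ∀ t ∈ Icc (t₀ - δ) (t₀ + δ), B t ≤ d)
    (hBc : ContinuousOn B (Icc (t₀ - δ) (t₀ + δ))) (hB : HasDerivAt B B' t₀)
    (hg : ContinuousOn (fun q : ℝ × ℝ => g q.1 q.2)
      {q | q.1 ∈ Icc (t₀ - δ) (t₀ + δ) ∧ c ≤ q.2 ∧ q.2 ≤ B q.1})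
    (hg' : ContinuousOn (fun q : ℝ × ℝ => g' q.1 q.2)
      {q | q.1 ∈ Icc (t₀ - δ) (t₀ + δ) ∧ c ≤ q.2 ∧ q.2 ≤ B q.1})
    (hder : ∀ t ∈ Ioo (t₀ - δ) (t₀ + δ), ∀ s ∈ Ioo c (B t), HasDerivAt (fun τ => g τ s) (g' t s) t)
    (hx : IntegrableOn x (Ioc c d)) (hxc : ContinuousAt x (B t₀)) :
    HasDerivAt (fun t => ∫ s in c..B t, g t s * x s)
      (B' * (g t₀ (B t₀) * x (B t₀)) + ∫ s in c..B t₀, g' t₀ s * x s) t₀ := by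
  set R : Set (ℝ × ℝ) := {q | q.1 ∈ Icc (t₀ - δ) (t₀ + δ) ∧ c ≤ q.2 ∧ q.2 ≤ B q.1} with hR
  set κ := g t₀ (B t₀) * x (B t₀) with hκ
  have ht₀ : t₀ ∈ Icc (t₀ - δ) (t₀ + δ) := ⟨by linarith, by linarith⟩
  have hRc : IsCompact R := by
    have hc : IsClosed (Icc (t₀ - δ) (t₀ + δ) ×ˢ Icc c d : Set (ℝ × ℝ)) :=
      isClosed_Icc.prod isClosed_Icc
    have h2 := hc.isClosed_le continuousOn_snd
      (hBc.comp continuousOn_fst (fun q hq => hq.1) :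
        ContinuousOn (fun q : ℝ × ℝ => B q.1) (Icc (t₀ - δ) (t₀ + δ) ×ˢ Icc c d))
    refine IsCompact.of_isClosed_subset (s := (Icc (t₀ - δ) (t₀ + δ) ×ˢ Icc c d : Set (ℝ × ℝ)))
      (isCompact_Icc.prod isCompact_Icc) ?_ (fun q hq => ⟨hq.1, hq.2.1, hq.2.2.trans (hBd _ hq.1)⟩)
    convert h2 using 1
    ext q
    exact ⟨fun hq => ⟨⟨hq.1, hq.2.1, hq.2.2.trans (hBd _ hq.1)⟩, hq.2.2⟩,
      fun hq => ⟨hq.1.1, hq.1.2.1, hq.2⟩⟩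
  have hxI : ∀ u v, c ≤ u → v ≤ d → IntegrableOn x (Icc u v) := fun u v hu hv => by
    rw [integrableOn_Icc_iff_integrableOn_Ioc]
    exact hx.mono_set (Ioc_subset_Ioc hu hv)
  have hint : ∀ {k : ℝ → ℝ → ℝ}, ContinuousOn (fun q : ℝ × ℝ => k q.1 q.2) R →
      ∀ t ∈ Icc (t₀ - δ) (t₀ + δ), ∀ u v, u ∈ Icc c (B t) → v ∈ Icc c (B t) →
      IntervalIntegrable (fun s => k t s * x s) volume u v := by
    intro k hk t ht u v hu hv
    have huv : uIcc u v ⊆ Icc c (B t) := uIcc_subset_Icc hu hv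
    have h1 : IntegrableOn (fun s => k t s * x s) (Icc c (B t)) := by
      refine (hxI c (B t) le_rfl (hBd t ht)).continuousOn_mul ?_ isCompact_Icc
      exact hk.comp (f := fun s => (t, s)) (by fun_prop) (fun s hs => ⟨ht, hs.1, hs.2⟩)
    rw [intervalIntegrable_iff']
    exact h1.mono_set huv
  set X := ∫ s in Ioc c d, |x s| with hX
  have hX0 : 0 ≤ X := integral_nonneg fun _ => abs_nonneg _
  set L := |B'| + 1 with hL
  have hL1 : 1 ≤ L := by rw [hL]; linarith [abs_nonneg B']
  rw [hasDerivAt_iff_isLittleO, isLittleO_iff]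
  intro ε hε
  -- The denominator collects the constants of the five error bounds `E1`–`E5` below: `X`, `2L`,
  -- `L`, `1` and `|κ|`.
  set η := ε / (X + 3 * L + 1 + |κ|) with hη
  have hden : 0 < X + 3 * L + 1 + |κ| := by positivity
  have hη0 : 0 < η := by positivity
  -- uniform continuity of `g'`
  obtain ⟨r₁, hr₁, hu⟩ := Metric.uniformContinuousOn_iff.1
    (hRc.uniformContinuousOn_of_continuous hg') η hη0
  -- continuity of `g * x` at the end point
  have hcont : ∀ {k : ℝ → ℝ → ℝ}, ContinuousOn (fun q : ℝ × ℝ => k q.1 q.2) R →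
      ∀ e > 0, ∃ r > 0, ∀ t ∈ Icc (t₀ - δ) (t₀ + δ), ∀ s, |t - t₀| < r → |s - B t₀| < r →
        c ≤ s → s ≤ B t → |k t s * x s - k t₀ (B t₀) * x (B t₀)| ≤ e := by
    intro k hk e he
    have h1 : ContinuousWithinAt (fun q : ℝ × ℝ => k q.1 q.2 * x q.2) R (t₀, B t₀) := by
      refine (hk (t₀, B t₀) ⟨ht₀, (hcB t₀ ht₀).le, le_rfl⟩).mul ?_
      exact (ContinuousAt.comp (f := fun q : ℝ × ℝ => q.2) (x := (t₀, B t₀)) hxc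
        continuousAt_snd).continuousWithinAt
    obtain ⟨r, hr, h⟩ := Metric.continuousWithinAt_iff.1 h1 e he
    refine ⟨r, hr, fun t ht s h1 h2 h3 h4 => ?_⟩
    have := h (x := (t, s)) ⟨ht, h3, h4⟩ (by
      rw [Prod.dist_eq, Real.dist_eq, Real.dist_eq]; exact max_lt h1 h2)
    rw [Real.dist_eq] at this
    exact this.le
  obtain ⟨r₂, hr₂, hgx⟩ := hcont hg η hη0
  obtain ⟨r₃, hr₃, hgx'⟩ := hcont hg' 1 one_pos
  set M := |g' t₀ (B t₀) * x (B t₀)| + 1 with hM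
  have hM0 : 0 < M := by positivity
  -- control of `B`
  have hBo : ∀ᶠ t in 𝓝 t₀, |B t - B t₀ - (t - t₀) * B'| ≤ min 1 η * |t - t₀| := by
    have := (isLittleO_iff.1 (hasDerivAt_iff_isLittleO.1 hB)) (lt_min one_pos hη0)
    simpa [Real.norm_eq_abs] using this
  obtain ⟨r₄, hr₄, hB4⟩ := Metric.eventually_nhds_iff.1 hBo
  have hsmall : ∀ K > (0 : ℝ), ∀ e > (0 : ℝ), ∀ᶠ t in 𝓝 t₀, K * |t - t₀| < e := by
    intro K hK e he
    have : Tendsto (fun t => K * |t - t₀|) (𝓝 t₀) (𝓝 (K * |t₀ - t₀|)) :=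
      (by fun_prop : Continuous fun t => K * |t - t₀|).continuousAt
    simp only [sub_self, abs_zero, mul_zero] at this
    exact this.eventually (gt_mem_nhds he)
  filter_upwards [hsmall 1 one_pos r₁ hr₁, hsmall 1 one_pos r₂ hr₂, hsmall 1 one_pos r₄ hr₄,
    hsmall 1 one_pos δ hδ, hsmall L (by positivity) (B t₀ - c) (by linarith [hcB t₀ ht₀]),
    hsmall L (by positivity) r₂ hr₂, hsmall L (by positivity) r₃ hr₃,
    hsmall (M * L) (by positivity) η hη0] with t k1 k2 k4 kδ kc kL2 kL3 kM
  rw [one_mul] at k1 k2 k4 kδ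
  set h := t - t₀ with hh
  -- Since `B` changes by at most `L|h|` between `t₀` and `t`, every level below `b` stays under the
  -- curve for all intermediate times, so the mean value theorem applies there. What remains is a
  -- strip of width `O(|h|)`.
  set b := B t₀ - L * |h| with hb
  have hLh : 0 ≤ L * |h| := by positivity
  have ht : t ∈ Icc (t₀ - δ) (t₀ + δ) := by
    rw [hh, abs_lt] at kδ; exact ⟨by linarith [kδ.1], by linarith [kδ.2]⟩
  have hBτ : ∀ τ, |τ - t₀| ≤ |h| → |B τ - B t₀| ≤ L * |τ - t₀| := by
    intro τ hτ
    have h1 := hB4 (y := τ) (by rw [Real.dist_eq]; linarith)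
    have h2 : min 1 η * |τ - t₀| ≤ 1 * |τ - t₀| :=
      mul_le_mul_of_nonneg_right (min_le_left _ _) (abs_nonneg _)
    calc |B τ - B t₀| = |(B τ - B t₀ - (τ - t₀) * B') + (τ - t₀) * B'| := by ring_nf
      _ ≤ |B τ - B t₀ - (τ - t₀) * B'| + |(τ - t₀) * B'| := abs_add_le _ _
      _ ≤ 1 * |τ - t₀| + |τ - t₀| * |B'| := by rw [abs_mul]; linarith
      _ = L * |τ - t₀| := by rw [hL]; ring
  have hBt := hBτ t le_rfl
  rw [← hh] at hBt
  have hbt : b ≤ B t := by have := (abs_le.1 hBt).1; linarith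
  have hcb : c ≤ b := by linarith
  have hbB : b ≤ B t₀ := by linarith
  have hct := (hcB t ht).le
  have hct₀ := (hcB t₀ ht₀).le
  have hb1 : b ∈ Icc c (B t) := ⟨hcb, hbt⟩
  have hb2 : b ∈ Icc c (B t₀) := ⟨hcb, hbB⟩
  -- decomposition
  have i1 := hint hg t ht c b ⟨le_rfl, hct⟩ hb1
  have i2 := hint hg t ht b (B t) hb1 ⟨hct, le_rfl⟩
  have i3 := hint hg t₀ ht₀ c b ⟨le_rfl, hct₀⟩ hb2
  have i4 := hint hg t₀ ht₀ b (B t₀) hb2 ⟨hct₀, le_rfl⟩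
  have i5 := hint hg' t₀ ht₀ c b ⟨le_rfl, hct₀⟩ hb2
  have i6 := hint hg' t₀ ht₀ b (B t₀) hb2 ⟨hct₀, le_rfl⟩
  -- Removing the end-point value `κ` from both strip integrals leaves `κ (B t - B t₀)`, which is
  -- matched against `h B' κ`.
  have e1 : (∫ s in c..B t, g t s * x s) - (∫ s in c..B t₀, g t₀ s * x s)
      - h • (B' * κ + ∫ s in c..B t₀, g' t₀ s * x s) =
      (∫ s in c..b, (g t s * x s - g t₀ s * x s - h * (g' t₀ s * x s)))
      + (∫ s in b..B t, (g t s * x s - κ)) - (∫ s in b..B t₀, (g t₀ s * x s - κ))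
      - h * (∫ s in b..B t₀, g' t₀ s * x s) + κ * (B t - B t₀ - h * B') := by
    rw [intervalIntegral.integral_sub (i1.sub i3) (i5.const_mul h),
      intervalIntegral.integral_sub i1 i3, intervalIntegral.integral_const_mul,
      intervalIntegral.integral_sub i2 intervalIntegrable_const,
      intervalIntegral.integral_sub i4 intervalIntegrable_const,
      intervalIntegral.integral_const, intervalIntegral.integral_const,
      ← intervalIntegral.integral_add_adjacent_intervals i1 i2,
      ← intervalIntegral.integral_add_adjacent_intervals i3 i4,
      ← intervalIntegral.integral_add_adjacent_intervals i5 i6]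
    simp only [smul_eq_mul]
    ring
  rw [e1]
  have E1 : |∫ s in c..b, (g t s * x s - g t₀ s * x s - h * (g' t₀ s * x s))| ≤ η * |h| * X := by
    have hxab : IntervalIntegrable (fun s => η * |h| * |x s|) volume c b := by
      rw [intervalIntegrable_iff_integrableOn_Ioc_of_le hcb]
      exact ((hx.mono_set (Ioc_subset_Ioc_right (hbB.trans (hBd _ ht₀)))).norm).const_mul _
    have hle : ∫ s in c..b, η * |h| * |x s| ≤ η * |h| * X := by
      rw [intervalIntegral.integral_const_mul, intervalIntegral.integral_of_le hcb]
      refine mul_le_mul_of_nonneg_left ?_ (by positivity)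
      exact setIntegral_mono_set hx.norm (Eventually.of_forall fun _ => abs_nonneg _)
        (Ioc_subset_Ioc_right (hbB.trans (hBd _ ht₀))).eventuallyLE
    refine le_trans ?_ hle
    rw [← Real.norm_eq_abs]
    refine intervalIntegral.norm_integral_le_of_norm_le hcb ?_ hxab
    filter_upwards [Measure.ae_ne volume b] with s hsb hs
    have hs' : s < b := lt_of_le_of_ne hs.2 hsb
    have hmv : |g t s - g t₀ s - h * g' t₀ s| ≤ η * |h| := by
      have hseg : ∀ τ ∈ uIcc t₀ t, |τ - t₀| ≤ |h| := fun τ hτ => abs_sub_left_of_mem_uIcc hτ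
      have hsB : ∀ τ ∈ uIcc t₀ t, s < B τ := by
        intro τ hτ
        have h1 := (abs_le.1 (hBτ τ (hseg τ hτ))).1
        have h2 : L * |τ - t₀| ≤ L * |h| :=
          mul_le_mul_of_nonneg_left (hseg τ hτ) (by positivity)
        linarith
      have hτm : ∀ τ ∈ uIcc t₀ t, τ ∈ Ioo (t₀ - δ) (t₀ + δ) := by
        intro τ hτ
        have := abs_lt.1 ((hseg τ hτ).trans_lt kδ)
        exact ⟨by linarith [this.1], by linarith [this.2]⟩
      -- The mean value inequality is applied to `g τ s - τ g'(t₀, s)`, whose derivative is at most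
      -- `η` by uniform continuity of `g'`.
      have := (convex_uIcc t₀ t).norm_image_sub_le_of_norm_hasDerivWithin_le
        (f := fun τ => g τ s - τ * g' t₀ s) (f' := fun τ => g' τ s - 1 * g' t₀ s) (C := η)
        (x := t₀) (y := t)
        (fun τ hτ => ((hder τ (hτm τ hτ) s ⟨hs.1, hsB τ hτ⟩).sub
          ((hasDerivAt_id τ).mul_const _)).hasDerivWithinAt)
        (fun τ hτ => by
          have h3 := hu (τ, s) ⟨Ioo_subset_Icc_self (hτm τ hτ), hs.1.le, (hsB τ hτ).le⟩ (t₀, s)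
            ⟨ht₀, hs.1.le, (hsB t₀ left_mem_uIcc).le⟩ (by
              rw [Prod.dist_eq, Real.dist_eq, dist_self]
              exact max_lt ((hseg τ hτ).trans_lt k1) hr₁)
          rw [Real.dist_eq] at h3
          rw [one_mul, Real.norm_eq_abs]; exact h3.le)
        left_mem_uIcc right_mem_uIcc
      rw [Real.norm_eq_abs, Real.norm_eq_abs] at this
      calc |g t s - g t₀ s - h * g' t₀ s|
          = |g t s - t * g' t₀ s - (g t₀ s - t₀ * g' t₀ s)| := by rw [hh]; ring_nf
        _ ≤ η * |h| := this
    calc ‖g t s * x s - g t₀ s * x s - h * (g' t₀ s * x s)‖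
        = |g t s - g t₀ s - h * g' t₀ s| * |x s| := by
          rw [Real.norm_eq_abs, ← abs_mul]; ring_nf
      _ ≤ η * |h| * |x s| := mul_le_mul_of_nonneg_right hmv (abs_nonneg _)
  have near : ∀ s, b < s → s ≤ B t₀ + L * |h| → |s - B t₀| ≤ L * |h| := fun s h1 h2 =>
    abs_le.2 ⟨by linarith, by linarith⟩
  have hBtle : B t ≤ B t₀ + L * |h| := by have := (abs_le.1 hBt).2; linarith
  have E2 : |∫ s in b..B t, (g t s * x s - κ)| ≤ η * (2 * L * |h|) := by
    rw [← Real.norm_eq_abs]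
    refine (intervalIntegral.norm_integral_le_of_norm_le_const (C := η) ?_).trans ?_
    · intro s hs
      rw [uIoc_of_le hbt] at hs
      exact hgx t ht s k2 ((near s hs.1 (hs.2.trans hBtle)).trans_lt kL2) (hcb.trans hs.1.le) hs.2
    · rw [abs_of_nonneg (by linarith)]
      exact mul_le_mul_of_nonneg_left (by linarith) hη0.le
  have E3 : |∫ s in b..B t₀, (g t₀ s * x s - κ)| ≤ η * (L * |h|) := by
    rw [← Real.norm_eq_abs]
    refine (intervalIntegral.norm_integral_le_of_norm_le_const (C := η) ?_).trans ?_
    · intro s hs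
      rw [uIoc_of_le hbB] at hs
      exact hgx t₀ ht₀ s (by simpa using hr₂) ((near s hs.1 (by linarith [hs.2])).trans_lt kL2)
        (hcb.trans hs.1.le) hs.2
    · rw [abs_of_nonneg (by linarith)]
      exact mul_le_mul_of_nonneg_left (by linarith) hη0.le
  have E4 : |h * ∫ s in b..B t₀, g' t₀ s * x s| ≤ η * |h| := by
    rw [abs_mul, mul_comm]
    refine mul_le_mul_of_nonneg_right ?_ (abs_nonneg _)
    rw [← Real.norm_eq_abs]
    refine (intervalIntegral.norm_integral_le_of_norm_le_const (C := M) ?_).trans ?_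
    · intro s hs
      rw [uIoc_of_le hbB] at hs
      have := hgx' t₀ ht₀ s (by simpa using hr₃) ((near s hs.1 (by linarith [hs.2])).trans_lt kL3)
        (hcb.trans hs.1.le) hs.2
      have h2 := abs_sub_abs_le_abs_sub (g' t₀ s * x s) (g' t₀ (B t₀) * x (B t₀))
      rw [Real.norm_eq_abs]; linarith
    · rw [abs_of_nonneg (by linarith)]
      have : M * (B t₀ - b) = M * L * |h| := by rw [hb]; ring
      linarith
  have E5 : |κ * (B t - B t₀ - h * B')| ≤ |κ| * (η * |h|) := by
    rw [abs_mul]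
    refine mul_le_mul_of_nonneg_left ?_ (abs_nonneg _)
    have h1 := hB4 (y := t) (by rw [Real.dist_eq]; exact k4)
    exact h1.trans (mul_le_mul_of_nonneg_right (min_le_right _ _) (abs_nonneg _))
  have hfin : η * |h| * X + η * (2 * L * |h|) + η * (L * |h|) + η * |h| + |κ| * (η * |h|)
      = ε * |h| := by
    have : ε = η * (X + 3 * L + 1 + |κ|) := by rw [hη]; field_simp
    rw [this]; ring
  rw [Real.norm_eq_abs, Real.norm_eq_abs, ← hfin]
  refine (abs_add_le _ _).trans (add_le_add ?_ E5)
  refine (abs_sub _ _).trans (add_le_add ?_ E4)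
  refine (abs_sub _ _).trans (add_le_add ?_ E3)
  exact (abs_add_le _ _).trans (add_le_add E1 E2)

/-- The reflection `s ↦ -s` turns a moving lower end into a moving upper one. -/
theorem hasDerivAt_integral_moving_lower {g g' : ℝ → ℝ → ℝ} {A x : ℝ → ℝ} {A' c d t₀ δ : ℝ}
    (hδ : 0 < δ) (hcA : ∀ t ∈ Icc (t₀ - δ) (t₀ + δ), A t < c)
    (hAd : ∀ t ∈ Icc (t₀ - δ) (t₀ + δ), d ≤ A t)
    (hAc : ContinuousOn A (Icc (t₀ - δ) (t₀ + δ))) (hA : HasDerivAt A A' t₀)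
    (hg : ContinuousOn (fun q : ℝ × ℝ => g q.1 q.2)
      {q | q.1 ∈ Icc (t₀ - δ) (t₀ + δ) ∧ A q.1 ≤ q.2 ∧ q.2 ≤ c})
    (hg' : ContinuousOn (fun q : ℝ × ℝ => g' q.1 q.2)
      {q | q.1 ∈ Icc (t₀ - δ) (t₀ + δ) ∧ A q.1 ≤ q.2 ∧ q.2 ≤ c})
    (hder : ∀ t ∈ Ioo (t₀ - δ) (t₀ + δ), ∀ s ∈ Ioo (A t) c, HasDerivAt (fun τ => g τ s) (g' t s) t)
    (hx : IntegrableOn x (Icc d c)) (hxc : ContinuousAt x (A t₀)) :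
    HasDerivAt (fun t => ∫ s in A t..c, g t s * x s)
      (-A' * (g t₀ (A t₀) * x (A t₀)) + ∫ s in A t₀..c, g' t₀ s * x s) t₀ := by
  have hneg : ∀ {k : ℝ → ℝ → ℝ}, ContinuousOn (fun q : ℝ × ℝ => k q.1 q.2)
      {q | q.1 ∈ Icc (t₀ - δ) (t₀ + δ) ∧ A q.1 ≤ q.2 ∧ q.2 ≤ c} →
      ContinuousOn (fun q : ℝ × ℝ => k q.1 (-q.2))
        {q | q.1 ∈ Icc (t₀ - δ) (t₀ + δ) ∧ -c ≤ q.2 ∧ q.2 ≤ -A q.1} := fun hk =>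
    hk.comp (f := fun q : ℝ × ℝ => (q.1, -q.2)) (by fun_prop)
      (fun q hq => ⟨hq.1, by have := hq.2.2; simp only; linarith,
        by have := hq.2.1; simp only; linarith⟩)
  have := hasDerivAt_integral_moving_upper (g := fun t s => g t (-s)) (g' := fun t s => g' t (-s))
    (B := fun t => -A t) (x := fun s => x (-s)) (B' := -A') (c := -c) (d := -d) hδ
    (fun t ht => neg_lt_neg (hcA t ht)) (fun t ht => neg_le_neg (hAd t ht)) hAc.neg hA.neg
    (hneg hg) (hneg hg')
    (fun t ht s hs => hder t ht (-s) ⟨by linarith [hs.2], by linarith [hs.1]⟩)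
    (by
      have h1 : IntegrableOn (fun s => x (-s)) (Icc (-c) (-d)) := by
        have := (Measure.measurePreserving_neg (volume : Measure ℝ)).integrableOn_comp_preimage
          (Homeomorph.neg ℝ).measurableEmbedding (f := x) (s := Icc d c)
        rw [← this] at hx
        have hset : Icc (-c) (-d) = Homeomorph.neg ℝ ⁻¹' Icc d c := by
          ext s
          simp only [mem_Icc, mem_preimage, Homeomorph.coe_neg]
          constructor <;> rintro ⟨h1, h2⟩ <;> constructor <;> linarith
        rw [hset]
        exact hx
      exact h1.mono_set Ioc_subset_Icc_self)
    (by
      refine ContinuousAt.comp (g := x) (f := fun s => -s) ?_ continuousAt_neg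
      rwa [neg_neg])
  simp only [neg_neg] at this
  convert this using 1
  · funext t
    have h := intervalIntegral.integral_comp_neg (fun s => g t s * x s) (a := -c) (b := -A t)
    simpa using h.symm
  · have h := intervalIntegral.integral_comp_neg (fun s => g' t₀ s * x s) (a := -c) (b := -A t₀)
    simp only [neg_neg] at h
    rw [h]

/-! ### Equivalence of the equation with its derivative. -/

namespace VolterraData.Standing

variable {P : VolterraData} {T' : ℝ}

/-- A level `c` strictly between the two curves at `t₀` separates the moving ends, so that each part
has one frozen end and falls under a one-sided Leibniz rule. -/
theorem hasDerivAt_sectorIntegral (hP : P.Standing T') {i : ℕ} (hi : i ∈ Finset.Icc 1 P.n)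
    {x : ℝ → ℝ} (hx : IntegrableOn x (Ioc 0 T')) (hxc : ContinuousOn x (Ioc 0 T'))
    {t₀ : ℝ} (ht₀ : t₀ ∈ Ioo 0 T') :
    HasDerivAt (fun t => ∫ s in (P.α (i - 1) t)..(P.α i t), P.K i t s * x s)
      (P.α' i t₀ * (P.K i t₀ (P.α i t₀) * x (P.α i t₀))
        - P.α' (i - 1) t₀ * (P.K i t₀ (P.α (i - 1) t₀) * x (P.α (i - 1) t₀))
        + ∫ s in (P.α (i - 1) t₀)..(P.α i t₀), P.Kt i t₀ s * x s) t₀ := by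
  have hi' := Finset.mem_Icc.1 hi
  have hin := hi'.2
  have ht₀' : t₀ ∈ Ioc 0 T' := ⟨ht₀.1, ht₀.2.le⟩
  have ht₀'' : t₀ ∈ Icc 0 T' := ⟨ht₀.1.le, ht₀.2.le⟩
  have hxat : ∀ s ∈ Ioo 0 T', ContinuousAt x s := fun s hs =>
    hxc.continuousAt (mem_of_superset (Ioo_mem_nhds hs.1 hs.2) Ioo_subset_Ioc_self)
  have hlt : ∀ t ∈ Ioc 0 T', P.α (i - 1) t < P.α i t := fun t ht => by
    have := hP.α_lt (i - 1) (by omega) t ht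
    rwa [Nat.sub_add_cancel hi'.1] at this
  have hBlt : P.α i t₀ < T' := (hP.α_le_self hin ht₀'').trans_lt ht₀.2
  have hBpos : 0 < P.α i t₀ := hP.α_pos hi'.1 hin ht₀'
  have hxIcc : IntegrableOn x (Icc 0 T') := by rwa [integrableOn_Icc_iff_integrableOn_Ioc]
  have hwin : ∀ {p : ℝ → Prop}, (∀ᶠ t in 𝓝 t₀, p t) →
      ∃ δ > 0, ∀ t ∈ Icc (t₀ - δ) (t₀ + δ), p t := by
    intro p hp
    obtain ⟨δ, hδ, h⟩ := Metric.eventually_nhds_iff.1 hp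
    refine ⟨δ / 2, by positivity, fun t ht => h ?_⟩
    rw [Real.dist_eq, abs_lt]
    constructor <;> linarith [ht.1, ht.2]
  have hIoo : ∀ᶠ t in 𝓝 t₀, t ∈ Ioo 0 T' := Ioo_mem_nhds ht₀.1 ht₀.2
  -- upper part, from a level `c` in the closed sector
  have upper : ∀ c, 0 ≤ c → c < P.α i t₀ → (∀ᶠ t in 𝓝 t₀, P.α (i - 1) t ≤ c) →
      HasDerivAt (fun t => ∫ s in c..P.α i t, P.K i t s * x s)
        (P.α' i t₀ * (P.K i t₀ (P.α i t₀) * x (P.α i t₀)) +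
          ∫ s in c..P.α i t₀, P.Kt i t₀ s * x s) t₀ := by
    intro c hc0 hc hAc
    have hcB := (hP.α_hasDerivAt hin ht₀).continuousAt.eventually (lt_mem_nhds hc)
    obtain ⟨δ, hδ, hw⟩ := hwin (hIoo.and (hAc.and hcB))
    have hsub : {q : ℝ × ℝ | q.1 ∈ Icc (t₀ - δ) (t₀ + δ) ∧ c ≤ q.2 ∧ q.2 ≤ P.α i q.1} ⊆
        P.closedSector T' i := fun q hq =>
      ⟨Ioo_subset_Icc_self (hw _ hq.1).1, (hw _ hq.1).2.1.trans hq.2.1, hq.2.2⟩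
    refine hasDerivAt_integral_moving_upper (d := T') hδ (fun t ht => (hw t ht).2.2) ?_
      ((hP.α_continuousOn hin).mono fun t ht => Ioo_subset_Icc_self (hw t ht).1)
      (hP.α_hasDerivAt hin ht₀) ((hP.K_cont i hi).mono hsub) ((hP.Kt_cont i hi).mono hsub) ?_
      (hx.mono_set (Ioc_subset_Ioc_left hc0)) (hxat _ ⟨hBpos, hBlt⟩)
    · intro t ht
      have := (hw t ht).1
      exact (hP.α_le_self hin ⟨this.1.le, this.2.le⟩).trans this.2.le
    · intro t ht s hs
      have := hw t (Ioo_subset_Icc_self ht)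
      exact hP.K_deriv i hi t this.1 s ⟨this.2.1.trans_lt hs.1, hs.2⟩
  -- If the lower curve is at zero then `i = 1` and the lower end is constant. This case is separate
  -- because `x` need not be continuous at `0`; the boundary term disappears through `α_0' = 0`.
  rcases (hP.α_nonneg (i := i - 1) (by omega) ht₀'').eq_or_lt with h0 | h0
  · have hi1 : i = 1 := by
      by_contra hne
      exact absurd h0 (hP.α_pos (i := i - 1) (by omega) (by omega) ht₀').ne
    subst hi1
    have h00 : ∀ᶠ t in 𝓝 t₀, P.α (1 - 1) t = 0 := by
      filter_upwards [hIoo] with t ht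
      exact hP.α_zero t (Ioo_subset_Icc_self ht)
    have := upper 0 le_rfl hBpos (h00.mono fun t ht => ht.le)
    refine (this.congr_of_eventuallyEq (h00.mono fun t ht => ?_)).congr_deriv ?_
    · simp only [ht]
    · rw [← h0]
      simp [hP.α'_zero ht₀'']
  · obtain ⟨c, hc1, hc2⟩ := exists_between (hlt t₀ ht₀')
    have hA := hP.α_hasDerivAt (i := i - 1) (by omega) ht₀
    have hAc := hA.continuousAt.eventually (gt_mem_nhds hc1)
    have hcB := (hP.α_hasDerivAt hin ht₀).continuousAt.eventually (lt_mem_nhds hc2)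
    have hup := upper c (h0.trans hc1).le hc2 (hAc.mono fun t ht => ht.le)
    obtain ⟨δ, hδ, hw⟩ := hwin (hIoo.and (hAc.and hcB))
    have hsub : {q : ℝ × ℝ | q.1 ∈ Icc (t₀ - δ) (t₀ + δ) ∧ P.α (i - 1) q.1 ≤ q.2 ∧ q.2 ≤ c} ⊆
        P.closedSector T' i := fun q hq =>
      ⟨Ioo_subset_Icc_self (hw _ hq.1).1, hq.2.1, hq.2.2.trans (hw _ hq.1).2.2.le⟩
    have hlow := hasDerivAt_integral_moving_lower (x := x) (g := P.K i) (g' := P.Kt i) (d := 0) hδ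
      (fun t ht => (hw t ht).2.1)
      (fun t ht => hP.α_nonneg (by omega) (Ioo_subset_Icc_self (hw t ht).1))
      ((hP.α_continuousOn (by omega)).mono fun t ht => Ioo_subset_Icc_self (hw t ht).1)
      hA ((hP.K_cont i hi).mono hsub) ((hP.Kt_cont i hi).mono hsub)
      (fun t ht s hs => by
        have := hw t (Ioo_subset_Icc_self ht)
        exact hP.K_deriv i hi t this.1 s ⟨hs.1, hs.2.trans this.2.2⟩)
      (hxIcc.mono_set (Icc_subset_Icc_right (hc2.le.trans hBlt.le)))
      (hxat _ ⟨h0, (hc1.trans hc2).trans hBlt⟩)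
    have hsplit : ∀ {k : ℝ → ℝ → ℝ},
        ContinuousOn (fun q : ℝ × ℝ => k q.1 q.2) (P.closedSector T' i) →
        ∀ t ∈ Icc 0 T', P.α (i - 1) t ≤ c → c ≤ P.α i t →
        (∫ s in (P.α (i - 1) t)..(P.α i t), k t s * x s) =
          (∫ s in (P.α (i - 1) t)..c, k t s * x s) + ∫ s in c..(P.α i t), k t s * x s := by
      intro k hk t ht h1 h2
      have hI := hP.intervalIntegrable_mul hin hk hx ht
      refine (intervalIntegral.integral_add_adjacent_intervals (hI.mono_set ?_)
        (hI.mono_set ?_)).symm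
      · rw [uIcc_of_le h1, uIcc_of_le (h1.trans h2)]; exact Icc_subset_Icc_right h2
      · rw [uIcc_of_le h2, uIcc_of_le (h1.trans h2)]; exact Icc_subset_Icc_left h1
    refine ((hlow.add hup).congr_of_eventuallyEq ?_).congr_deriv ?_
    · filter_upwards [hIoo, hAc, hcB] with t h1 h2 h3
      exact hsplit (hP.K_cont i hi) t (Ioo_subset_Icc_self h1) h2.le h3.le
    · rw [hsplit (hP.Kt_cont i hi) t₀ ht₀'' hc1.le hc2.le]
      ring

/-- The line `s = 0` lies on the boundary of the first sector, where differentiability is not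
assumed. The interior derivatives converge uniformly as `s → +0`, by uniform continuity on the
compact sector, so the limit may be differentiated. -/
theorem hasDerivAt_K_zero (hP : P.Standing T') {t₀ : ℝ} (ht₀ : t₀ ∈ Ioo 0 T') :
    HasDerivAt (fun t => P.K 1 t 0) (P.Kt 1 t₀ 0) t₀ := by
  have hn := hP.n_pos
  have h1 : (1 : ℕ) ∈ Finset.Icc 1 P.n := by simpa using hn
  have ht₀'' : t₀ ∈ Icc 0 T' := ⟨ht₀.1.le, ht₀.2.le⟩
  have hpos := hP.α_pos le_rfl hn ⟨ht₀.1, ht₀.2.le⟩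
  obtain ⟨c, hc0, hc⟩ := exists_between hpos
  have hev : ∀ᶠ t in 𝓝 t₀, t ∈ Ioo 0 T' ∧ c < P.α 1 t :=
    Eventually.and (Ioo_mem_nhds ht₀.1 ht₀.2)
      ((hP.α_hasDerivAt hn ht₀).continuousAt.eventually (lt_mem_nhds hc))
  obtain ⟨r, hr, hball⟩ := Metric.eventually_nhds_iff_ball.1 hev
  have hmem : ∀ t ∈ Metric.ball t₀ r, ∀ s ∈ Icc 0 c, (t, s) ∈ P.closedSector T' 1 := by
    intro t ht s hs
    have hb := hball t ht
    refine ⟨Ioo_subset_Icc_self hb.1, ?_, hs.2.trans hb.2.le⟩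
    simp only [Nat.sub_self, hP.α_zero t (Ioo_subset_Icc_self hb.1)]
    exact hs.1
  have huc := (hP.isCompact_closedSector hn).uniformContinuousOn_of_continuous (hP.Kt_cont 1 h1)
  refine hasDerivAt_of_tendstoUniformlyOn (l := 𝓝[>] (0 : ℝ)) (s := Metric.ball t₀ r)
    (f := fun s t => P.K 1 t s) (f' := fun s t => P.Kt 1 t s) (g' := fun t => P.Kt 1 t 0)
    Metric.isOpen_ball ?_ ?_ ?_ (Metric.mem_ball_self hr)
  · rw [Metric.tendstoUniformlyOn_iff]
    intro e he
    obtain ⟨d, hd, hd'⟩ := Metric.uniformContinuousOn_iff.1 huc e he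
    filter_upwards [Ioo_mem_nhdsGT (lt_min hc0 hd)] with s hs t ht
    refine hd' (t, 0) (hmem t ht 0 ⟨le_rfl, hc0.le⟩) (t, s)
      (hmem t ht s ⟨hs.1.le, (hs.2.trans_le (min_le_left _ _)).le⟩) ?_
    rw [Prod.dist_eq, dist_self, Real.dist_eq, zero_sub, abs_neg, abs_of_pos hs.1]
    exact max_lt hd (hs.2.trans_le (min_le_right _ _))
  · filter_upwards [Ioo_mem_nhdsGT hc0] with s hs t ht
    have hb := hball t ht
    refine hP.K_deriv 1 h1 t hb.1 s ⟨?_, hs.2.trans hb.2⟩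
    simp only [Nat.sub_self, hP.α_zero t (Ioo_subset_Icc_self hb.1)]
    exact hs.1
  · intro t ht
    have hK := hP.K_cont 1 h1 (t, 0) (hmem t ht 0 ⟨le_rfl, hc0.le⟩)
    refine Tendsto.comp (f := fun s => (t, s)) hK (tendsto_nhdsWithin_iff.2 ⟨?_, ?_⟩)
    · exact tendsto_nhdsWithin_of_tendsto_nhds
        (by fun_prop : Continuous fun s : ℝ => (t, s)).continuousAt
    · filter_upwards [Ioo_mem_nhdsGT hc0] with s hs
      exact hmem t ht s ⟨hs.1.le, hs.2.le⟩

/-- The boundary terms of neighbouring sectors combine into the terms with the jumps of the kernels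
along the curves. -/
theorem sum_boundary (hP : P.Standing T') (x : ℝ → ℝ) {t : ℝ} (ht : t ∈ Icc 0 T') :
    ∑ i ∈ Finset.Icc 1 P.n, (P.α' i t * (P.K i t (P.α i t) * x (P.α i t))
        - P.α' (i - 1) t * (P.K i t (P.α (i - 1) t) * x (P.α (i - 1) t))) =
      P.K P.n t t * x t + ∑ i ∈ Finset.Icc 1 (P.n - 1),
        P.α' i t * (P.K i t (P.α i t) - P.K (i + 1) t (P.α i t)) * x (P.α i t) := by
  obtain ⟨m, hm⟩ : ∃ m, P.n = m + 1 := ⟨P.n - 1, by have := hP.n_pos; omega⟩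
  have hlast := hP.α'_last ht
  have hα := hP.α_last t ht
  have key : ∀ (u w : ℕ → ℝ) (m : ℕ), ∑ i ∈ Finset.Icc 1 (m + 1), (u i - w i) =
      u (m + 1) - w 1 + ∑ i ∈ Finset.Icc 1 m, (u i - w (i + 1)) := by
    intro u w m
    induction m with
    | zero => simp
    | succ m ih =>
      rw [Finset.sum_Icc_succ_top (by omega), ih, Finset.sum_Icc_succ_top (by omega : 1 ≤ m + 1)]
      ring
  rw [hm] at hlast hα ⊢
  rw [key (fun i => P.α' i t * (P.K i t (P.α i t) * x (P.α i t)))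
    (fun i => P.α' (i - 1) t * (P.K i t (P.α (i - 1) t) * x (P.α (i - 1) t)))]
  simp only [hlast, hα, Nat.sub_self, hP.α'_zero ht, Nat.add_sub_cancel]
  rw [one_mul, zero_mul, sub_zero]
  congr 1
  exact Finset.sum_congr rfl fun i _ => by ring

theorem hasDerivAt_lhs (hP : P.Standing T') {x : ℝ → ℝ} (hx : IntegrableOn x (Ioc 0 T'))
    (hxc : ContinuousOn x (Ioc 0 T')) (a : ℝ) {t : ℝ} (ht : t ∈ Ioo 0 T') :
    HasDerivAt (fun t => a * P.K 1 t 0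
        + ∑ i ∈ Finset.Icc 1 P.n, ∫ s in (P.α (i - 1) t)..(P.α i t), P.K i t s * x s)
      (a * P.Kt 1 t 0 + P.F x t) t := by
  have h1 := HasDerivAt.fun_sum fun i hi => hP.hasDerivAt_sectorIntegral hi hx hxc ht
  refine (((hP.hasDerivAt_K_zero ht).const_mul a).add h1).congr_deriv ?_
  rw [Finset.sum_add_distrib, hP.sum_boundary x (Ioo_subset_Icc_self ht), F]

theorem continuousOn_lhs (hP : P.Standing T') {x : ℝ → ℝ} (hx : IntegrableOn x (Ioc 0 T'))
    (a : ℝ) :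
    ContinuousOn (fun t => a * P.K 1 t 0
      + ∑ i ∈ Finset.Icc 1 P.n, ∫ s in (P.α (i - 1) t)..(P.α i t), P.K i t s * x s)
      (Icc 0 T') := by
  have h1 : (1 : ℕ) ∈ Finset.Icc 1 P.n := by simpa using hP.n_pos
  refine ContinuousOn.add (continuousOn_const.mul ?_) (continuousOn_finsetSum _ fun i hi =>
    hP.continuousOn_sectorIntegral (Finset.mem_Icc.1 hi).2 (hP.K_cont i hi) hx)
  refine (hP.continuousOn_lower hP.n_pos (hP.K_cont 1 h1)).congr fun t ht => ?_
  simp only [Nat.sub_self, hP.α_zero t ht]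

theorem f_continuousOn (hP : P.Standing T') : ContinuousOn P.f (Icc 0 T') :=
  fun t ht => (hP.f_deriv t ht).continuousWithinAt

theorem lhs_zero (hP : P.Standing T') (x : ℝ → ℝ) (a : ℝ) :
    a * P.K 1 0 0 + ∑ i ∈ Finset.Icc 1 P.n,
      ∫ s in (P.α (i - 1) 0)..(P.α i 0), P.K i 0 s * x s = a * P.K 1 0 0 := by
  rw [Finset.sum_eq_zero, add_zero]
  intro i hi
  have := Finset.mem_Icc.1 hi
  rw [hP.α_at_zero i this.2, hP.α_at_zero (i - 1) (by omega), intervalIntegral.integral_same]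

/-- If the differentiated equation holds, so does the original one. -/
theorem lhs_eq_of_F_eq (hP : P.Standing T') (hK : P.K 1 0 0 ≠ 0) {x : ℝ → ℝ}
    (hx : IntegrableOn x (Ioc 0 T')) (hxc : ContinuousOn x (Ioc 0 T'))
    (h : ∀ t ∈ Ioo 0 T', P.F x t = P.rhs t) {t : ℝ} (ht : t ∈ Icc 0 T') :
    P.a * P.K 1 t 0
      + ∑ i ∈ Finset.Icc 1 P.n, ∫ s in (P.α (i - 1) t)..(P.α i t), P.K i t s * x s = P.f t := by
  -- The defect of the equation has zero derivative and is continuous up to `0`, where the choice of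
  -- `a` makes it vanish.
  have hd : ∀ s ∈ Ioo 0 T', HasDerivAt (fun t => (P.a * P.K 1 t 0
      + ∑ i ∈ Finset.Icc 1 P.n, ∫ s in (P.α (i - 1) t)..(P.α i t), P.K i t s * x s) - P.f t)
      0 s := by
    intro s hs
    have hf := (hP.f_deriv s (Ioo_subset_Icc_self hs)).hasDerivAt (Icc_mem_nhds hs.1 hs.2)
    refine ((hP.hasDerivAt_lhs hx hxc P.a hs).sub hf).congr_deriv ?_
    rw [h s hs, rhs]; ring
  have hc := (hP.continuousOn_lhs hx P.a).sub hP.f_continuousOn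
  rcases ht.1.eq_or_lt with h0 | h0
  · subst h0
    rw [hP.lhs_zero, a, div_mul_cancel₀ _ hK]
  obtain ⟨s, hs, hs'⟩ := exists_hasDerivAt_eq_slope _ (fun _ => (0 : ℝ)) h0
    (hc.mono (Icc_subset_Icc_right ht.2))
    (fun s hs => hd s ⟨hs.1, hs.2.trans_le ht.2⟩)
  have h0' := hP.lhs_zero x P.a
  rw [eq_comm, div_eq_zero_iff] at hs'
  have hfa : P.a * P.K 1 0 0 = P.f 0 := div_mul_cancel₀ _ hK
  simp only [Pi.sub_apply] at hs'
  rcases hs' with hs' | hs'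
  · linarith
  · linarith

theorem F_eq_of_lhs_eq (hP : P.Standing T') {x : ℝ → ℝ}
    (hx : IntegrableOn x (Ioc 0 T')) (hxc : ContinuousOn x (Ioc 0 T'))
    (h : ∀ t ∈ Ioo 0 T', P.a * P.K 1 t 0
      + ∑ i ∈ Finset.Icc 1 P.n, ∫ s in (P.α (i - 1) t)..(P.α i t), P.K i t s * x s = P.f t)
    {t : ℝ} (ht : t ∈ Ioo 0 T') : P.F x t = P.rhs t := by
  have hf := (hP.f_deriv t (Ioo_subset_Icc_self ht)).hasDerivAt (Icc_mem_nhds ht.1 ht.2)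
  have h1 := (hP.hasDerivAt_lhs hx hxc P.a ht).congr_of_eventuallyEq
    (f₁ := P.f) (by
      filter_upwards [Ioo_mem_nhds ht.1 ht.2] with s hs
      exact (h s hs).symm)
  have := h1.unique hf
  rw [rhs]; linarith

end VolterraData.Standing

/-! ### Calculus of expansions in powers of `t` and `ln t`. -/

/-- Functions that are `O(t^ρ (1 + |ln t|)^k)` for some `k` as `t → +0`. -/
noncomputable def logBigO (ρ : ℕ) : Submodule ℝ (ℝ → ℝ) where
  carrier := {g | ∃ k : ℕ, g =O[𝓝[>] 0] fun t => t ^ ρ * (1 + |Real.log t|) ^ k}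
  zero_mem' := ⟨0, isBigO_zero _ _⟩
  add_mem' := by
    rintro g h ⟨k, hk⟩ ⟨l, hl⟩
    have hmono : ∀ m n : ℕ, m ≤ n → (fun t : ℝ => t ^ ρ * (1 + |Real.log t|) ^ m) =O[𝓝[>] 0]
        fun t => t ^ ρ * (1 + |Real.log t|) ^ n := fun m n hmn => by
      refine (isBigO_refl _ _).mul (IsBigO.of_bound 1 (Eventually.of_forall fun t => ?_))
      have h1 : 1 ≤ 1 + |Real.log t| := by linarith [abs_nonneg (Real.log t)]
      rw [Real.norm_of_nonneg (by positivity), Real.norm_of_nonneg (by positivity), one_mul]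
      exact pow_le_pow_right₀ h1 hmn
    exact ⟨max k l, (hk.trans (hmono _ _ (le_max_left _ _))).add
      (hl.trans (hmono _ _ (le_max_right _ _)))⟩
  smul_mem' := by
    rintro c g ⟨k, hk⟩
    exact ⟨k, hk.const_mul_left c⟩

theorem mem_logBigO_of_isBigO {ρ : ℕ} {g : ℝ → ℝ} (h : g =O[𝓝[>] 0] fun t => t ^ ρ) :
    g ∈ logBigO ρ := ⟨0, by simpa using h⟩

theorem logBigO_mul_mem {ρ σ : ℕ} {g h : ℝ → ℝ} (hg : g ∈ logBigO ρ) (hh : h ∈ logBigO σ) :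
    g * h ∈ logBigO (ρ + σ) := by
  obtain ⟨k, hk⟩ := hg
  obtain ⟨l, hl⟩ := hh
  refine ⟨k + l, (hk.mul hl).congr_right fun t => ?_⟩
  ring

theorem logBigO_anti {ρ σ : ℕ} (h : ρ ≤ σ) : logBigO σ ≤ logBigO ρ := by
  rintro g ⟨k, hk⟩
  refine ⟨k, hk.trans ((IsBigO.of_bound 1 ?_).mul (isBigO_refl _ _))⟩
  filter_upwards [Ioo_mem_nhdsGT (zero_lt_one' ℝ)] with t ht
  rw [Real.norm_of_nonneg (pow_nonneg ht.1.le _), Real.norm_of_nonneg (pow_nonneg ht.1.le _),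
    one_mul]
  exact pow_le_pow_of_le_one ht.1.le ht.2.le h

theorem logBigO_congr {ρ : ℕ} {g h : ℝ → ℝ} (hg : g ∈ logBigO ρ) (hgh : g =ᶠ[𝓝[>] 0] h) :
    h ∈ logBigO ρ := by
  obtain ⟨k, hk⟩ := hg
  exact ⟨k, hgh.symm.trans_isBigO hk⟩

theorem pow_mul_log_pow_mem_logBigO (j k : ℕ) : (fun t => t ^ j * Real.log t ^ k) ∈ logBigO j := by
  refine ⟨k, (isBigO_refl _ _).mul (IsBigO.of_bound 1 (Eventually.of_forall fun t => ?_))⟩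
  rw [norm_pow, norm_pow, one_mul]
  refine pow_le_pow_left₀ (norm_nonneg _) ?_ _
  rw [Real.norm_eq_abs, Real.norm_of_nonneg (by positivity)]
  linarith

theorem isLittleO_one_add_abs_log_pow (k : ℕ) {r : ℝ} (hr : r < 0) :
    (fun t : ℝ => (1 + |Real.log t|) ^ k) =o[𝓝[>] 0] fun t : ℝ => t ^ r := by
  have h1 : (fun t : ℝ => (1 + |Real.log t|) ^ k) =O[𝓝[>] 0] fun t => |Real.log t| ^ k := by
    refine IsBigO.pow (IsBigO.of_bound 2 ?_) k
    have : ∀ᶠ t in 𝓝[>] (0 : ℝ), Real.log t ≤ -1 :=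
      Real.tendsto_log_nhdsGT_zero.eventually (eventually_le_atBot (-1))
    filter_upwards [this] with t ht
    rw [Real.norm_of_nonneg (by positivity), Real.norm_of_nonneg (by positivity),
      abs_of_nonpos (by linarith)]
    linarith
  have h2 := isLittleO_abs_log_rpow_rpow_nhdsGT_zero (s := r) k hr
  exact h1.trans_isLittleO (by simpa using h2)

theorem tendsto_mul_log_pow (k : ℕ) :
    Tendsto (fun t : ℝ => t * (1 + |Real.log t|) ^ k) (𝓝[>] 0) (𝓝 0) := by
  have h3 := isLittleO_one_add_abs_log_pow k (r := -1) (by norm_num)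
  have h4 := (isBigO_refl (fun t : ℝ => t) (𝓝[>] 0)).mul_isLittleO h3
  refine (isLittleO_one_iff ℝ).1 (h4.congr' EventuallyEq.rfl ?_)
  filter_upwards [self_mem_nhdsWithin] with t ht
  rw [Real.rpow_neg_one, mul_inv_cancel₀ (ne_of_gt ht)]

theorem isLittleO_of_mem_logBigO {ρ : ℕ} {g : ℝ → ℝ} (hg : g ∈ logBigO (ρ + 1)) :
    g =o[𝓝[>] 0] fun t => t ^ ρ := by
  obtain ⟨k, hk⟩ := hg
  refine hk.trans_isLittleO ?_
  have h := (isBigO_refl (fun t : ℝ => t ^ ρ) (𝓝[>] 0)).mul_isLittleO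
    ((isLittleO_one_iff ℝ).2 (tendsto_mul_log_pow k))
  refine h.congr (fun t => by ring) (fun t => by ring)

theorem tendsto_zero_of_mem_logBigO {g : ℝ → ℝ} (hg : g ∈ logBigO 1) :
    Tendsto g (𝓝[>] 0) (𝓝 0) := by
  have := isLittleO_of_mem_logBigO (ρ := 0) hg
  simp only [pow_zero] at this
  exact (isLittleO_one_iff ℝ).1 this

/-- Functions with an expansion in powers `t^j (ln t)^k`, `j ≥ m`, up to a remainder in
`logBigO N`. -/
noncomputable def logExp (N m : ℕ) : Submodule ℝ (ℝ → ℝ) :=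
  Submodule.span ℝ {g | ∃ j k : ℕ, m ≤ j ∧ g = fun t => t ^ j * Real.log t ^ k} ⊔ logBigO N

theorem logBigO_le_logExp (N m : ℕ) : logBigO N ≤ logExp N m := le_sup_right

theorem logExp_anti {N m n : ℕ} (h : m ≤ n) : logExp N n ≤ logExp N m := by
  refine sup_le_sup_right (Submodule.span_mono ?_) _
  rintro g ⟨j, k, hj, rfl⟩
  exact ⟨j, k, h.trans hj, rfl⟩

theorem pow_mul_log_pow_mem_logExp (N : ℕ) {m j : ℕ} (hj : m ≤ j) (k : ℕ) :
    (fun t => t ^ j * Real.log t ^ k) ∈ logExp N m :=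
  Submodule.mem_sup_left (Submodule.subset_span ⟨j, k, hj, rfl⟩)

theorem span_le_logBigO (m : ℕ) :
    Submodule.span ℝ {g : ℝ → ℝ | ∃ j k : ℕ, m ≤ j ∧ g = fun t => t ^ j * Real.log t ^ k} ≤
      logBigO m := by
  rw [Submodule.span_le]
  rintro g ⟨j, k, hj, rfl⟩
  exact logBigO_anti hj (pow_mul_log_pow_mem_logBigO j k)

theorem logExp_le_logBigO {N m : ℕ} (h : m ≤ N) : logExp N m ≤ logBigO m :=
  sup_le (span_le_logBigO m) (logBigO_anti h)

/-- At order `N` every explicit term is already of the size of the remainder, so the expansions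
carry no information from there on. -/
theorem logExp_self (N : ℕ) : logExp N N = logBigO N :=
  le_antisymm (logExp_le_logBigO le_rfl) (logBigO_le_logExp N N)

theorem logExp_congr {N m : ℕ} {g h : ℝ → ℝ} (hg : g ∈ logExp N m) (hgh : g =ᶠ[𝓝[>] 0] h) :
    h ∈ logExp N m := by
  have : h - g ∈ logBigO N := logBigO_congr (Submodule.zero_mem _) (by
    filter_upwards [hgh] with t ht
    simp [ht])
  have := add_mem hg (logBigO_le_logExp N m this)
  simpa using this

/-- Products of explicit terms are explicit. Any product involving a remainder is again a remainder,
because the other factor is bounded by a power of the logarithm. -/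
theorem logExp_mul_mem {N a b : ℕ} {g h : ℝ → ℝ} (hg : g ∈ logExp N a) (hh : h ∈ logExp N b) :
    g * h ∈ logExp N (a + b) := by
  have hle : logExp N a * logExp N b ≤ logExp N (a + b) := by
    have hS : ∀ {U V : Submodule ℝ (ℝ → ℝ)} {ρ σ : ℕ}, U ≤ logBigO ρ → V ≤ logBigO σ →
        N ≤ ρ + σ → U * V ≤ logExp N (a + b) := fun hU hV hN =>
      Submodule.mul_le.2 fun u hu v hv =>
        logBigO_le_logExp N _ (logBigO_anti hN (logBigO_mul_mem (hU hu) (hV hv)))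
    rw [logExp, logExp, Submodule.sup_mul, Submodule.mul_sup, Submodule.mul_sup,
      Submodule.span_mul_span]
    refine sup_le (sup_le ?_ ?_) (sup_le ?_ ?_)
    · rw [Submodule.span_le]
      rintro _ ⟨_, ⟨j, k, hj, rfl⟩, _, ⟨j', k', hj', rfl⟩, rfl⟩
      have := pow_mul_log_pow_mem_logExp N (add_le_add hj hj') (k + k')
      have he : ((fun t => t ^ j * Real.log t ^ k) * fun t => t ^ j' * Real.log t ^ k') =
          fun t => t ^ (j + j') * Real.log t ^ (k + k') := by
        funext t
        simp only [Pi.mul_apply]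
        ring
      rw [← he] at this
      exact this
    · exact hS (span_le_logBigO a) le_rfl (by omega)
    · exact hS le_rfl (span_le_logBigO b) (by omega)
    · exact hS le_rfl le_rfl (by omega)
  exact hle (Submodule.mul_mem_mul hg hh)

theorem zero_mem_logExp (N m : ℕ) : (fun _ => (0 : ℝ)) ∈ logExp N m := (logExp N m).zero_mem

theorem const_mem_logExp (N : ℕ) (c : ℝ) : (fun _ => c) ∈ logExp N 0 := by
  have := (logExp N 0).smul_mem c (pow_mul_log_pow_mem_logExp N (le_refl 0) 0)
  convert this using 1
  funext t
  simp

theorem id_mem_logExp (N : ℕ) : (fun t => t) ∈ logExp N 1 := by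
  simpa using pow_mul_log_pow_mem_logExp N (le_refl 1) 0

theorem log_mem_logExp (N : ℕ) : Real.log ∈ logExp N 0 := by
  simpa using pow_mul_log_pow_mem_logExp N (le_refl 0) 1

theorem logExp_mul_left {N b : ℕ} {g h : ℝ → ℝ} (hg : g ∈ logExp N 0) (hh : h ∈ logExp N b) :
    g * h ∈ logExp N b := by simpa using logExp_mul_mem hg hh

theorem logExp_mul_right {N a : ℕ} {g h : ℝ → ℝ} (hg : g ∈ logExp N a) (hh : h ∈ logExp N 0) :
    g * h ∈ logExp N a := by simpa using logExp_mul_mem hg hh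

theorem logExp_const_mul {N a : ℕ} {g : ℝ → ℝ} (c : ℝ) (hg : g ∈ logExp N a) :
    (fun t => c * g t) ∈ logExp N a := (logExp N a).smul_mem c hg

theorem logExp_pow_mem {N a : ℕ} {g : ℝ → ℝ} (hg : g ∈ logExp N a) (k : ℕ) :
    g ^ k ∈ logExp N (k * a) := by
  induction k with
  | zero => rw [pow_zero, zero_mul]; exact const_mem_logExp N 1
  | succ k ih => rw [pow_succ, Nat.succ_mul]; exact logExp_mul_mem ih hg

theorem of_sub_const_mem_logExp {N : ℕ} {g : ℝ → ℝ} {c : ℝ}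
    (hg : (fun t => g t - c) ∈ logExp N 1) : g ∈ logExp N 0 := by
  have := add_mem (logExp_anti (zero_le_one' ℕ) hg) (const_mem_logExp N c)
  convert this using 1
  funext t; simp

/-- Uses `g h - c e = g (h - e) + (g - c) e`. It replaces a coefficient by its value at zero and a
function by its leading part in one move. -/
theorem sub_mem_of_mul {N a b : ℕ} {g h : ℝ → ℝ} {c : ℝ} (hg : (fun t => g t - c) ∈ logExp N b)
    {e : ℝ → ℝ} (hh : (fun t => h t - e t) ∈ logExp N (a + b)) (he : e ∈ logExp N a) :
    (fun t => g t * h t - c * e t) ∈ logExp N (a + b) := by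
  have hg0 : g ∈ logExp N 0 := by
    have := add_mem (logExp_anti (Nat.zero_le b) hg) (const_mem_logExp N c)
    convert this using 1
    funext t; simp
  have h1 := logExp_mul_left hg0 hh
  have h2 := logExp_mul_mem he hg
  convert add_mem h1 h2 using 1
  funext t
  simp only [Pi.add_apply, Pi.mul_apply]
  ring

theorem eval_sub_mem_logExp (N : ℕ) (p : ℝ[X]) :
    (fun t => p.eval t - p.eval 0) ∈ logExp N 1 := by
  induction p using Polynomial.induction_on' with
  | add p q hp hq =>
    convert add_mem hp hq using 1
    funext t; simp only [Polynomial.eval_add, Pi.add_apply]; ring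
  | monomial n a =>
    rcases n with _ | n
    · simpa using zero_mem_logExp N 1
    · have := logExp_const_mul a (pow_mul_log_pow_mem_logExp N (show 1 ≤ n + 1 by omega) 0)
      convert this using 1
      funext t; simp

theorem mvEval_sub_mem_logExp {N : ℕ} (p : MvPolynomial (Fin 2) ℝ) {g h : ℝ → ℝ}
    (hg : g ∈ logExp N 1) (hh : h ∈ logExp N 1) :
    (fun t => MvPolynomial.eval ![g t, h t] p - MvPolynomial.eval ![0, 0] p) ∈ logExp N 1 := by
  induction p using MvPolynomial.induction_on with
  | C a => simpa using zero_mem_logExp N 1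
  | add p q hp hq =>
    convert add_mem hp hq using 1
    funext t; simp only [map_add, Pi.add_apply]; ring
  | mul_X p i hp =>
    have hp0 := of_sub_const_mem_logExp hp
    have hi : (fun t => ![g t, h t] i) ∈ logExp N 1 := by
      fin_cases i
      · exact hg
      · exact hh
    convert logExp_mul_left hp0 hi using 1
    funext t
    have h0 : (![0, 0] : Fin 2 → ℝ) i = 0 := by fin_cases i <;> rfl
    simp [h0]

/-- The Taylor sum of the logarithm up to degree `N` is a polynomial in `h`. Once `|h| < 1/2`, the
remainder is at most `2|h|^(N+1)`, hence negligible. -/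
theorem log_one_add_mem_logExp {N : ℕ} (hN : 1 ≤ N) {h : ℝ → ℝ} (hh : h ∈ logExp N 1) :
    (fun t => Real.log (1 + h t)) ∈ logExp N 1 := by
  have hlim := tendsto_zero_of_mem_logBigO (logExp_le_logBigO hN hh)
  have hsum : (fun t => -∑ i ∈ Finset.range N, (-h t) ^ (i + 1) / ((i : ℝ) + 1)) ∈
      logExp N 1 := by
    have : (fun t => -∑ i ∈ Finset.range N, (-h t) ^ (i + 1) / ((i : ℝ) + 1)) =
        -∑ i ∈ Finset.range N, ((i : ℝ) + 1)⁻¹ • (-h) ^ (i + 1) := by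
      funext t
      simp only [Pi.neg_apply, Finset.sum_apply, Pi.smul_apply, Pi.pow_apply, smul_eq_mul,
        div_eq_inv_mul]
    rw [this]
    refine neg_mem (sum_mem fun i _ => Submodule.smul_mem _ _ ?_)
    exact logExp_anti (by omega) (logExp_pow_mem (neg_mem hh) (i + 1))
  have hrem : (fun t => Real.log (1 + h t)
      - (-∑ i ∈ Finset.range N, (-h t) ^ (i + 1) / ((i : ℝ) + 1))) ∈ logBigO N := by
    have hpow : h ^ (N + 1) ∈ logBigO N := by
      have h1 : logExp N ((N + 1) * 1) ≤ logBigO N := by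
        rw [← logExp_self]; exact logExp_anti (by omega)
      exact h1 (logExp_pow_mem hh (N + 1))
    obtain ⟨k, hk⟩ := hpow
    refine ⟨k, IsBigO.trans (IsBigO.of_bound 2 ?_) hk⟩
    have hev : ∀ᶠ t in 𝓝[>] (0 : ℝ), |h t| < 1 / 2 := by
      have := hlim.abs
      rw [abs_zero] at this
      exact this.eventually (gt_mem_nhds (by norm_num))
    filter_upwards [hev] with t ht
    have := Real.abs_log_sub_add_sum_range_le (x := -h t) (by rw [abs_neg]; linarith) N
    rw [sub_neg_eq_add, abs_neg, add_comm] at this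
    rw [Real.norm_eq_abs, sub_neg_eq_add, Pi.pow_apply, norm_pow, Real.norm_eq_abs]
    refine this.trans ?_
    rw [div_le_iff₀ (by linarith)]
    have : 0 ≤ |h t| ^ (N + 1) := by positivity
    nlinarith
  convert add_mem hsum (logBigO_le_logExp N 1 hrem) using 1
  funext t
  simp only [Pi.add_apply]
  ring

/-- Separation of the leading term of an expansion. -/
theorem exists_leading_of_mem_logExp {N m : ℕ} {g : ℝ → ℝ} (hg : g ∈ logExp N m) :
    ∃ y : ℝ[X], (fun t => g t - t ^ m * y.eval (Real.log t)) ∈ logExp N (m + 1) := by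
  obtain ⟨u, hu, r, hr, rfl⟩ := Submodule.mem_sup.1 hg
  have hr' := logBigO_le_logExp N (m + 1) hr
  suffices h : ∃ y : ℝ[X], (fun t => u t - t ^ m * y.eval (Real.log t)) ∈ logExp N (m + 1) by
    obtain ⟨y, hy⟩ := h
    refine ⟨y, ?_⟩
    convert add_mem hy hr' using 1
    funext t; simp only [Pi.add_apply]; ring
  induction hu using Submodule.span_induction with
  | mem u hu =>
    obtain ⟨j, k, hj, rfl⟩ := hu
    rcases hj.eq_or_lt with rfl | hj
    · exact ⟨Polynomial.X ^ k, by simpa using zero_mem_logExp N (m + 1)⟩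
    · exact ⟨0, by simpa using pow_mul_log_pow_mem_logExp N hj k⟩
  | zero => exact ⟨0, by simpa using zero_mem_logExp N (m + 1)⟩
  | add u v hu' hv' hu hv =>
    obtain ⟨y, hy⟩ := hu (add_mem (Submodule.mem_sup_left hu') (Submodule.mem_sup_right hr))
    obtain ⟨z, hz⟩ := hv (add_mem (Submodule.mem_sup_left hv') (Submodule.mem_sup_right hr))
    refine ⟨y + z, ?_⟩
    convert add_mem hy hz using 1
    funext t; simp only [Pi.add_apply, Polynomial.eval_add]; ring
  | smul c u hu' hu =>
    obtain ⟨y, hy⟩ := hu (add_mem (Submodule.mem_sup_left hu') (Submodule.mem_sup_right hr))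
    refine ⟨Polynomial.C c * y, ?_⟩
    convert logExp_const_mul c hy using 1
    funext t; simp only [Pi.smul_apply, smul_eq_mul, Polynomial.eval_mul, Polynomial.eval_C]; ring

theorem eval_log_mem_logExp (N m : ℕ) (y : ℝ[X]) :
    (fun t => t ^ m * y.eval (Real.log t)) ∈ logExp N m := by
  induction y using Polynomial.induction_on' with
  | add p q hp hq =>
    convert add_mem hp hq using 1
    funext t; simp only [Polynomial.eval_add, Pi.add_apply]; ring
  | monomial n a =>
    convert logExp_const_mul a (pow_mul_log_pow_mem_logExp N (le_refl m) n) using 1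
    funext t; simp only [Polynomial.eval_monomial]; ring

theorem pow_sub_pow_mem_logExp {N : ℕ} {u w : ℝ → ℝ} (hu : u ∈ logExp N 0)
    (h : (fun t => w t - u t) ∈ logExp N 1) (k : ℕ) :
    (fun t => w t ^ k - u t ^ k) ∈ logExp N 1 := by
  have hw : w ∈ logExp N 0 := by
    convert add_mem (logExp_anti (zero_le_one' ℕ) h) hu using 1
    funext t; simp
  induction k with
  | zero => simpa using zero_mem_logExp N 1
  | succ k ih =>
    have h2 := logExp_pow_mem hu k
    rw [mul_zero] at h2
    convert add_mem (logExp_mul_left hw ih) (logExp_mul_left h2 h) using 1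
    funext t
    simp only [Pi.add_apply, Pi.mul_apply, Pi.pow_apply]
    ring

/-- Near zero every power of the logarithm is dominated by the integrable function `t^(-1/2)`. -/
theorem integrableOn_of_mem_logBigO {g : ℝ → ℝ} {T : ℝ} (hT : 0 < T)
    (hc : ContinuousOn g (Ioc 0 T)) (hg : g ∈ logBigO 0) : IntegrableOn g (Ioc 0 T) := by
  obtain ⟨k, hk⟩ := hg
  have h1 := (hk.congr_right fun t => by rw [pow_zero, one_mul]).trans_isLittleO
    (isLittleO_one_add_abs_log_pow k (r := -1 / 2) (by norm_num))
  have h2 : ∀ᶠ t in 𝓝[>] (0 : ℝ), ‖g t‖ ≤ 1 * ‖t ^ (-1 / 2 : ℝ)‖ := h1.bound one_pos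
  obtain ⟨r, hr, hr'⟩ := mem_nhdsGT_iff_exists_Ioo_subset.1 h2
  set c := min (r / 2) T with hcdef
  have hr0 : (0 : ℝ) < r := hr
  have hc0 : 0 < c := lt_min (by positivity) hT
  have hcT : c ≤ T := min_le_right _ _
  rw [← Ioc_union_Ioc_eq_Ioc hc0.le hcT]
  refine IntegrableOn.union ?_ ?_
  · have hI : IntegrableOn (fun t : ℝ => t ^ (-1 / 2 : ℝ)) (Ioc 0 c) := by
      rw [← intervalIntegrable_iff_integrableOn_Ioc_of_le hc0.le]
      exact intervalIntegral.intervalIntegrable_rpow' (by norm_num)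
    refine Integrable.mono hI ((hc.mono (Ioc_subset_Ioc_right hcT)).aestronglyMeasurable
      measurableSet_Ioc) ?_
    filter_upwards [ae_restrict_mem measurableSet_Ioc] with t ht
    have := hr' (⟨ht.1, ht.2.trans_lt ((min_le_left _ _).trans_lt (by linarith))⟩ : t ∈ Ioo 0 r)
    simpa using this
  · rw [← integrableOn_Icc_iff_integrableOn_Ioc]
    exact (hc.mono fun t ht => ⟨hc0.trans_le ht.1, ht.2⟩).integrableOn_Icc

/-- Integration by parts lowers the power of the logarithm: the antiderivative for `k + 1` is
`(t^(b+1) ln^(k+1) t - (k+1) ∫ t^b ln^k t) / (b+1)`. -/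
theorem exists_antideriv_pow_mul_log_pow (b k : ℕ) :
    ∃ Q : ℝ[X], ∀ t > 0, HasDerivAt (fun t => t ^ (b + 1) * Q.eval (Real.log t))
      (t ^ b * Real.log t ^ k) t := by
  have hb : (b : ℝ) + 1 ≠ 0 := by positivity
  induction k with
  | zero =>
    refine ⟨Polynomial.C (1 / ((b : ℝ) + 1)), fun t ht => ?_⟩
    simp only [Polynomial.eval_C]
    refine ((hasDerivAt_pow (b + 1) t).mul_const _).congr_deriv ?_
    push_cast
    field_simp
  | succ k ih =>
    obtain ⟨Q, hQ⟩ := ih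
    refine ⟨Polynomial.C (1 / ((b : ℝ) + 1)) * (Polynomial.X ^ (k + 1)
      - Polynomial.C ((k : ℝ) + 1) * Q), fun t ht => ?_⟩
    have h1 := (hasDerivAt_pow (b + 1) t).mul ((Real.hasDerivAt_log ht.ne').pow (k + 1))
    have h2 := (h1.sub ((hQ t ht).const_mul ((k : ℝ) + 1))).const_mul (1 / ((b : ℝ) + 1))
    have h3 : (fun t : ℝ => t ^ (b + 1) * (Polynomial.C (1 / ((b : ℝ) + 1)) * (Polynomial.X ^ (k + 1)
      - Polynomial.C ((k : ℝ) + 1) * Q)).eval (Real.log t)) = fun t => 1 / ((b : ℝ) + 1) *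
        (t ^ (b + 1) * Real.log t ^ (k + 1) -
          ((k : ℝ) + 1) * (t ^ (b + 1) * Q.eval (Real.log t))) := by
      funext t
      simp only [Polynomial.eval_mul, Polynomial.eval_sub, Polynomial.eval_C, Polynomial.eval_pow,
        Polynomial.eval_X]
      ring
    rw [h3]
    refine h2.congr_deriv ?_
    push_cast
    simp only [Pi.pow_apply]
    field_simp
    ring

theorem exists_antideriv_pow_mul_eval_log (b : ℕ) (y : ℝ[X]) :
    ∃ Q : ℝ[X], ∀ t > 0, HasDerivAt (fun t => t ^ (b + 1) * Q.eval (Real.log t))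
      (t ^ b * y.eval (Real.log t)) t := by
  induction y using Polynomial.induction_on' with
  | add p q hp hq =>
    obtain ⟨P, hP⟩ := hp
    obtain ⟨Q, hQ⟩ := hq
    refine ⟨P + Q, fun t ht => ?_⟩
    simp only [Polynomial.eval_add, mul_add]
    exact (hP t ht).add (hQ t ht)
  | monomial n a =>
    obtain ⟨Q, hQ⟩ := exists_antideriv_pow_mul_log_pow b n
    refine ⟨Polynomial.C a * Q, fun t ht => ?_⟩
    simp only [Polynomial.eval_mul, Polynomial.eval_C, Polynomial.eval_monomial, mul_left_comm _ a]
    exact (hQ t ht).const_mul a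

theorem continuousOn_pow_mul_eval_log (b : ℕ) (y : ℝ[X]) :
    ContinuousOn (fun t => t ^ b * y.eval (Real.log t)) (Ioi 0) :=
  (continuousOn_pow b).mul (y.continuous.comp_continuousOn
    (Real.continuousOn_log.mono fun _ ht => ne_of_gt ht))

theorem integrableOn_pow_mul_eval_log (b : ℕ) (y : ℝ[X]) {T : ℝ} (hT : 0 < T) :
    IntegrableOn (fun t => t ^ b * y.eval (Real.log t)) (Ioc 0 T) :=
  integrableOn_of_mem_logBigO hT ((continuousOn_pow_mul_eval_log b y).mono fun _ ht => ht.1)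
    (logExp_le_logBigO le_rfl (logExp_anti (Nat.zero_le b) (eval_log_mem_logExp 0 b y)))

/-- An antiderivative of `s^b y(ln s)` of the form `s^(b+1) Q(ln s)`, down to `s = 0`. -/
theorem exists_integral_pow_mul_eval_log (b : ℕ) (y : ℝ[X]) :
    ∃ Q : ℝ[X], ∀ A B, 0 ≤ A → A ≤ B → (∫ s in A..B, s ^ b * y.eval (Real.log s)) =
      B ^ (b + 1) * Q.eval (Real.log B) - A ^ (b + 1) * Q.eval (Real.log A) := by
  obtain ⟨Q, hQ⟩ := exists_antideriv_pow_mul_eval_log b y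
  refine ⟨Q, fun A B hA hAB => ?_⟩
  rcases hAB.eq_or_lt with rfl | hAB'
  · simp
  refine intervalIntegral.integral_eq_sub_of_hasDerivAt_of_le hAB ?_
    (fun t ht => hQ t (hA.trans_lt ht.1)) ?_
  · intro t ht
    rcases (hA.trans ht.1).eq_or_lt with h | h
    · subst h
      -- The factor `0 ^ (b + 1)` makes the value at zero agree with this limit whatever `Real.log
      -- 0` is, so the antiderivative is continuous down to `A = 0`.
      have h0 : Tendsto (fun t => t ^ (b + 1) * Q.eval (Real.log t)) (𝓝[>] 0) (𝓝 0) :=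
        tendsto_zero_of_mem_logBigO (logExp_le_logBigO le_rfl
          (logExp_anti (by omega) (eval_log_mem_logExp 1 (b + 1) Q)))
      have h1 : ContinuousWithinAt (fun t => t ^ (b + 1) * Q.eval (Real.log t)) (Ioi 0) 0 := by
        simpa [ContinuousWithinAt] using h0
      exact (continuousWithinAt_Ioi_iff_Ici.1 h1).mono fun s hs => hA.trans hs.1
    · exact (hQ t h).continuousAt.continuousWithinAt
  · rw [intervalIntegrable_iff_integrableOn_Ioc_of_le hAB]
    exact (integrableOn_pow_mul_eval_log b y (hA.trans_lt hAB')).mono_set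
      (Ioc_subset_Ioc_left hA)

/-! ### Expansions of the data and the action of `F` on log-power terms. -/

namespace VolterraData

variable {P : VolterraData} {T' : ℝ} {N : ℕ}

theorem Standing.Ioo_mem_nhdsGT (hP : P.Standing T') : Ioo 0 T' ∈ 𝓝[>] (0 : ℝ) :=
  _root_.Ioo_mem_nhdsGT hP.T'_pos

theorem Standing.tendsto_nhdsGT (hP : P.Standing T') {g : ℝ → ℝ}
    (hg : ContinuousOn g (Icc 0 T')) : Tendsto g (𝓝[>] 0) (𝓝 (g 0)) :=
  ((hg 0 hP.zero_mem).mono_of_mem_nhdsWithin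
    (mem_of_superset hP.Ioo_mem_nhdsGT Ioo_subset_Icc_self)).tendsto

theorem isBigO_pow_tendsto_zero {g : ℝ → ℝ} {m : ℕ} (hm : m ≠ 0)
    (h : g =O[𝓝[>] 0] fun t => t ^ m) : Tendsto g (𝓝[>] 0) (𝓝 0) := by
  refine h.trans_tendsto ?_
  have : Tendsto (fun t : ℝ => t ^ m) (𝓝 0) (𝓝 (0 ^ m)) := (continuous_pow m).continuousAt
  rw [zero_pow hm] at this
  exact this.mono_left nhdsWithin_le_nhds

theorem α'_sub_mem_logExp (hP : P.Standing T') (hB : P.CondB T' N) (hN : 1 ≤ N) {i : ℕ}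
    (hi : i ∈ Finset.Icc 1 (P.n - 1)) : (fun t => P.α' i t - P.α' i 0) ∈ logExp N 1 := by
  obtain ⟨p, -, -, h⟩ := hB.α_taylor i hi
  have hin : i ≤ P.n := by have := Finset.mem_Icc.1 hi; omega
  -- Both sides are limits at zero, and their difference is `O(t^N)` with `N ≥ 1`.
  have h0 : P.α' i 0 = p.derivative.eval 0 := by
    have h1 := isBigO_pow_tendsto_zero (by omega) h
    have h2 := (hP.tendsto_nhdsGT (hP.α'_cont i hin)).sub
      ((p.derivative.continuous.tendsto 0).mono_left nhdsWithin_le_nhds)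
    linarith [tendsto_nhds_unique h1 h2]
  convert add_mem (logBigO_le_logExp N 1 (mem_logBigO_of_isBigO h))
    (eval_sub_mem_logExp N p.derivative) using 1
  funext t
  simp only [Pi.add_apply, h0]
  ring

/-- `α_i(t) = α_i'(0) t (1 + h(t))` with `h` of order at least one. -/
theorem exists_α_expansion (hP : P.Standing T') (hB : P.CondB T' N) (hN : 1 ≤ N) {i : ℕ}
    (hi : i ∈ Finset.Icc 1 P.n) :
    ∃ h ∈ logExp N 1, ∀ᶠ t in 𝓝[>] 0, P.α i t = P.α' i 0 * t * (1 + h t) := by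
  have hi' := Finset.mem_Icc.1 hi
  rcases eq_or_ne i P.n with rfl | hne
  · refine ⟨fun _ => 0, zero_mem_logExp N 1, ?_⟩
    filter_upwards [hP.Ioo_mem_nhdsGT] with t ht
    rw [hP.α_last t (Ioo_subset_Icc_self ht), hP.α'_last hP.zero_mem]
    ring
  have hin : i ∈ Finset.Icc 1 (P.n - 1) := by rw [Finset.mem_Icc]; omega
  have hapos := hP.α'_zero_pos hi'.1 hi'.2
  obtain ⟨p, -, h1, h2⟩ := hB.α_taylor i hin
  have hp0 : p.eval 0 = 0 := by
    have h3 := isBigO_pow_tendsto_zero (by omega) h1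
    have h4 := (hP.tendsto_nhdsGT (hP.α_continuousOn hi'.2)).sub
      ((p.continuous.tendsto 0).mono_left nhdsWithin_le_nhds)
    have := tendsto_nhds_unique h3 h4
    rw [hP.α_at_zero i hi'.2] at this
    linarith
  have hp1 : P.α' i 0 = p.divX.eval 0 := by
    have h3 := isBigO_pow_tendsto_zero (by omega) h2
    have h4 := (hP.tendsto_nhdsGT (hP.α'_cont i hi'.2)).sub
      ((p.derivative.continuous.tendsto 0).mono_left nhdsWithin_le_nhds)
    have := tendsto_nhds_unique h3 h4
    have h5 : p.derivative.eval 0 = p.divX.eval 0 := by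
      rw [← Polynomial.coeff_zero_eq_eval_zero, ← Polynomial.coeff_zero_eq_eval_zero,
        Polynomial.coeff_derivative, Polynomial.coeff_divX]
      simp
    linarith
  have hpX : ∀ t, p.eval t = t * p.divX.eval t := by
    intro t
    conv_lhs => rw [← Polynomial.divX_mul_X_add p]
    rw [Polynomial.coeff_zero_eq_eval_zero, hp0]
    simp [mul_comm]
  refine ⟨fun t => P.α i t / (P.α' i 0 * t) - 1, ?_, ?_⟩
  -- Division by `t` costs one order; the remainder `O(t^(N+1))` assumed for the curves leaves
  -- exactly the `O(t^N)` required.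
  · have hR : (fun t => (P.α i t - p.eval t) * t⁻¹) ∈ logBigO N := by
      refine mem_logBigO_of_isBigO ((h1.mul (isBigO_refl (fun t : ℝ => t⁻¹) _)).congr'
        EventuallyEq.rfl ?_)
      filter_upwards [self_mem_nhdsWithin] with t ht
      have : t ≠ 0 := ne_of_gt ht
      field_simp
      ring
    have hs := logExp_const_mul (P.α' i 0)⁻¹
      (add_mem (logBigO_le_logExp N 1 hR) (eval_sub_mem_logExp N p.divX))
    refine logExp_congr hs ?_
    filter_upwards [self_mem_nhdsWithin] with t ht
    have : t ≠ 0 := ne_of_gt ht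
    have hne : P.α' i 0 ≠ 0 := hapos.ne'
    simp only [Pi.add_apply]
    rw [← hp1, hpX]
    field_simp
    ring
  · filter_upwards [self_mem_nhdsWithin] with t ht
    have : t ≠ 0 := ne_of_gt ht
    have hne : P.α' i 0 ≠ 0 := hapos.ne'
    field_simp
    ring

theorem α_pow_sub_mem_logExp (hP : P.Standing T') (hB : P.CondB T' N) (hN : 1 ≤ N) {i : ℕ}
    (hi : i ∈ Finset.Icc 1 P.n) (j : ℕ) :
    (fun t => P.α i t ^ j - P.α' i 0 ^ j * t ^ j) ∈ logExp N (j + 1) := by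
  obtain ⟨h, hh, hev⟩ := exists_α_expansion hP hB hN hi
  have h1 : (fun t => (1 + h t) ^ j - (fun _ => (1 : ℝ)) t ^ j) ∈ logExp N 1 :=
    pow_sub_pow_mem_logExp (const_mem_logExp N 1) (by simpa using hh) j
  have h2 := logExp_mul_mem (pow_mul_log_pow_mem_logExp N (le_refl j) 0) h1
  refine logExp_congr (logExp_const_mul (P.α' i 0 ^ j) h2) ?_
  filter_upwards [hev] with t ht
  rw [ht, mul_pow, mul_pow]
  simp only [Pi.mul_apply]
  ring

theorem log_α_sub_mem_logExp (hP : P.Standing T') (hB : P.CondB T' N) (hN : 1 ≤ N) {i : ℕ}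
    (hi : i ∈ Finset.Icc 1 P.n) :
    (fun t => Real.log (P.α i t) - (Real.log t + Real.log (P.α' i 0))) ∈ logExp N 1 := by
  obtain ⟨h, hh, hev⟩ := exists_α_expansion hP hB hN hi
  have hi' := Finset.mem_Icc.1 hi
  have hapos := hP.α'_zero_pos hi'.1 hi'.2
  refine logExp_congr (log_one_add_mem_logExp hN hh) ?_
  filter_upwards [hev, hP.Ioo_mem_nhdsGT] with t ht ht'
  have hpos := hP.α_pos hi'.1 hi'.2 ⟨ht'.1, ht'.2.le⟩
  have hat : 0 < P.α' i 0 * t := mul_pos hapos ht'.1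
  have h1 : 0 < 1 + h t := by
    rw [ht] at hpos
    exact (mul_pos_iff_of_pos_left hat).1 hpos
  rw [ht, Real.log_mul hat.ne' h1.ne', Real.log_mul hapos.ne' ht'.1.ne']
  ring

/-- To leading order `α_i` is the dilation by `α_i'(0)`, which acts on polynomials in `ln t` as a
translation. This is the source of the Taylor shifts in `charOp`. -/
theorem logTerm_comp_α_sub_mem_logExp (hP : P.Standing T') (hB : P.CondB T' N) (hN : 1 ≤ N)
    {i : ℕ} (hi : i ∈ Finset.Icc 1 P.n) (m : ℕ) (y : ℝ[X]) :
    (fun t => P.α i t ^ m * y.eval (Real.log (P.α i t))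
      - P.α' i 0 ^ m * t ^ m * y.eval (Real.log t + Real.log (P.α' i 0))) ∈ logExp N (m + 1) := by
  have hu : (fun t => Real.log t + Real.log (P.α' i 0)) ∈ logExp N 0 :=
    add_mem (log_mem_logExp N) (const_mem_logExp N _)
  have hα := α_pow_sub_mem_logExp hP hB hN hi m
  have hα0 : (fun t => P.α i t ^ m) ∈ logExp N m := by
    convert add_mem (logExp_anti (Nat.le_succ m) hα) (logExp_const_mul (P.α' i 0 ^ m)
      (pow_mul_log_pow_mem_logExp N (le_refl m) 0)) using 1
    funext t; simp
  induction y using Polynomial.induction_on' with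
  | add p q hp hq =>
    convert add_mem hp hq using 1
    funext t; simp only [Polynomial.eval_add, Pi.add_apply]; ring
  | monomial k c =>
    have h1 := pow_sub_pow_mem_logExp hu (log_α_sub_mem_logExp hP hB hN hi) k
    have h2 := logExp_pow_mem hu k
    rw [mul_zero] at h2
    convert logExp_const_mul c (add_mem (logExp_mul_mem hα0 h1) (logExp_mul_right hα h2)) using 1
    funext t
    simp only [Polynomial.eval_monomial, Pi.add_apply, Pi.mul_apply, Pi.pow_apply]
    ring

theorem logTerm_comp_α_mem_logExp (hP : P.Standing T') (hB : P.CondB T' N) (hN : 1 ≤ N)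
    {i : ℕ} (hi : i ∈ Finset.Icc 1 P.n) (m : ℕ) (y : ℝ[X]) :
    (fun t => P.α i t ^ m * y.eval (Real.log (P.α i t))) ∈ logExp N m := by
  have h1 := eval_log_mem_logExp N m (Polynomial.taylor (Real.log (P.α' i 0)) y)
  convert add_mem (logExp_anti (Nat.le_succ m) (logTerm_comp_α_sub_mem_logExp hP hB hN hi m y))
    (logExp_const_mul (P.α' i 0 ^ m) h1) using 1
  funext t
  simp only [Pi.add_apply, Polynomial.taylor_eval]
  ring

/-- The exponent is kept positive so that the curve `α_0 = 0` can be included: its term is then zero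
rather than a constant. -/
theorem logTerm_comp_α_mem_logExp' (hP : P.Standing T') (hB : P.CondB T' N) (hN : 1 ≤ N)
    {i : ℕ} (hi : i ≤ P.n) (m : ℕ) (y : ℝ[X]) :
    (fun t => P.α i t ^ (m + 1) * y.eval (Real.log (P.α i t))) ∈ logExp N (m + 1) := by
  rcases Nat.eq_zero_or_pos i with rfl | h
  · refine logExp_congr (zero_mem_logExp N (m + 1)) ?_
    filter_upwards [hP.Ioo_mem_nhdsGT] with t ht
    rw [hP.α_zero t (Ioo_subset_Icc_self ht), zero_pow (by omega), zero_mul]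
  · exact logTerm_comp_α_mem_logExp hP hB hN (Finset.mem_Icc.2 ⟨h, hi⟩) (m + 1) y

theorem α_mem_logExp (hP : P.Standing T') (hB : P.CondB T' N) (hN : 1 ≤ N)
    {i : ℕ} (hi : i ≤ P.n) : P.α i ∈ logExp N 1 := by
  simpa using logTerm_comp_α_mem_logExp' hP hB hN hi 0 1

theorem tendsto_curve (hP : P.Standing T') {i l : ℕ} (hl : l = i - 1 ∨ l = i)
    (hi : i ∈ Finset.Icc 1 P.n) :
    Tendsto (fun t => (t, P.α l t)) (𝓝[>] 0) (𝓝[P.closedSector T' i] (0, 0)) := by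
  have hi' := Finset.mem_Icc.1 hi
  have hl' : l ≤ P.n := by omega
  refine tendsto_nhdsWithin_iff.2 ⟨?_, ?_⟩
  · have := hP.tendsto_nhdsGT (hP.α_continuousOn hl')
    rw [hP.α_at_zero l hl'] at this
    exact (tendsto_id.mono_left nhdsWithin_le_nhds).prodMk_nhds this
  · filter_upwards [hP.Ioo_mem_nhdsGT] with t ht
    rcases hl with rfl | rfl
    · exact hP.mem_closedSector_lower hi'.2 (Ioo_subset_Icc_self ht)
    · exact hP.mem_closedSector_upper hi'.2 (Ioo_subset_Icc_self ht)

theorem isBigO_add_α_pow (hP : P.Standing T') {l : ℕ} (hl : l ≤ P.n) (m : ℕ) :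
    (fun t => (t + P.α l t) ^ m) =O[𝓝[>] 0] fun t => t ^ m := by
  refine IsBigO.pow (IsBigO.of_bound 2 ?_) m
  filter_upwards [hP.Ioo_mem_nhdsGT] with t ht
  have h1 := hP.α_nonneg hl (Ioo_subset_Icc_self ht)
  have h2 := hP.α_le_self hl (Ioo_subset_Icc_self ht)
  rw [Real.norm_of_nonneg (by linarith [ht.1]), Real.norm_of_nonneg ht.1.le]
  linarith

theorem eval_along_curve_mem_logExp (hP : P.Standing T') (hB : P.CondB T' N) (hN : 1 ≤ N)
    {g : ℝ → ℝ → ℝ} {m i l : ℕ} (hm : N ≤ m) (hl : l = i - 1 ∨ l = i)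
    (hi : i ∈ Finset.Icc 1 P.n) {p : MvPolynomial (Fin 2) ℝ}
    (h : (fun q : ℝ × ℝ => g q.1 q.2 - MvPolynomial.eval ![q.1, q.2] p)
      =O[𝓝[P.closedSector T' i] (0, 0)] (fun q => (q.1 + q.2) ^ m)) :
    (fun t => g t (P.α l t) - MvPolynomial.eval ![0, 0] p) ∈ logExp N 1 := by
  have hi' := Finset.mem_Icc.1 hi
  have hl' : l ≤ P.n := by omega
  have h1 := (h.comp_tendsto (tendsto_curve hP hl hi)).trans (isBigO_add_α_pow hP hl' m)
  have h2 : (fun t => g t (P.α l t) - MvPolynomial.eval ![t, P.α l t] p) ∈ logExp N 1 :=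
    logBigO_le_logExp N 1 (logBigO_anti hm (mem_logBigO_of_isBigO h1))
  convert add_mem h2 (mvEval_sub_mem_logExp p (id_mem_logExp N) (α_mem_logExp hP hB hN hl'))
    using 1
  funext t; simp only [Pi.add_apply]; ring

theorem K_sub_mem_logExp (hP : P.Standing T') (hB : P.CondB T' N) (hN : 1 ≤ N)
    {i l : ℕ} (hl : l = i - 1 ∨ l = i) (hi : i ∈ Finset.Icc 1 P.n) :
    (fun t => P.K i t (P.α l t) - P.K i 0 0) ∈ logExp N 1 := by
  have hi' := Finset.mem_Icc.1 hi
  obtain ⟨p, -, h, -⟩ := hB.K_taylor i hi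
  -- The estimate can be read at the point `(0, 0)` itself, since this point belongs to the sector,
  -- and its right-hand side vanishes there.
  have h0 : P.K i 0 0 = MvPolynomial.eval ![0, 0] p := by
    have hmem : ((0 : ℝ), (0 : ℝ)) ∈ P.closedSector T' i := by
      have := hP.mem_closedSector_upper hi'.2 hP.zero_mem
      rwa [hP.α_at_zero i hi'.2] at this
    obtain ⟨c, hc⟩ := h.bound
    have := hc.self_of_nhdsWithin hmem
    simp only [add_zero, zero_pow (Nat.succ_ne_zero N), norm_zero, mul_zero, norm_le_zero_iff]
      at this
    linarith
  rw [h0]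
  exact eval_along_curve_mem_logExp hP hB hN (Nat.le_succ N) hl hi h

theorem rhs_mem_logExp (hP : P.Standing T') (hB : P.CondB T' N) (hN : 1 ≤ N) :
    P.rhs ∈ logExp N 0 := by
  have hn := hP.n_pos
  have h1 : (1 : ℕ) ∈ Finset.Icc 1 P.n := by simpa using hn
  obtain ⟨p, -, -, hf⟩ := hB.f_taylor
  obtain ⟨q, -, -, hq⟩ := hB.K_taylor 1 h1
  have hf' : P.f' ∈ logExp N 0 := by
    refine of_sub_const_mem_logExp (c := p.derivative.eval 0) ?_
    convert add_mem (logBigO_le_logExp N 1 (mem_logBigO_of_isBigO hf))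
      (eval_sub_mem_logExp N p.derivative) using 1
    funext t; simp only [Pi.add_apply]; ring
  have hq' := of_sub_const_mem_logExp
    (eval_along_curve_mem_logExp hP hB hN le_rfl (Or.inl rfl) h1 hq)
  refine logExp_congr (sub_mem hf' (logExp_const_mul P.a hq')) ?_
  filter_upwards [hP.Ioo_mem_nhdsGT] with t ht
  simp only [Pi.sub_apply, Nat.sub_self, hP.α_zero t (Ioo_subset_Icc_self ht), rhs]
  ring

/-- For a monomial the integral is explicit, and only boundary values `α^(b+1) Q(ln α)` on the two
curves appear. Integration in `s` produces the extra power of `t`. -/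
theorem sectorIntegral_mvEval_mem_logExp (hP : P.Standing T') (hB : P.CondB T' N) (hN : 1 ≤ N)
    {i : ℕ} (hi : i ∈ Finset.Icc 1 P.n) (p : MvPolynomial (Fin 2) ℝ) (m : ℕ) (y : ℝ[X]) :
    (fun t => ∫ s in (P.α (i - 1) t)..(P.α i t),
      MvPolynomial.eval ![t, s] p * (s ^ m * y.eval (Real.log s))) ∈ logExp N (m + 1) := by
  have hi' := Finset.mem_Icc.1 hi
  have hI := integrableOn_pow_mul_eval_log m y hP.T'_pos
  induction p using MvPolynomial.induction_on' with
  | monomial u c =>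
    obtain ⟨Q, hQ⟩ := exists_integral_pow_mul_eval_log (u 1 + m) y
    have hG : ∀ l ≤ P.n, (fun t => P.α l t ^ (u 1 + m + 1) * Q.eval (Real.log (P.α l t))) ∈
        logExp N (m + 1) := fun l hl =>
      logExp_anti (by omega) (logTerm_comp_α_mem_logExp' hP hB hN hl (u 1 + m) Q)
    have ht : (fun t : ℝ => t ^ (u 0)) ∈ logExp N 0 := by
      simpa using pow_mul_log_pow_mem_logExp N (Nat.zero_le (u 0)) 0
    refine logExp_congr (logExp_const_mul c (logExp_mul_left ht
      (sub_mem (hG i hi'.2) (hG (i - 1) (by omega))))) ?_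
    filter_upwards [hP.Ioo_mem_nhdsGT] with t ht
    have ht' := Ioo_subset_Icc_self ht
    simp only [Pi.mul_apply, Pi.sub_apply]
    rw [← hQ _ _ (hP.α_nonneg (by omega) ht') (hP.α_mono (by omega) hi'.2 ht'),
      ← intervalIntegral.integral_const_mul, ← intervalIntegral.integral_const_mul]
    refine intervalIntegral.integral_congr fun s _ => ?_
    simp only [MvPolynomial.eval_monomial, Finsupp.prod_fintype, pow_zero, implies_true,
      Fin.prod_univ_two, Matrix.cons_val_zero, Matrix.cons_val_one]
    ring
  | add p q hp hq =>
    refine logExp_congr (add_mem hp hq) ?_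
    filter_upwards [hP.Ioo_mem_nhdsGT] with t ht
    have ht' := Ioo_subset_Icc_self ht
    have hc : ∀ r : MvPolynomial (Fin 2) ℝ, ContinuousOn
        (fun q : ℝ × ℝ => MvPolynomial.eval ![q.1, q.2] r) (P.closedSector T' i) := fun r =>
      ((MvPolynomial.continuous_eval r).comp (by fun_prop)).continuousOn
    have h1 := hP.intervalIntegrable_mul (g := fun t s => MvPolynomial.eval ![t, s] p) hi'.2
      (hc p) hI ht'
    have h2 := hP.intervalIntegrable_mul (g := fun t s => MvPolynomial.eval ![t, s] q) hi'.2
      (hc q) hI ht'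
    rw [Pi.add_apply, ← intervalIntegral.integral_add h1 h2]
    refine intervalIntegral.integral_congr fun s _ => ?_
    simp only [map_add]
    ring

/-- In the sector `s ≤ t`, so the kernel is at most a constant times `(2t)^N`, and integrability of
`x` does the rest. -/
theorem sectorIntegral_remainder_mem_logBigO (hP : P.Standing T')
    {i : ℕ} (hi : i ∈ Finset.Icc 1 P.n) {R : ℝ → ℝ → ℝ}
    (hR : (fun q : ℝ × ℝ => R q.1 q.2) =O[𝓝[P.closedSector T' i] (0, 0)] fun q => (q.1 + q.2) ^ N)
    {x : ℝ → ℝ} (hx : IntegrableOn x (Ioc 0 T')) :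
    (fun t => ∫ s in (P.α (i - 1) t)..(P.α i t), R t s * x s) ∈ logBigO N := by
  have hi' := Finset.mem_Icc.1 hi
  obtain ⟨c, hc0, hc⟩ := hR.exists_nonneg
  obtain ⟨r, hr, hr'⟩ := Metric.mem_nhdsWithin_iff.1 hc.bound
  refine mem_logBigO_of_isBigO
    (IsBigO.of_bound (c * 2 ^ N * ∫ s in Ioc 0 T', ‖x s‖) ?_)
  filter_upwards [hP.Ioo_mem_nhdsGT, _root_.Ioo_mem_nhdsGT hr] with t ht htr
  have ht' := Ioo_subset_Icc_self ht
  have hAB := hP.α_mono (i := i - 1) (by omega) hi'.2 ht'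
  have hsub := (hP.Ioc_subset hi'.2 ht').trans (Ioc_subset_Ioc_right ht.2.le)
  have hint : IntervalIntegrable (fun s => c * (2 ^ N * t ^ N) * ‖x s‖) volume
      (P.α (i - 1) t) (P.α i t) := by
    rw [intervalIntegrable_iff_integrableOn_Ioc_of_le hAB]
    exact ((hx.mono_set hsub).norm).const_mul _
  refine (intervalIntegral.norm_integral_le_of_norm_le hAB
    (Eventually.of_forall fun s hs => ?_) hint).trans ?_
  · have hs0 := hP.Ioc_subset hi'.2 ht' hs
    have hmem : (t, s) ∈ Metric.ball ((0 : ℝ), (0 : ℝ)) r ∩ P.closedSector T' i := by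
      refine ⟨?_, ht', hs.1.le, hs.2⟩
      rw [Metric.mem_ball, Prod.dist_eq, Real.dist_eq, Real.dist_eq, sub_zero, sub_zero,
        abs_of_pos ht.1, abs_of_pos hs0.1]
      exact max_lt htr.2 (hs0.2.trans_lt htr.2)
    have h1 : ‖R t s‖ ≤ c * ‖(t + s) ^ N‖ := hr' hmem
    rw [norm_mul]
    refine mul_le_mul_of_nonneg_right (h1.trans (mul_le_mul_of_nonneg_left ?_ hc0))
      (norm_nonneg _)
    rw [Real.norm_of_nonneg (pow_nonneg (add_nonneg ht.1.le hs0.1.le) _), ← mul_pow]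
    exact pow_le_pow_left₀ (add_nonneg ht.1.le hs0.1.le) (by linarith [hs0.2]) _
  · rw [intervalIntegral.integral_const_mul, intervalIntegral.integral_of_le hAB,
      Real.norm_of_nonneg (pow_nonneg ht.1.le N)]
    have h1 : ∫ s in Ioc (P.α (i - 1) t) (P.α i t), ‖x s‖ ≤ ∫ s in Ioc 0 T', ‖x s‖ :=
      setIntegral_mono_set hx.norm (Eventually.of_forall fun _ => norm_nonneg _)
        hsub.eventuallyLE
    have h2 : 0 ≤ c * (2 ^ N * t ^ N) := by have := ht.1.le; positivity
    calc _ ≤ c * (2 ^ N * t ^ N) * ∫ s in Ioc 0 T', ‖x s‖ := mul_le_mul_of_nonneg_left h1 h2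
      _ = _ := by ring

theorem sectorIntegral_Kt_mem_logExp (hP : P.Standing T') (hB : P.CondB T' N) (hN : 1 ≤ N)
    {i : ℕ} (hi : i ∈ Finset.Icc 1 P.n) (m : ℕ) (y : ℝ[X]) :
    (fun t => ∫ s in (P.α (i - 1) t)..(P.α i t),
      P.Kt i t s * (s ^ m * y.eval (Real.log s))) ∈ logExp N (m + 1) := by
  have hi' := Finset.mem_Icc.1 hi
  have hI := integrableOn_pow_mul_eval_log m y hP.T'_pos
  obtain ⟨p, -, -, h⟩ := hB.K_taylor i hi
  set q := MvPolynomial.pderiv 0 p with hq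
  have h1 := sectorIntegral_mvEval_mem_logExp hP hB hN hi q m y
  have h2 := sectorIntegral_remainder_mem_logBigO hP hi
    (R := fun t s => P.Kt i t s - MvPolynomial.eval ![t, s] q) h hI
  refine logExp_congr (add_mem h1 (logBigO_le_logExp N (m + 1) h2)) ?_
  filter_upwards [hP.Ioo_mem_nhdsGT] with t ht
  have ht' := Ioo_subset_Icc_self ht
  have hc : ContinuousOn
      (fun w : ℝ × ℝ => MvPolynomial.eval ![w.1, w.2] q) (P.closedSector T' i) :=
    ((MvPolynomial.continuous_eval q).comp (by fun_prop)).continuousOn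
  have i1 := hP.intervalIntegrable_mul (g := fun t s => MvPolynomial.eval ![t, s] q) hi'.2
    hc hI ht'
  have i2 := hP.intervalIntegrable_mul (g := P.Kt i) hi'.2 (hP.Kt_cont i hi) hI ht'
  have i3 : IntervalIntegrable (fun s => (P.Kt i t s - MvPolynomial.eval ![t, s] q) *
      (s ^ m * y.eval (Real.log s))) volume (P.α (i - 1) t) (P.α i t) := by
    refine (i2.sub i1).congr (fun s _ => ?_)
    ring
  rw [Pi.add_apply, ← intervalIntegral.integral_add i1 i3]
  refine intervalIntegral.integral_congr fun s _ => ?_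
  ring

/-- The action of the principal part of `F` on the coefficients of `t^m`, as polynomials in
`ln t`. -/
noncomputable def charOp (P : VolterraData) (m : ℕ) : ℝ[X] →ₗ[ℝ] ℝ[X] :=
  P.K P.n 0 0 • LinearMap.id + ∑ i ∈ Finset.Icc 1 (P.n - 1),
    (P.α' i 0 ^ (1 + m) * (P.K i 0 0 - P.K (i + 1) 0 0)) •
      Polynomial.taylor (Real.log (P.α' i 0))

theorem eval_charOp (m : ℕ) (y : ℝ[X]) (u : ℝ) :
    (P.charOp m y).eval u = P.K P.n 0 0 * y.eval u + ∑ i ∈ Finset.Icc 1 (P.n - 1),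
      (P.α' i 0 ^ (1 + m) * (P.K i 0 0 - P.K (i + 1) 0 0)) *
        y.eval (u + Real.log (P.α' i 0)) := by
  simp only [charOp, LinearMap.add_apply, LinearMap.smul_apply, LinearMap.id_apply,
    LinearMap.sum_apply, Polynomial.eval_add, Polynomial.eval_smul, Polynomial.eval_finsetSum,
    smul_eq_mul, Polynomial.taylor_eval]

/-- At order `t^m` only the coefficients at zero and the dilations by `α_i'(0)` survive; the
integral terms begin at order `m + 1`. -/
theorem F_logTerm_sub_mem_logExp (hP : P.Standing T') (hB : P.CondB T' N) (hN : 1 ≤ N)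
    (m : ℕ) (y : ℝ[X]) :
    (fun t => P.F (fun s => s ^ m * y.eval (Real.log s)) t
      - t ^ m * (P.charOp m y).eval (Real.log t)) ∈ logExp N (m + 1) := by
  have hn := hP.n_pos
  have hnn : P.n ∈ Finset.Icc 1 P.n := by simpa using hn
  have hdiag : (fun t => P.K P.n t t - P.K P.n 0 0) ∈ logExp N 1 := by
    refine logExp_congr (K_sub_mem_logExp hP hB hN (Or.inr rfl) hnn) ?_
    filter_upwards [hP.Ioo_mem_nhdsGT] with t ht
    rw [hP.α_last t (Ioo_subset_Icc_self ht)]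
  have h1 : (fun t => P.K P.n t t * (t ^ m * y.eval (Real.log t))
      - P.K P.n 0 0 * (t ^ m * y.eval (Real.log t))) ∈ logExp N (m + 1) :=
    sub_mem_of_mul hdiag (by simpa using zero_mem_logExp N (m + 1)) (eval_log_mem_logExp N m y)
  have h2 : ∀ i ∈ Finset.Icc 1 (P.n - 1),
      (fun t => P.α' i t * (P.K i t (P.α i t) - P.K (i + 1) t (P.α i t)) *
        (P.α i t ^ m * y.eval (Real.log (P.α i t)))
        - P.α' i 0 * (P.K i 0 0 - P.K (i + 1) 0 0) *
          (P.α' i 0 ^ m * t ^ m * y.eval (Real.log t + Real.log (P.α' i 0)))) ∈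
        logExp N (m + 1) := by
    intro i hi
    have hi' := Finset.mem_Icc.1 hi
    have hi1 : i ∈ Finset.Icc 1 P.n := by rw [Finset.mem_Icc]; omega
    have hi2 : i + 1 ∈ Finset.Icc 1 P.n := by rw [Finset.mem_Icc]; omega
    have hd : (fun t => (P.K i t (P.α i t) - P.K (i + 1) t (P.α i t))
        - (P.K i 0 0 - P.K (i + 1) 0 0)) ∈ logExp N 1 := by
      convert sub_mem (K_sub_mem_logExp hP hB hN (Or.inr rfl) hi1)
        (K_sub_mem_logExp hP hB hN (l := i) (Or.inl (by omega)) hi2) using 1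
      funext t; simp only [Pi.sub_apply]; ring
    have hc : (fun t => P.α' i t * (P.K i t (P.α i t) - P.K (i + 1) t (P.α i t))
        - P.α' i 0 * (P.K i 0 0 - P.K (i + 1) 0 0)) ∈ logExp N 1 :=
      sub_mem_of_mul (a := 0) (α'_sub_mem_logExp hP hB hN hi) hd (const_mem_logExp N _)
    refine sub_mem_of_mul hc (logTerm_comp_α_sub_mem_logExp hP hB hN hi1 m y) ?_
    convert logExp_const_mul (P.α' i 0 ^ m)
      (eval_log_mem_logExp N m (Polynomial.taylor (Real.log (P.α' i 0)) y)) using 1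
    funext t
    rw [Polynomial.taylor_eval, mul_assoc]
  have h3 : ∀ i ∈ Finset.Icc 1 P.n, _ := fun i hi =>
    sectorIntegral_Kt_mem_logExp hP hB hN hi m y
  convert add_mem (add_mem h1 (sum_mem h2)) (sum_mem h3) using 1
  funext t
  simp only [F, eval_charOp, Pi.add_apply, Finset.sum_apply, Finset.sum_sub_distrib, mul_add,
    Finset.mul_sum]
  have : ∑ i ∈ Finset.Icc 1 (P.n - 1), t ^ m * (P.α' i 0 ^ (1 + m) *
      (P.K i 0 0 - P.K (i + 1) 0 0) * y.eval (Real.log t + Real.log (P.α' i 0))) =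
      ∑ i ∈ Finset.Icc 1 (P.n - 1), P.α' i 0 * (P.K i 0 0 - P.K (i + 1) 0 0) *
        (P.α' i 0 ^ m * t ^ m * y.eval (Real.log t + Real.log (P.α' i 0))) :=
    Finset.sum_congr rfl fun i _ => by ring
  rw [this]
  ring

end VolterraData

/-! ### The characteristic function: multiplicities, solvability, and the range of its zeros. -/

namespace VolterraData

variable {P : VolterraData} {T' : ℝ} {N : ℕ}

/-- The derivatives of the characteristic function at the integer `m`. -/
noncomputable def charCoeff (P : VolterraData) (m l : ℕ) : ℝ :=
  (if l = 0 then P.K P.n 0 0 else 0) + ∑ i ∈ Finset.Icc 1 (P.n - 1),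
    P.α' i 0 ^ (1 + m) * (P.K i 0 0 - P.K (i + 1) 0 0) * Real.log (P.α' i 0) ^ l

theorem iteratedDeriv_B (hP : P.Standing T') (l : ℕ) (z : ℝ) :
    iteratedDeriv l P.B z = (if l = 0 then P.K P.n 0 0 else 0) +
      ∑ i ∈ Finset.Icc 1 (P.n - 1),
        P.α' i 0 ^ (1 + z) * (P.K i 0 0 - P.K (i + 1) 0 0) * Real.log (P.α' i 0) ^ l := by
  induction l generalizing z with
  | zero => simp [B]
  | succ l ih =>
    rw [iteratedDeriv_succ, funext ih]
    refine HasDerivAt.deriv ?_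
    rw [if_neg (Nat.succ_ne_zero l)]
    refine (hasDerivAt_const z _).add (HasDerivAt.fun_sum fun i hi => ?_)
    have hi' := Finset.mem_Icc.1 hi
    have hpos := hP.α'_zero_pos hi'.1 (by omega : i ≤ P.n)
    have h1 := ((hasDerivAt_id z).const_add 1).const_rpow hpos
    refine ((h1.mul_const _).mul_const _).congr_deriv ?_
    simp only [id]
    ring

theorem iteratedDeriv_B_natCast (hP : P.Standing T') (l m : ℕ) :
    iteratedDeriv l P.B m = P.charCoeff m l := by
  rw [iteratedDeriv_B hP, charCoeff]
  congr 1
  refine Finset.sum_congr rfl fun i _ => ?_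
  rw [← Nat.cast_one, ← Nat.cast_add, Real.rpow_natCast]

theorem B_natCast (hP : P.Standing T') (m : ℕ) : P.B m = P.charCoeff m 0 := by
  rw [← iteratedDeriv_B_natCast hP, iteratedDeriv_zero]

/-- The binomial formula for `(u + ln α_i'(0))^k` brings out powers of `ln α_i'(0)`, exactly the
factors produced by differentiating `α_i'(0)^(1+z)` in `z`. This links multiplicities of zeros of
`B` to degrees in `ln t`. -/
theorem charOp_X_pow (m k : ℕ) :
    P.charOp m (Polynomial.X ^ k) = ∑ l ∈ Finset.range (k + 1),
      Polynomial.C (P.charCoeff m l * k.choose l) * Polynomial.X ^ (k - l) := by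
  refine Polynomial.funext fun u => ?_
  rw [eval_charOp, Polynomial.eval_finsetSum]
  simp only [Polynomial.eval_mul, Polynomial.eval_C, Polynomial.eval_pow, Polynomial.eval_X,
    charCoeff, add_mul, Finset.sum_add_distrib]
  congr 1
  · rw [Finset.sum_eq_single 0]
    · simp
    · intro l _ hl; simp [hl]
    · simp
  · simp only [Finset.sum_mul]
    rw [Finset.sum_comm]
    refine Finset.sum_congr rfl fun i _ => ?_
    rw [add_comm u, add_pow, Finset.mul_sum]
    exact Finset.sum_congr rfl fun l _ => by ring

theorem charOp_X_pow_eq_zero {m κ k : ℕ} (h : ∀ l < κ, P.charCoeff m l = 0) (hk : k < κ) :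
    P.charOp m (Polynomial.X ^ k) = 0 := by
  rw [charOp_X_pow]
  refine Finset.sum_eq_zero fun l hl => ?_
  rw [h l (by have := Finset.mem_range.1 hl; omega)]
  simp

/-- The operator lowers degrees by exactly `κ`: it takes `X^(κ+r)` to a nonzero multiple of `X^r`
plus lower powers, which induction on `r` has already reached. -/
theorem charOp_surjective {m κ : ℕ} (h : ∀ l < κ, P.charCoeff m l = 0)
    (hκ : P.charCoeff m κ ≠ 0) : Function.Surjective (P.charOp m) := by
  rw [← LinearMap.range_eq_top]
  have hX : ∀ r, (Polynomial.X ^ r : ℝ[X]) ∈ LinearMap.range (P.charOp m) := by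
    intro r
    induction r using Nat.strong_induction_on with
    | _ r ih =>
      have h1 : P.charOp m (Polynomial.X ^ (κ + r)) ∈ LinearMap.range (P.charOp m) := ⟨_, rfl⟩
      rw [charOp_X_pow, ← Finset.sum_erase_add _ _
        (Finset.mem_range.2 (by omega : κ < κ + r + 1))] at h1
      have h2 : ∑ l ∈ (Finset.range (κ + r + 1)).erase κ,
          Polynomial.C (P.charCoeff m l * (κ + r).choose l) * Polynomial.X ^ (κ + r - l) ∈
          LinearMap.range (P.charOp m) := by
        refine sum_mem fun l hl => ?_
        rw [Finset.mem_erase, Finset.mem_range] at hl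
        rcases lt_or_gt_of_ne hl.1 with h3 | h3
        · rw [h l h3]; simp
        · rw [← Polynomial.smul_eq_C_mul]
          exact Submodule.smul_mem _ _ (ih _ (by omega))
      have h3 := (Submodule.add_mem_iff_right _ h2).1 h1
      rw [← Polynomial.smul_eq_C_mul, Nat.add_sub_cancel_left] at h3
      refine (Submodule.smul_mem_iff _ (mul_ne_zero hκ ?_)).1 h3
      exact_mod_cast (Nat.choose_pos (by omega)).ne'
  refine eq_top_iff.2 fun p _ => ?_
  rw [p.as_sum_range_C_mul_X_pow]
  refine sum_mem fun i _ => ?_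
  rw [← Polynomial.smul_eq_C_mul]
  exact Submodule.smul_mem _ _ (hX i)

theorem CondC.charOp_surjective {ν : ℕ} {j k : Fin ν → ℕ} (hP : P.Standing T')
    (hC : P.CondC N j k) {m : ℕ} (hm : m ≤ N) : Function.Surjective (P.charOp m) := by
  by_cases hB : P.B m = 0
  · obtain ⟨i, rfl⟩ := (hC.zeros m).1 ⟨hm, hB⟩
    have := hC.mult i
    simp only [iteratedDeriv_B_natCast hP] at this
    exact VolterraData.charOp_surjective this.1 this.2
  · rw [B_natCast hP] at hB
    exact VolterraData.charOp_surjective (κ := 0) (by simp) hB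

/-- The bound passes to both end points by continuity. It is needed at `0` for the zeros of `B` and
at `T'` for the contraction estimate. -/
theorem CondD.contraction_Icc {ε q : ℝ} {Nstar : ℕ} (hP : P.Standing T')
    (hD : P.CondD T' ε q Nstar) {t : ℝ} (ht : t ∈ Icc 0 T') :
    ε ^ Nstar * ∑ i ∈ Finset.Icc 1 (P.n - 1),
      |P.α' i t * (P.K P.n t t)⁻¹ * (P.K i t (P.α i t) - P.K (i + 1) t (P.α i t))| ≤ q := by
  have hc : ContinuousOn (fun t => ε ^ Nstar * ∑ i ∈ Finset.Icc 1 (P.n - 1),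
      |P.α' i t * (P.K P.n t t)⁻¹ * (P.K i t (P.α i t) - P.K (i + 1) t (P.α i t))|)
      (Icc 0 T') := by
    refine continuousOn_const.mul (continuousOn_finsetSum _ fun i hi => ?_)
    have hi' := Finset.mem_Icc.1 hi
    exact (((hP.α'_cont i (by omega)).mul (hP.continuousOn_diag.inv₀ hD.Kn_ne_zero)).mul
      (hP.continuousOn_jump hi)).abs
  have hcl := (isClosed_Icc (a := (0 : ℝ)) (b := T')).isClosed_le hc
    (continuousOn_const (c := q))
  have hsub : Ioo 0 T' ⊆ {t ∈ Icc 0 T' | ε ^ Nstar * ∑ i ∈ Finset.Icc 1 (P.n - 1),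
      |P.α' i t * (P.K P.n t t)⁻¹ * (P.K i t (P.α i t) - P.K (i + 1) t (P.α i t))| ≤ q} :=
    fun s hs => ⟨Ioo_subset_Icc_self hs, hD.contraction s hs⟩
  have := closure_minimal hsub hcl
  rw [closure_Ioo hP.T'_pos.ne] at this
  exact (this ht).2

/-- If `B(m) = 0`, dividing by `K_n(0,0)` writes `1` as a sum bounded at `t = 0` by the left side of
the contraction condition, because `α_i'(0)^m ≤ ε^m ≤ ε^{N*}`. This contradicts `q < 1`. -/
theorem CondD.B_ne_zero {ε q : ℝ} {Nstar : ℕ} (hP : P.Standing T')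
    (hD : P.CondD T' ε q Nstar) {m : ℕ} (hm : Nstar ≤ m) : P.B m ≠ 0 := by
  have h0 := hP.zero_mem
  have hK := hD.Kn_ne_zero 0 h0
  have hcon := (hD.contraction_Icc hP h0).trans_lt hD.q_lt_one
  intro hB
  have hB' : P.K P.n 0 0 = -∑ i ∈ Finset.Icc 1 (P.n - 1),
      P.α' i 0 ^ (1 + (m : ℝ)) * (P.K i 0 0 - P.K (i + 1) 0 0) := by
    rw [B] at hB; linarith
  have h1 : (1 : ℝ) ≤ ε ^ Nstar * ∑ i ∈ Finset.Icc 1 (P.n - 1),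
      |P.α' i 0 * (P.K P.n 0 0)⁻¹ * (P.K i 0 (P.α i 0) - P.K (i + 1) 0 (P.α i 0))| := by
    have h2 : (1 : ℝ) = |(P.K P.n 0 0)⁻¹ * ∑ i ∈ Finset.Icc 1 (P.n - 1),
      P.α' i 0 ^ (1 + (m : ℝ)) * (P.K i 0 0 - P.K (i + 1) 0 0)| := by
      rw [← abs_neg, ← mul_neg, ← hB', inv_mul_cancel₀ hK, abs_one]
    rw [h2, Finset.mul_sum, Finset.mul_sum]
    refine (Finset.abs_sum_le_sum_abs _ _).trans (Finset.sum_le_sum fun i hi => ?_)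
    have hi' := Finset.mem_Icc.1 hi
    have hpos := hP.α'_zero_pos hi'.1 (by omega : i ≤ P.n)
    have hle := (le_abs_self _).trans (hD.α'_le i hi 0 h0)
    rw [hP.α_at_zero i (by omega), ← Nat.cast_one, ← Nat.cast_add, Real.rpow_natCast, pow_add,
      pow_one]
    have h3 : P.α' i 0 ^ m ≤ ε ^ Nstar :=
      (pow_le_pow_left₀ hpos.le hle m).trans
        (pow_le_pow_of_le_one hD.ε_pos.le hD.ε_lt_one.le hm)
    rw [show (P.K P.n 0 0)⁻¹ * (P.α' i 0 * P.α' i 0 ^ m * (P.K i 0 0 - P.K (i + 1) 0 0)) =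
      P.α' i 0 ^ m * (P.α' i 0 * (P.K P.n 0 0)⁻¹ * (P.K i 0 0 - P.K (i + 1) 0 0)) by ring,
      abs_mul, abs_of_pos (pow_pos hpos m)]
    exact mul_le_mul_of_nonneg_right h3 (abs_nonneg _)
  linarith

theorem Standing.F_add (hP : P.Standing T') {x y : ℝ → ℝ} (hx : IntegrableOn x (Ioc 0 T'))
    (hy : IntegrableOn y (Ioc 0 T')) {t : ℝ} (ht : t ∈ Icc 0 T') :
    P.F (fun s => x s + y s) t = P.F x t + P.F y t := by
  have h : ∀ i ∈ Finset.Icc 1 P.n,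
      (∫ s in (P.α (i - 1) t)..(P.α i t), P.Kt i t s * (x s + y s)) =
      (∫ s in (P.α (i - 1) t)..(P.α i t), P.Kt i t s * x s) +
        ∫ s in (P.α (i - 1) t)..(P.α i t), P.Kt i t s * y s := by
    intro i hi
    have hi' := (Finset.mem_Icc.1 hi).2
    rw [← intervalIntegral.integral_add (hP.intervalIntegrable_mul hi' (hP.Kt_cont i hi) hx ht)
      (hP.intervalIntegrable_mul hi' (hP.Kt_cont i hi) hy ht)]
    exact intervalIntegral.integral_congr fun s _ => mul_add _ _ _
  simp only [F]
  rw [Finset.sum_congr rfl h, Finset.sum_add_distrib]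
  simp only [mul_add, Finset.sum_add_distrib]
  ring

theorem F_smul (c : ℝ) (x : ℝ → ℝ) (t : ℝ) : P.F (fun s => c * x s) t = c * P.F x t := by
  simp only [F, mul_add, Finset.mul_sum, ← intervalIntegral.integral_const_mul]
  congr 1
  · congr 1
    · ring
    · exact Finset.sum_congr rfl fun i _ => by ring
  · refine Finset.sum_congr rfl fun i _ => intervalIntegral.integral_congr fun s _ => ?_
    ring

end VolterraData

/-! ### Log-power polynomials and their order at zero. -/

theorem logPower_add {N : ℕ} (x y : Fin (N + 1) → ℝ[X]) :
    logPower (x + y) = fun t => logPower x t + logPower y t := by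
  funext t
  simp only [logPower, Pi.add_apply, Polynomial.eval_add, add_mul, Finset.sum_add_distrib]

theorem logPower_smul {N : ℕ} (c : ℝ) (x : Fin (N + 1) → ℝ[X]) :
    logPower (c • x) = fun t => c * logPower x t := by
  funext t
  simp only [logPower, Pi.smul_apply, Polynomial.eval_smul, smul_eq_mul, Finset.mul_sum, mul_assoc]

theorem logPower_zero {N : ℕ} : logPower (0 : Fin (N + 1) → ℝ[X]) = fun _ => 0 := by
  funext t
  simp [logPower]

theorem logPower_single {N : ℕ} (m : Fin (N + 1)) (y : ℝ[X]) :
    logPower (Pi.single m y) = fun t => t ^ (m : ℕ) * y.eval (Real.log t) := by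
  funext t
  rw [logPower, Finset.sum_eq_single m]
  · rw [Pi.single_eq_same, mul_comm]
  · intro i _ hi
    rw [Pi.single_eq_of_ne hi]; simp
  · simp

theorem continuousOn_logPower {N : ℕ} (x : Fin (N + 1) → ℝ[X]) :
    ContinuousOn (logPower x) (Ioi 0) := by
  have : logPower x = fun t => ∑ i : Fin (N + 1), t ^ (i : ℕ) * (x i).eval (Real.log t) := by
    funext t; exact Finset.sum_congr rfl fun i _ => mul_comm _ _
  rw [this]
  exact continuousOn_finsetSum _ fun i _ => continuousOn_pow_mul_eval_log _ _

theorem integrableOn_logPower {N : ℕ} (x : Fin (N + 1) → ℝ[X]) {T : ℝ} (hT : 0 < T) :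
    IntegrableOn (logPower x) (Ioc 0 T) := by
  have : logPower x = fun t => ∑ i : Fin (N + 1), t ^ (i : ℕ) * (x i).eval (Real.log t) := by
    funext t; exact Finset.sum_congr rfl fun i _ => mul_comm _ _
  rw [this]
  exact integrable_finsetSum _ fun i _ => integrableOn_pow_mul_eval_log _ _ hT

theorem logPower_mem_logExp {N m : ℕ} (M : ℕ) {x : Fin (N + 1) → ℝ[X]}
    (hx : ∀ i : Fin (N + 1), (i : ℕ) < m → x i = 0) : logPower x ∈ logExp M m := by
  have : logPower x = ∑ i : Fin (N + 1), fun t => t ^ (i : ℕ) * (x i).eval (Real.log t) := by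
    funext t
    rw [Finset.sum_apply]
    exact Finset.sum_congr rfl fun i _ => mul_comm _ _
  rw [this]
  refine sum_mem fun i _ => ?_
  by_cases hi : (i : ℕ) < m
  · rw [hx i hi]; simpa using zero_mem_logExp M m
  · exact logExp_anti (not_lt.1 hi) (eval_log_mem_logExp M i (x i))

/-- As `t → +0` the argument `ln t` runs to `-∞`, and a nonzero polynomial does not tend to zero
there. Composition with `-X` moves the question to `+∞`. -/
theorem eq_zero_of_tendsto_eval_log {y : ℝ[X]}
    (h : Tendsto (fun t => y.eval (Real.log t)) (𝓝[>] 0) (𝓝 0)) : y = 0 := by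
  have h1 : Tendsto (fun u => (y.comp (-Polynomial.X)).eval u) atTop (𝓝 0) := by
    have h2 : Tendsto (fun u : ℝ => Real.exp (-u)) atTop (𝓝[>] 0) :=
      Real.tendsto_exp_atBot_nhdsGT.comp tendsto_neg_atTop_atBot
    have h3 := h.comp h2
    refine h3.congr fun u => ?_
    simp
  have h2 := (Polynomial.tendsto_nhds_iff _).1 h1
  have h3 := Polynomial.leadingCoeff_eq_zero.1 h2.1
  have h4 : (y.comp (-Polynomial.X)).comp (-Polynomial.X) = 0 := by rw [h3, Polynomial.zero_comp]
  rwa [Polynomial.comp_assoc, Polynomial.neg_comp, Polynomial.X_comp, neg_neg,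
    Polynomial.comp_X] at h4

/-- The first nonzero coefficient determines the order: after division by `t^i` it would have to
tend to zero, since all later terms do. -/
theorem logPower_not_isBigO {N m : ℕ} {x : Fin (N + 1) → ℝ[X]} {i : Fin (N + 1)}
    (hx : ∀ l < i, x l = 0) (hi : x i ≠ 0) (him : (i : ℕ) < m) :
    ¬ logPower x =O[𝓝[>] 0] fun t => t ^ m := by
  intro h
  have h1 : logPower x ∈ logBigO ((i : ℕ) + 1) :=
    logBigO_anti him (mem_logBigO_of_isBigO h)
  have h2 : logPower (x - Pi.single i (x i)) ∈ logBigO ((i : ℕ) + 1) := by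
    rw [← logExp_self]
    refine logPower_mem_logExp _ fun l hl => ?_
    rcases eq_or_ne l i with rfl | hne
    · simp
    · rw [Pi.sub_apply, Pi.single_eq_of_ne hne, sub_zero]
      exact hx l (lt_of_le_of_ne (Fin.le_def.2 (by omega)) hne)
  have h3 : (fun t => t ^ (i : ℕ) * (x i).eval (Real.log t)) ∈ logBigO ((i : ℕ) + 1) := by
    rw [← logPower_single]
    convert sub_mem h1 h2 using 1
    funext t
    have := congrFun (logPower_add (x - Pi.single i (x i)) (Pi.single i (x i))) t
    rw [sub_add_cancel] at this
    simp only [Pi.sub_apply]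
    linarith
  have h4 := (isBigO_refl (fun t : ℝ => (t ^ (i : ℕ))⁻¹) (𝓝[>] 0)).mul_isLittleO
    (isLittleO_of_mem_logBigO h3)
  refine hi (eq_zero_of_tendsto_eval_log ((isLittleO_one_iff ℝ).1 (h4.congr' ?_ ?_)))
  all_goals
    filter_upwards [self_mem_nhdsWithin] with t ht
    have : t ^ (i : ℕ) ≠ 0 := pow_ne_zero _ (ne_of_gt ht)
    field_simp

/-! ### Asymptotic solutions order by order. -/

namespace VolterraData

variable {P : VolterraData} {T' : ℝ} {N : ℕ}

/-- Downward induction on the order `m` of the right-hand side. Surjectivity of `charOp m` removes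
the leading polynomial, and the new error has order `m + 1`. At order `N + 1` the right-hand side is
itself a remainder. -/
theorem exists_asymptotic_solution {ν : ℕ} {j k : Fin ν → ℕ} (hP : P.Standing T')
    (hB : P.CondB T' N) (hC : P.CondC N j k) (hN : 1 ≤ N) {m : ℕ} (hm : m ≤ N + 1)
    {g : ℝ → ℝ} (hg : g ∈ logExp N m) :
    ∃ x : Fin (N + 1) → ℝ[X], (∀ i : Fin (N + 1), (i : ℕ) < m → x i = 0) ∧
      (fun t => P.F (logPower x) t - g t) ∈ logBigO N := by
  induction hm using Nat.decreasingInduction generalizing g with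
  | self =>
    refine ⟨0, fun _ _ => rfl, ?_⟩
    have hg' : g ∈ logBigO N := by
      rw [← logExp_self]; exact logExp_anti (Nat.le_succ N) hg
    convert neg_mem hg' using 1
    funext t
    rw [logPower_zero]
    have := F_smul (P := P) 0 (fun _ => 0) t
    simp only [zero_mul] at this
    simp [this]
  | of_succ m hm ih =>
    have hmN : m ≤ N := Nat.lt_succ_iff.1 hm
    obtain ⟨y, hy⟩ := exists_leading_of_mem_logExp hg
    obtain ⟨z, rfl⟩ := hC.charOp_surjective hP hmN y
    obtain ⟨x, hx, hxF⟩ := ih (sub_mem hy (F_logTerm_sub_mem_logExp hP hB hN m z))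
    set i : Fin (N + 1) := ⟨m, hm⟩
    refine ⟨x + Pi.single i z, fun l hl => ?_, logBigO_congr hxF ?_⟩
    · rw [Pi.add_apply, hx l (by omega), zero_add, Pi.single_eq_of_ne]
      rintro rfl
      exact lt_irrefl _ hl
    · filter_upwards [hP.Ioo_mem_nhdsGT] with t ht
      rw [logPower_add, hP.F_add (integrableOn_logPower _ hP.T'_pos)
        (integrableOn_logPower _ hP.T'_pos) (Ioo_subset_Icc_self ht), logPower_single]
      simp only [Pi.sub_apply, i]
      ring

/-- For `l` below the multiplicity, `charOp (j i)` kills `X^l`, so `t^{j_i} ln^l t` fails the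
homogeneous equation only from order `j_i + 1` on. Terms of those higher orders correct it. -/
theorem exists_asymptotic_kernel {ν : ℕ} {j k : Fin ν → ℕ} (hP : P.Standing T')
    (hB : P.CondB T' N) (hC : P.CondC N j k) (hN : 1 ≤ N) (i : Fin ν) {l : ℕ} (hl : l < k i) :
    ∃ x : Fin (N + 1) → ℝ[X], (∀ m : Fin (N + 1), (m : ℕ) < j i → x m = 0) ∧
      (∀ m : Fin (N + 1), (m : ℕ) = j i → x m = Polynomial.X ^ l) ∧
      P.F (logPower x) ∈ logBigO N := by
  have hj := (hC.zeros (j i)).2 ⟨i, rfl⟩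
  have hmult := (hC.mult i).1
  simp only [iteratedDeriv_B_natCast hP] at hmult
  have h1 := F_logTerm_sub_mem_logExp hP hB hN (j i) (Polynomial.X ^ l)
  rw [charOp_X_pow_eq_zero hmult hl] at h1
  simp only [Polynomial.eval_zero, mul_zero, sub_zero] at h1
  obtain ⟨x, hx, hxF⟩ := exists_asymptotic_solution hP hB hC hN (by omega) (neg_mem h1)
  set m₀ : Fin (N + 1) := ⟨j i, by omega⟩ with hm₀
  refine ⟨x + Pi.single m₀ (Polynomial.X ^ l), fun m hm => ?_, fun m hm => ?_,
    logBigO_congr hxF ?_⟩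
  · rw [Pi.add_apply, hx m (by omega), zero_add, Pi.single_eq_of_ne]
    rintro rfl
    exact lt_irrefl _ hm
  · rw [Pi.add_apply, hx m (by omega), zero_add]
    have : m = m₀ := Fin.ext hm
    rw [this, Pi.single_eq_same]
  · filter_upwards [hP.Ioo_mem_nhdsGT] with t ht
    rw [logPower_add, hP.F_add (integrableOn_logPower _ hP.T'_pos)
      (integrableOn_logPower _ hP.T'_pos) (Ioo_subset_Icc_self ht), logPower_single]
    simp only [Pi.neg_apply, hm₀]
    ring

/-- The affine family of asymptotic solutions. Two different members differ first at a zero of the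
characteristic function. -/
theorem exists_asymptotic_family {ν : ℕ} {j k : Fin ν → ℕ} (hP : P.Standing T')
    (hB : P.CondB T' N) (hC : P.CondC N j k) (hN : 1 ≤ N) :
    ∃ p : (Fin (∑ i, k i) → ℝ) →ᵃ[ℝ] (Fin (N + 1) → ℝ[X]),
      (∀ c, (fun t => P.F (logPower (p c)) t - P.rhs t) ∈ logBigO N) ∧
      ∀ c c', c ≠ c' → ∃ m : Fin (N + 1), P.B (m : ℕ) = 0 ∧
        (∀ l < m, p c l = p c' l) ∧ p c m ≠ p c' m := by
  obtain ⟨x₀, -, hx₀⟩ := exists_asymptotic_solution hP hB hC hN (Nat.zero_le _)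
    (rhs_mem_logExp hP hB hN)
  have hker : ∀ e : (i : Fin ν) × Fin (k i), _ := fun e =>
    exists_asymptotic_kernel hP hB hC hN e.1 e.2.2
  choose b hb0 hbX hbF using hker
  -- The constants are indexed by pairs consisting of a zero of `B` and a power of the logarithm
  -- below its multiplicity.
  set φ : (Fin (∑ i, k i) → ℝ) →ₗ[ℝ] (Fin (N + 1) → ℝ[X]) :=
    Fintype.linearCombination ℝ (fun e => b (finSigmaFinEquiv.symm e)) with hφ
  refine ⟨φ.toAffineMap + AffineMap.const ℝ _ x₀, fun c => ?_, fun c c' hcc => ?_⟩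
  · have hφF : P.F (logPower (φ c)) ∈ logBigO N := by
      rw [hφ, Fintype.linearCombination_apply]
      refine Finset.sum_induction (fun e => c e • b (finSigmaFinEquiv.symm e))
        (fun x => P.F (logPower x) ∈ logBigO N) (fun x y hx hy => ?_) ?_ (fun e _ => ?_)
      · refine logBigO_congr (add_mem hx hy) ?_
        filter_upwards [hP.Ioo_mem_nhdsGT] with t ht
        rw [logPower_add, hP.F_add (integrableOn_logPower _ hP.T'_pos)
          (integrableOn_logPower _ hP.T'_pos) (Ioo_subset_Icc_self ht), Pi.add_apply]
      · convert (logBigO N).zero_mem using 1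
        funext t
        have := F_smul (P := P) 0 (fun _ => 0) t
        simp only [zero_mul] at this
        rw [logPower_zero, this, Pi.zero_apply]
      · convert (logBigO N).smul_mem (c e) (hbF (finSigmaFinEquiv.symm e)) using 1
        funext t
        rw [logPower_smul, F_smul, Pi.smul_apply, smul_eq_mul]
    refine logBigO_congr (add_mem hφF hx₀) ?_
    filter_upwards [hP.Ioo_mem_nhdsGT] with t ht
    have : (φ.toAffineMap + AffineMap.const ℝ (Fin (∑ i, k i) → ℝ) x₀) c = φ c + x₀ := rfl
    rw [this, logPower_add, hP.F_add (integrableOn_logPower _ hP.T'_pos)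
      (integrableOn_logPower _ hP.T'_pos) (Ioo_subset_Icc_self ht), Pi.add_apply]
    ring
  · set d := c - c' with hd
    have hdφ : ∀ m, (φ c + x₀) m - (φ c' + x₀) m = φ d m := fun m => by
      rw [hd, map_sub]; simp
    -- the first zero of the characteristic function with a non-zero constant
    set S : Finset (Fin ν) := Finset.univ.filter fun i => ∃ l : Fin (k i),
      d (finSigmaFinEquiv ⟨i, l⟩) ≠ 0 with hS
    have hSne : S.Nonempty := by
      obtain ⟨e, he⟩ := Function.ne_iff.1 hcc
      refine ⟨(finSigmaFinEquiv.symm e).1, Finset.mem_filter.2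
        ⟨Finset.mem_univ _, (finSigmaFinEquiv.symm e).2, ?_⟩⟩
      rw [Sigma.eta, Equiv.apply_symm_apply, hd, Pi.sub_apply]
      exact sub_ne_zero.2 he
    obtain ⟨i₀, hi₀, hmin⟩ := S.exists_min_image j hSne
    have hj := (hC.zeros (j i₀)).2 ⟨i₀, rfl⟩
    have hφd : ∀ m, φ d m = ∑ e : (i : Fin ν) × Fin (k i), d (finSigmaFinEquiv e) • b e m := by
      intro m
      rw [hφ, Fintype.linearCombination_apply, Finset.sum_apply,
        ← Equiv.sum_comp finSigmaFinEquiv]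
      simp
    have hzero : ∀ e : (i : Fin ν) × Fin (k i), j e.1 < j i₀ → d (finSigmaFinEquiv e) = 0 := by
      intro e he
      by_contra hne
      have := hmin e.1 (Finset.mem_filter.2 ⟨Finset.mem_univ _, e.2, hne⟩)
      omega
    refine ⟨⟨j i₀, by omega⟩, hj.2, fun l hl => ?_, fun heq => ?_⟩
    · refine sub_eq_zero.1 ((hdφ l).trans ?_)
      rw [hφd]
      refine Finset.sum_eq_zero fun e _ => ?_
      rcases lt_or_ge (j e.1) (j i₀) with h | h
      · rw [hzero e h, zero_smul]
      · rw [hb0 e l (lt_of_lt_of_le (Fin.lt_def.1 hl) h), smul_zero]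
    · have h1 := (hdφ ⟨j i₀, by omega⟩).symm.trans (sub_eq_zero.2 heq)
      rw [hφd, Fintype.sum_sigma, Finset.sum_eq_single i₀] at h1
      · obtain ⟨l₀, hl₀⟩ := (Finset.mem_filter.1 hi₀).2
        -- At the order `j i₀` the basis elements belonging to `i₀` are the distinct monomials
        -- `X^l`, so a coefficient reads off a single constant.
        have h2 := congrArg (fun p => Polynomial.coeff p (l₀ : ℕ)) h1
        have hX : ∀ l : Fin (k i₀), b ⟨i₀, l⟩ ⟨j i₀, by omega⟩ = Polynomial.X ^ (l : ℕ) :=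
          fun l => hbX ⟨i₀, l⟩ _ rfl
        simp only [hX, Polynomial.finsetSum_coeff, Polynomial.coeff_smul,
          Polynomial.coeff_X_pow, Polynomial.coeff_zero, smul_eq_mul, mul_ite, mul_one,
          mul_zero] at h2
        rw [Finset.sum_eq_single l₀] at h2
        · exact hl₀ (by simpa using h2)
        · intro l _ hl
          rw [if_neg]
          exact fun h => hl (Fin.ext h.symm)
        · simp
      · intro i _ hi
        refine Finset.sum_eq_zero fun l _ => ?_
        rcases lt_or_gt_of_ne (hC.inj.ne hi) with h | h
        · rw [hzero ⟨i, l⟩ h, zero_smul]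
        · rw [hb0 ⟨i, l⟩ _ h, smul_zero]
      · simp

end VolterraData

/-! ### The contraction estimate and the reduction to `v + (M + K) v = γ`. -/

namespace VolterraData

variable {P : VolterraData} {T' : ℝ}

theorem sum_integral_sectors (hP : P.Standing T') {φ : ℝ → ℝ} (hφ : Continuous φ) {t : ℝ}
    (ht : t ∈ Icc 0 T') :
    ∑ i ∈ Finset.Icc 1 P.n, ∫ s in (P.α (i - 1) t)..(P.α i t), φ s = ∫ s in (0 : ℝ)..t, φ s := by
  have h := intervalIntegral.sum_integral_adjacent_intervals (μ := volume) (f := φ)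
    (a := fun k => P.α k t) (n := P.n) (fun k _ => hφ.intervalIntegrable _ _)
  rw [hP.α_zero t ht, hP.α_last t ht] at h
  rw [← h, Finset.range_eq_Ico, ← Finset.sum_Ico_add_right_sub_eq (c := 1)]
  refine Finset.sum_congr rfl fun i hi => ?_
  rw [Nat.sub_add_cancel (Finset.mem_Icc.1 hi).1]

/-- In a weighted supremum norm, the operator `M + K` is a contraction. -/
theorem exists_MK_contraction {ε q : ℝ} {Nstar : ℕ} (hP : P.Standing T')
    (hD : P.CondD T' ε q Nstar) :
    ∃ ρ lam : ℝ, 0 ≤ ρ ∧ ρ < 1 ∧ 0 < lam ∧ ∀ (d : ℝ → ℝ) (C t : ℝ), 0 ≤ C → t ∈ Ioc 0 T' →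
      (∀ s ∈ Ioc 0 t, |d s| ≤ C * Real.exp (lam * s)) →
      |P.MK Nstar d t| ≤ ρ * C * Real.exp (lam * t) := by
  obtain ⟨M, hM0, hM⟩ := hP.exists_bound hP.Kt_cont
  obtain ⟨κ, hκ⟩ := isCompact_Icc.exists_bound_of_continuousOn
    (hP.continuousOn_diag.inv₀ hD.Kn_ne_zero)
  have hκ0 : 0 ≤ κ := (norm_nonneg _).trans (hκ 0 hP.zero_mem)
  have hq0 : 0 ≤ q := (mul_nonneg (pow_nonneg hD.ε_pos.le _)
    (Finset.sum_nonneg fun _ _ => abs_nonneg _)).trans (hD.contraction_Icc hP hP.zero_mem)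
  have hq1 := hD.q_lt_one
  -- Chosen so that the integral part contributes at most `(1 - q)/2`, which leaves the total factor
  -- below `1`; the added `1` keeps it positive if `M` or `κ` is zero.
  set lam := 2 * κ * M / (1 - q) + 1 with hlam
  have hlam0 : 0 < lam := by
    have : 0 ≤ 2 * κ * M / (1 - q) := div_nonneg (by positivity) (by linarith)
    linarith
  have hρ : κ * M / lam ≤ (1 - q) / 2 := by
    rw [div_le_iff₀ hlam0, hlam]
    have : 0 < 1 - q := by linarith
    field_simp
    linarith
  refine ⟨q + κ * M / lam, lam, by positivity, by linarith, hlam0, fun d C t hC ht hd => ?_⟩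
  have ht' : t ∈ Icc 0 T' := ⟨ht.1.le, ht.2⟩
  have hC' : ∀ s ≤ t, C * Real.exp (lam * s) ≤ C * Real.exp (lam * t) := fun s hs =>
    mul_le_mul_of_nonneg_left
      (Real.exp_le_exp.2 (mul_le_mul_of_nonneg_left hs hlam0.le)) hC
  have h1 : |(P.K P.n t t)⁻¹ * ∑ i ∈ Finset.Icc 1 (P.n - 1), P.α' i t * (P.α i t / t) ^ Nstar *
        (P.K i t (P.α i t) - P.K (i + 1) t (P.α i t)) * d (P.α i t)| ≤
      q * (C * Real.exp (lam * t)) := by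
    have hCt : 0 ≤ C * Real.exp (lam * t) := by positivity
    refine le_trans ?_ (mul_le_mul_of_nonneg_right (hD.contraction_Icc hP ht') hCt)
    rw [Finset.mul_sum, Finset.mul_sum, Finset.sum_mul]
    refine (Finset.abs_sum_le_sum_abs _ _).trans (Finset.sum_le_sum fun i hi => ?_)
    have hi' := Finset.mem_Icc.1 hi
    have hα0 := hP.α_pos hi'.1 (by omega : i ≤ P.n) ht
    have hαt := hP.α_le_self (by omega : i ≤ P.n) ht'
    have hr0 : 0 ≤ P.α i t / t := div_nonneg hα0.le ht.1.le
    have hr : (P.α i t / t) ^ Nstar ≤ ε ^ Nstar :=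
      pow_le_pow_left₀ hr0 (hD.α_div_le i hi t ht) _
    rw [show (P.K P.n t t)⁻¹ * (P.α' i t * (P.α i t / t) ^ Nstar *
        (P.K i t (P.α i t) - P.K (i + 1) t (P.α i t)) * d (P.α i t)) =
      (P.α i t / t) ^ Nstar * (P.α' i t * (P.K P.n t t)⁻¹ *
        (P.K i t (P.α i t) - P.K (i + 1) t (P.α i t))) * d (P.α i t) by ring,
      abs_mul, abs_mul, abs_of_nonneg (pow_nonneg hr0 _)]
    refine mul_le_mul (mul_le_mul_of_nonneg_right hr (abs_nonneg _))
      ((hd _ ⟨hα0, hαt⟩).trans (hC' _ hαt)) (abs_nonneg _)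
      (mul_nonneg (pow_nonneg hD.ε_pos.le _) (abs_nonneg _))
  have h2 : |∑ i ∈ Finset.Icc 1 P.n,
          ∫ s in (P.α (i - 1) t)..(P.α i t), P.Kt i t s * (s / t) ^ Nstar * d s| ≤
      M / lam * (C * Real.exp (lam * t)) := by
    have hcont : Continuous fun s => M * (C * Real.exp (lam * s)) := by fun_prop
    have h3 : ∑ i ∈ Finset.Icc 1 P.n,
        |∫ s in (P.α (i - 1) t)..(P.α i t), P.Kt i t s * (s / t) ^ Nstar * d s| ≤
        ∑ i ∈ Finset.Icc 1 P.n,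
          ∫ s in (P.α (i - 1) t)..(P.α i t), M * (C * Real.exp (lam * s)) := by
      refine Finset.sum_le_sum fun i hi => ?_
      have hi' := Finset.mem_Icc.1 hi
      rw [← Real.norm_eq_abs]
      refine intervalIntegral.norm_integral_le_of_norm_le (hP.α_mono (by omega) hi'.2 ht')
        (Eventually.of_forall fun s hs => ?_) (hcont.intervalIntegrable _ _)
      have hs0 := hP.Ioc_subset hi'.2 ht' hs
      have hr0 : 0 ≤ s / t := div_nonneg hs0.1.le ht.1.le
      have hr1 : (s / t) ^ Nstar ≤ 1 := pow_le_one₀ hr0 ((div_le_one ht.1).2 hs0.2)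
      rw [Real.norm_eq_abs, abs_mul, abs_mul, abs_of_nonneg (pow_nonneg hr0 _)]
      have hb := hM i hi (t, s) ⟨ht', hs.1.le, hs.2⟩
      refine mul_le_mul ?_ (hd s hs0) (abs_nonneg _) hM0
      calc _ ≤ M * 1 := mul_le_mul hb hr1 (pow_nonneg hr0 _) hM0
        _ = M := mul_one M
    refine (Finset.abs_sum_le_sum_abs _ _).trans (h3.trans ?_)
    -- The sector bounds add up to a single integral over `[0, t]`, and integrating the weight gains
    -- the factor `1/lam`.
    rw [sum_integral_sectors hP hcont ht', intervalIntegral.integral_const_mul,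
      intervalIntegral.integral_const_mul]
    have h4 : ∫ s in (0 : ℝ)..t, Real.exp (lam * s) ≤ Real.exp (lam * t) / lam := by
      have hderiv : ∀ s ∈ uIcc 0 t, HasDerivAt (fun s => Real.exp (lam * s) / lam)
          (Real.exp (lam * s)) s := fun s _ => by
        refine ((((hasDerivAt_id s).const_mul lam).exp).div_const lam).congr_deriv ?_
        simp only [id]
        field_simp
      rw [intervalIntegral.integral_eq_sub_of_hasDerivAt hderiv
        ((by fun_prop : Continuous fun s => Real.exp (lam * s)).intervalIntegrable _ _)]
      have : 0 ≤ Real.exp (lam * 0) / lam := by positivity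
      linarith
    calc M * (C * ∫ s in (0 : ℝ)..t, Real.exp (lam * s))
        ≤ M * (C * (Real.exp (lam * t) / lam)) := by gcongr
      _ = M / lam * (C * Real.exp (lam * t)) := by ring
  rw [MK, mul_add]
  refine (abs_add_le _ _).trans ?_
  rw [abs_mul (P.K P.n t t)⁻¹ (∑ i ∈ Finset.Icc 1 P.n, _)]
  have h5 : |(P.K P.n t t)⁻¹| ≤ κ := hκ t ht'
  calc _ ≤ q * (C * Real.exp (lam * t)) + κ * (M / lam * (C * Real.exp (lam * t))) :=
        add_le_add h1 (mul_le_mul h5 h2 (abs_nonneg _) hκ0)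
    _ = (q + κ * M / lam) * C * Real.exp (lam * t) := by ring

/-- Conjugation by `t^{N*}` produces the small factors `(α_i(t)/t)^{N*}` on which the contraction
depends. -/
theorem F_pow_mul {Nstar : ℕ} {v : ℝ → ℝ} {t : ℝ} (ht : t ≠ 0) (hK : P.K P.n t t ≠ 0) :
    P.F (fun s => s ^ Nstar * v s) t = t ^ Nstar * P.K P.n t t * (v t + P.MK Nstar v t) := by
  have h1 : ∀ i ∈ Finset.Icc 1 P.n, (∫ s in (P.α (i - 1) t)..(P.α i t),
      P.Kt i t s * (s ^ Nstar * v s)) =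
      t ^ Nstar * ∫ s in (P.α (i - 1) t)..(P.α i t), P.Kt i t s * (s / t) ^ Nstar * v s := by
    intro i _
    rw [← intervalIntegral.integral_const_mul]
    refine intervalIntegral.integral_congr fun s _ => ?_
    simp only [div_pow]
    field_simp
  have h2 : ∀ i ∈ Finset.Icc 1 (P.n - 1),
      P.α' i t * (P.K i t (P.α i t) - P.K (i + 1) t (P.α i t)) *
        (P.α i t ^ Nstar * v (P.α i t)) =
      t ^ Nstar * (P.α' i t * (P.α i t / t) ^ Nstar *
        (P.K i t (P.α i t) - P.K (i + 1) t (P.α i t)) * v (P.α i t)) := by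
    intro i _
    rw [div_pow]
    field_simp
  rw [F, MK, Finset.sum_congr rfl h1, Finset.sum_congr rfl h2, ← Finset.mul_sum, ← Finset.mul_sum]
  field_simp
  ring

theorem MK_eq {Nstar : ℕ} (v : ℝ → ℝ) {t : ℝ} (ht : t ≠ 0) (hK : P.K P.n t t ≠ 0) :
    P.MK Nstar v t = P.F (fun s => s ^ Nstar * v s) t / (t ^ Nstar * P.K P.n t t) - v t := by
  rw [F_pow_mul ht hK, mul_div_cancel_left₀ _ (mul_ne_zero (pow_ne_zero _ ht) hK)]
  ring

theorem integrableOn_pow_mul {v : ℝ → ℝ} (m : ℕ) (hv : IntegrableOn v (Ioc 0 T')) :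
    IntegrableOn (fun s => s ^ m * v s) (Ioc 0 T') := by
  rw [← integrableOn_Icc_iff_integrableOn_Ioc] at hv ⊢
  exact hv.continuousOn_mul (continuousOn_pow m) isCompact_Icc

theorem MK_sub {Nstar : ℕ} {ε q : ℝ} (hP : P.Standing T') (hD : P.CondD T' ε q Nstar)
    {v w : ℝ → ℝ} (hv : IntegrableOn v (Ioc 0 T')) (hw : IntegrableOn w (Ioc 0 T')) {t : ℝ}
    (ht : t ∈ Ioc 0 T') :
    P.MK Nstar (fun s => v s - w s) t = P.MK Nstar v t - P.MK Nstar w t := by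
  have ht' : t ∈ Icc 0 T' := ⟨ht.1.le, ht.2⟩
  have hK := hD.Kn_ne_zero t ht'
  have h1 := hP.F_add (integrableOn_pow_mul Nstar hv)
    ((integrableOn_pow_mul Nstar hw).const_mul (-1)) ht'
  have h2 : (fun s => s ^ Nstar * v s + -1 * (s ^ Nstar * w s)) =
      fun s => s ^ Nstar * (v s - w s) := by funext s; ring
  rw [h2, F_smul] at h1
  rw [MK_eq _ ht.1.ne' hK, MK_eq _ ht.1.ne' hK, MK_eq _ ht.1.ne' hK, h1]
  ring

theorem continuousOn_F (hP : P.Standing T') {x : ℝ → ℝ} (hx : IntegrableOn x (Ioc 0 T'))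
    (hxc : ContinuousOn x (Ioc 0 T')) : ContinuousOn (P.F x) (Ioc 0 T') := by
  have hsub : Ioc 0 T' ⊆ Icc 0 T' := Ioc_subset_Icc_self
  refine (((hP.continuousOn_diag.mono hsub).mul hxc).add
    (continuousOn_finsetSum _ fun i hi => ?_)).add (continuousOn_finsetSum _ fun i hi =>
      (hP.continuousOn_sectorIntegral (Finset.mem_Icc.1 hi).2 (hP.Kt_cont i hi) hx).mono hsub)
  have hi' := Finset.mem_Icc.1 hi
  have hin : i ≤ P.n := by omega
  refine (((hP.α'_cont i hin).mul (hP.continuousOn_jump hi)).mono hsub).mul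
    (hxc.comp ((hP.α_continuousOn hin).mono hsub) fun t ht => ⟨hP.α_pos hi'.1 hin ht, ?_⟩)
  exact (hP.α_le_self hin (hsub ht)).trans ht.2

theorem continuousOn_rhs (hP : P.Standing T') : ContinuousOn P.rhs (Icc 0 T') := by
  have h1 : (1 : ℕ) ∈ Finset.Icc 1 P.n := by simpa using hP.n_pos
  refine hP.f'_cont.sub (ContinuousOn.mul ?_ continuousOn_const)
  refine (hP.continuousOn_lower hP.n_pos (hP.Kt_cont 1 h1)).congr fun t ht => ?_
  simp only [Nat.sub_self, hP.α_zero t ht]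

end VolterraData

/-! ### Successive approximations among functions vanishing at zero. -/

/-- Continuous functions on `(0, T]` that tend to zero at zero. -/
structure VanishingAtZero (T : ℝ) (v : ℝ → ℝ) : Prop where
  continuousOn : ContinuousOn v (Ioc 0 T)
  tendsto : Tendsto v (𝓝[>] 0) (𝓝 0)

namespace VanishingAtZero

variable {T : ℝ} {v w : ℝ → ℝ}

theorem integrableOn (hv : VanishingAtZero T v) (hT : 0 < T) : IntegrableOn v (Ioc 0 T) :=
  integrableOn_of_mem_logBigO hT hv.continuousOn
    (mem_logBigO_of_isBigO (by simpa using hv.tendsto.isBigO_one ℝ))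

theorem continuousOn_update (hv : VanishingAtZero T v) (hT : 0 < T) :
    ContinuousOn (Function.update v 0 0) (Icc 0 T) := by
  rw [continuousOn_update_iff, Icc_sdiff_left]
  refine ⟨hv.continuousOn, fun _ => ?_⟩
  rw [nhdsWithin_Ioc_eq_nhdsGT hT]
  exact hv.tendsto

theorem exists_bound (hv : VanishingAtZero T v) (hT : 0 < T) :
    ∃ C, 0 ≤ C ∧ ∀ t ∈ Ioc 0 T, |v t| ≤ C := by
  obtain ⟨C, hC⟩ := isCompact_Icc.exists_bound_of_continuousOn (hv.continuousOn_update hT)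
  refine ⟨C, (norm_nonneg _).trans (hC 0 ⟨le_rfl, hT.le⟩), fun t ht => ?_⟩
  have := hC t ⟨ht.1.le, ht.2⟩
  rwa [Function.update_of_ne ht.1.ne'] at this

theorem neg_add (hv : VanishingAtZero T v) (hw : VanishingAtZero T w) :
    VanishingAtZero T fun t => -v t + w t :=
  ⟨hv.continuousOn.neg.add hw.continuousOn, by simpa using hv.tendsto.neg.add hw.tendsto⟩

theorem of_tendstoUniformlyOn {u : ℕ → ℝ → ℝ} (hu : ∀ m, VanishingAtZero T (u m)) (hT : 0 < T)
    (h : TendstoUniformlyOn u v atTop (Ioc 0 T)) : VanishingAtZero T v := by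
  refine ⟨h.continuousOn (Eventually.of_forall fun m => (hu m).continuousOn).frequently, ?_⟩
  rw [Metric.tendsto_nhds]
  intro e he
  obtain ⟨m, hm⟩ := (Metric.tendstoUniformlyOn_iff.1 h (e / 2) (by positivity)).exists
  filter_upwards [Metric.tendsto_nhds.1 (hu m).tendsto (e / 2) (by positivity),
    Ioo_mem_nhdsGT hT] with t h1 h2
  have h3 := hm t ⟨h2.1, h2.2.le⟩
  linarith [dist_triangle (v t) (u m t) 0]

end VanishingAtZero

namespace VolterraData

variable {P : VolterraData} {T' ε q : ℝ} {Nstar : ℕ}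

theorem vanishing_MK (hP : P.Standing T') (hD : P.CondD T' ε q Nstar) {v : ℝ → ℝ}
    (hv : VanishingAtZero T' v) : VanishingAtZero T' (P.MK Nstar v) := by
  have hT := hP.T'_pos
  have hsub : Ioc 0 T' ⊆ Icc 0 T' := Ioc_subset_Icc_self
  constructor
  · have h1 := continuousOn_F hP (integrableOn_pow_mul Nstar (hv.integrableOn hT))
      ((continuousOn_pow Nstar).mul hv.continuousOn)
    refine ContinuousOn.congr (f := fun t => P.F (fun s => s ^ Nstar * v s) t /
      (t ^ Nstar * P.K P.n t t) - v t) ((h1.div ((continuousOn_pow Nstar).mul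
        (hP.continuousOn_diag.mono hsub)) fun t ht => ?_).sub hv.continuousOn) fun t ht => ?_
    · exact mul_ne_zero (pow_ne_zero _ ht.1.ne') (hD.Kn_ne_zero t (hsub ht))
    · exact MK_eq _ ht.1.ne' (hD.Kn_ne_zero t (hsub ht))
  · obtain ⟨ρ, lam, hρ0, hρ1, hlam, hc⟩ := exists_MK_contraction hP hD
    rw [Metric.tendsto_nhds]
    intro e he
    -- Only values on `(0, t]` enter at time `t`, so the contraction estimate may be used with a
    -- bound `η` valid merely near zero.
    set η := e / (2 * Real.exp (lam * T')) with hη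
    have hη0 : 0 < η := by positivity
    obtain ⟨r, hr, hr'⟩ := mem_nhdsGT_iff_exists_Ioo_subset.1
      (Metric.tendsto_nhds.1 hv.tendsto η hη0)
    filter_upwards [Ioo_mem_nhdsGT hT, Ioo_mem_nhdsGT (show (0 : ℝ) < r from hr)] with t ht htr
    have h1 := hc v η t hη0.le ⟨ht.1, ht.2.le⟩ fun s hs => by
      have h2 := hr' (⟨hs.1, hs.2.trans_lt htr.2⟩ : s ∈ Ioo 0 r)
      simp only [mem_ofPred_eq, Real.dist_eq, sub_zero] at h2
      refine h2.le.trans (le_mul_of_one_le_right hη0.le ?_)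
      exact Real.one_le_exp (mul_nonneg hlam.le hs.1.le)
    rw [Real.dist_eq, sub_zero]
    have h3 : Real.exp (lam * t) ≤ Real.exp (lam * T') :=
      Real.exp_le_exp.2 (mul_le_mul_of_nonneg_left ht.2.le hlam.le)
    calc _ ≤ ρ * η * Real.exp (lam * t) := h1
      _ ≤ 1 * η * Real.exp (lam * T') := by gcongr
      _ = e / 2 := by rw [hη]; field_simp
      _ < e := by linarith

/-- The division by `t^{N*}` is harmless because the residual of `x̂` is `o(t^{N*})`. -/
theorem vanishing_γ (hP : P.Standing T') (hD : P.CondD T' ε q Nstar) {x : ℝ → ℝ}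
    (hx : IntegrableOn x (Ioc 0 T')) (hxc : ContinuousOn x (Ioc 0 T'))
    (h : (fun t => P.F x t - P.rhs t) =o[𝓝[>] 0] fun t => t ^ Nstar) :
    VanishingAtZero T' (P.γ Nstar x) := by
  have hsub : Ioc 0 T' ⊆ Icc 0 T' := Ioc_subset_Icc_self
  constructor
  · exact (((continuousOn_rhs hP).mono hsub).sub (continuousOn_F hP hx hxc)).div
      ((continuousOn_pow Nstar).mul (hP.continuousOn_diag.mono hsub)) fun t ht =>
        mul_ne_zero (pow_ne_zero _ ht.1.ne') (hD.Kn_ne_zero t (hsub ht))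
  · have h1 := h.tendsto_div_nhds_zero
    have h2 := hP.tendsto_nhdsGT (hP.continuousOn_diag.inv₀ hD.Kn_ne_zero)
    have h3 := (h1.mul h2).neg
    rw [zero_mul, neg_zero] at h3
    refine h3.congr fun t => ?_
    rw [γ, Pi.inv_apply, ← div_eq_mul_inv, div_div, ← neg_div, neg_sub]

/-- Convergence of the successive approximations. -/
theorem exists_limit_approx (hP : P.Standing T') (hD : P.CondD T' ε q Nstar) {x : ℝ → ℝ}
    (hγ : VanishingAtZero T' (P.γ Nstar x)) :
    ∃ v : ℝ → ℝ, ContinuousOn v (Icc 0 T') ∧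
      TendstoUniformlyOn (P.approx Nstar x) v atTop (Ioc 0 T') ∧
      ∀ t ∈ Ioc 0 T', v t + P.MK Nstar v t = P.γ Nstar x t := by
  have hT := hP.T'_pos
  obtain ⟨ρ, lam, hρ0, hρ1, hlam, hc⟩ := exists_MK_contraction hP hD
  set u := P.approx Nstar x with hu
  have husucc : ∀ m t, u (m + 1) t = -P.MK Nstar (u m) t + P.γ Nstar x t := fun m t => rfl
  have huV : ∀ m, VanishingAtZero T' (u m) := by
    intro m
    induction m with
    | zero => exact hγ
    | succ m ih => exact (vanishing_MK hP hD ih).neg_add hγ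
  have huI : ∀ m, IntegrableOn (u m) (Ioc 0 T') := fun m => (huV m).integrableOn hT
  obtain ⟨C, hC0, hC⟩ := hγ.exists_bound hT
  have hdiff : ∀ m, ∀ t ∈ Ioc 0 T',
      |u (m + 1) t - u m t| ≤ ρ ^ (m + 1) * C * Real.exp (lam * t) := by
    intro m
    induction m with
    | zero =>
      intro t ht
      have h1 := hc (u 0) C t hC0 ht fun s hs => (hC s ⟨hs.1, hs.2.trans ht.2⟩).trans
        (le_mul_of_one_le_right hC0 (Real.one_le_exp (mul_nonneg hlam.le hs.1.le)))
      rw [husucc, show P.γ Nstar x t = u 0 t from rfl, add_sub_cancel_right, abs_neg, zero_add,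
        pow_one]
      exact h1
    | succ m ih =>
      intro t ht
      have h1 := hc (fun s => u (m + 1) s - u m s) (ρ ^ (m + 1) * C) t (by positivity) ht
        fun s hs => ih s ⟨hs.1, hs.2.trans ht.2⟩
      rw [MK_sub hP hD (huI _) (huI _) ht] at h1
      rw [husucc (m + 1), husucc m, show -P.MK Nstar (u (m + 1)) t + P.γ Nstar x t -
        (-P.MK Nstar (u m) t + P.γ Nstar x t) = -(P.MK Nstar (u (m + 1)) t - P.MK Nstar (u m) t)
        by ring, abs_neg]
      calc _ ≤ ρ * (ρ ^ (m + 1) * C) * Real.exp (lam * t) := h1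
        _ = _ := by ring
  have hsum : Summable fun m : ℕ => ρ ^ (m + 1) * C * Real.exp (lam * T') := by
    have := (summable_geometric_of_lt_one hρ0 hρ1).mul_left (ρ * C * Real.exp (lam * T'))
    exact this.congr fun m => by ring
  have hM := tendstoUniformlyOn_tsum_nat (f := fun m t => u (m + 1) t - u m t) hsum
    (s := Ioc 0 T') fun m t ht => by
      rw [Real.norm_eq_abs]
      refine (hdiff m t ht).trans ?_
      have : Real.exp (lam * t) ≤ Real.exp (lam * T') :=
        Real.exp_le_exp.2 (mul_le_mul_of_nonneg_left ht.2 hlam.le)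
      gcongr
  -- The approximations are controlled only for `t > 0`, so the value at zero is prescribed as the
  -- limit `0`.
  set v := Function.update (fun t => u 0 t + ∑' m, (u (m + 1) t - u m t)) 0 0 with hv
  have hlim : TendstoUniformlyOn u v atTop (Ioc 0 T') := by
    rw [Metric.tendstoUniformlyOn_iff] at hM ⊢
    intro e he
    filter_upwards [hM e he] with m hm t ht
    have h1 := hm t ht
    rw [Finset.sum_range_sub (fun m => u m t), Real.dist_eq] at h1
    rw [hv, Function.update_of_ne ht.1.ne', Real.dist_eq]
    convert h1 using 2
    ring
  have hvV := VanishingAtZero.of_tendstoUniformlyOn huV hT hlim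
  refine ⟨v, ?_, hlim, fun t ht => ?_⟩
  · have := hvV.continuousOn_update hT
    rwa [hv, Function.update_idem] at this
  · have h1 : Tendsto (fun m => u (m + 1) t) atTop (𝓝 (v t)) :=
      (hlim.tendsto_at ht).comp (tendsto_add_atTop_nat 1)
    have h2 : Tendsto (fun m => P.MK Nstar (u m) t) atTop (𝓝 (P.MK Nstar v t)) := by
      rw [Metric.tendsto_nhds]
      intro e he
      set η := e / (2 * Real.exp (lam * t)) with hη
      have hη0 : 0 < η := by positivity
      filter_upwards [Metric.tendstoUniformlyOn_iff.1 hlim η hη0] with m hm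
      have h3 := hc (fun s => u m s - v s) η t hη0.le ht fun s hs => by
        have h4 := hm s ⟨hs.1, hs.2.trans ht.2⟩
        rw [dist_comm, Real.dist_eq] at h4
        exact h4.le.trans (le_mul_of_one_le_right hη0.le
          (Real.one_le_exp (mul_nonneg hlam.le hs.1.le)))
      rw [MK_sub hP hD (huI m) (hvV.integrableOn hT) ht] at h3
      rw [Real.dist_eq]
      calc _ ≤ ρ * η * Real.exp (lam * t) := h3
        _ ≤ 1 * η * Real.exp (lam * t) := by gcongr
        _ = e / 2 := by rw [hη]; field_simp
        _ < e := by linarith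
    have h3 := tendsto_nhds_unique h1 (h2.neg.add_const (P.γ Nstar x t))
    linarith

/-- Iterating the contraction estimate from a uniform bound gives `|v - w| ≤ ρ^m C e^{λt}` for every
`m`. The equation is used only on the open interval, and continuity supplies the end points. -/
theorem eqOn_of_add_MK_eq (hP : P.Standing T') (hD : P.CondD T' ε q Nstar) {v w g : ℝ → ℝ}
    (hv : ContinuousOn v (Icc 0 T')) (hw : ContinuousOn w (Icc 0 T'))
    (hve : ∀ t ∈ Ioo 0 T', v t + P.MK Nstar v t = g t)
    (hwe : ∀ t ∈ Ioo 0 T', w t + P.MK Nstar w t = g t) : EqOn v w (Icc 0 T') := by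
  have hT := hP.T'_pos
  obtain ⟨ρ, lam, hρ0, hρ1, hlam, hc⟩ := exists_MK_contraction hP hD
  obtain ⟨C, hC⟩ := isCompact_Icc.exists_bound_of_continuousOn (hv.sub hw)
  have hC0 : 0 ≤ C := (norm_nonneg _).trans (hC 0 hP.zero_mem)
  have hI : ∀ {u : ℝ → ℝ}, ContinuousOn u (Icc 0 T') → IntegrableOn u (Ioc 0 T') := fun hu =>
    hu.integrableOn_Icc.mono_set Ioc_subset_Icc_self
  have hb : ∀ m : ℕ, ∀ t ∈ Ioo 0 T', |v t - w t| ≤ ρ ^ m * C * Real.exp (lam * t) := by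
    intro m
    induction m with
    | zero =>
      intro t ht
      rw [pow_zero, one_mul]
      exact (hC t (Ioo_subset_Icc_self ht)).trans
        (le_mul_of_one_le_right hC0 (Real.one_le_exp (mul_nonneg hlam.le ht.1.le)))
    | succ m ih =>
      intro t ht
      have ht' : t ∈ Ioc 0 T' := ⟨ht.1, ht.2.le⟩
      have h1 := hc (fun s => v s - w s) (ρ ^ m * C) t (by positivity) ht'
        fun s hs => ih s ⟨hs.1, hs.2.trans_lt ht.2⟩
      rw [MK_sub hP hD (hI hv) (hI hw) ht'] at h1
      have h2 : v t - w t = -(P.MK Nstar v t - P.MK Nstar w t) := by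
        linarith [hve t ht, hwe t ht]
      rw [h2, abs_neg]
      calc _ ≤ ρ * (ρ ^ m * C) * Real.exp (lam * t) := h1
        _ = _ := by ring
  have heq : EqOn v w (Ioo 0 T') := by
    intro t ht
    have h1 : Tendsto (fun m : ℕ => ρ ^ m * C * Real.exp (lam * t)) atTop (𝓝 0) := by
      have := ((tendsto_pow_atTop_nhds_zero_of_lt_one hρ0 hρ1).mul_const C).mul_const
        (Real.exp (lam * t))
      simpa using this
    have h2 := ge_of_tendsto' h1 fun m => hb m t ht
    exact sub_eq_zero.1 (abs_nonpos_iff.1 h2)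
  exact heq.of_subset_closure hv hw Ioo_subset_Icc_self (by rw [closure_Ioo hT.ne])

end VolterraData

/-! ### Test functions, regular distributions and representing measures. -/

/-- Take a smooth `f ≥ 0` whose support is the open set and cut it off as `smoothTransition (m f -
1)`. This lives on the closed set `m f ≥ 1`, hence has compact support inside, and equals `1` once
`m f ≥ 2`. -/
theorem exists_smooth_approx_indicator {a b T' : ℝ} :
    ∃ φ : ℕ → 𝓓(halfLine T', ℝ), (∀ m s, |φ m s| ≤ 1) ∧
      ∀ s, Tendsto (fun m => φ m s) atTop
        (𝓝 ((Ioo a b ∩ Iio T').indicator (fun _ => (1 : ℝ)) s)) := by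
  obtain ⟨f, hfs, hf, hfr⟩ := (isOpen_Ioo.inter isOpen_Iio :
    IsOpen (Ioo a b ∩ Iio T')).exists_contDiff_support_eq (n := ⊤)
  have hsub : ∀ m : ℕ, tsupport (fun s => Real.smoothTransition (m * f s - 1)) ⊆
      Ioo a b ∩ Iio T' := by
    intro m
    have h1 : tsupport (fun s => Real.smoothTransition (m * f s - 1)) ⊆ {s | 1 ≤ m * f s} := by
      refine closure_minimal (fun s hs => ?_)
        (isClosed_le continuous_const (continuous_const.mul hf.continuous))
      by_contra h
      simp only [mem_ofPred_eq, not_le] at h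
      exact hs (Real.smoothTransition.zero_of_nonpos (by linarith))
    refine h1.trans fun s hs => ?_
    rw [← hfs, Function.mem_support]
    intro h0
    simp only [mem_ofPred_eq, h0, mul_zero] at hs
    linarith
  refine ⟨fun m => ⟨fun s => Real.smoothTransition (m * f s - 1),
    Real.smoothTransition.contDiff.comp ((contDiff_const.mul hf).sub contDiff_const),
    HasCompactSupport.of_support_subset_isCompact (isCompact_Icc (a := a) (b := b))
      (subset_closure.trans ((hsub m).trans fun s hs => Ioo_subset_Icc_self hs.1)),
    (hsub m).trans inter_subset_right⟩, fun m s => ?_, fun s => ?_⟩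
  · change |Real.smoothTransition (m * f s - 1)| ≤ 1
    rw [abs_of_nonneg (Real.smoothTransition.nonneg _)]
    exact Real.smoothTransition.le_one _
  · change Tendsto (fun m : ℕ => Real.smoothTransition (m * f s - 1)) atTop _
    by_cases hs : s ∈ Ioo a b ∩ Iio T'
    · rw [indicator_of_mem hs]
      have hpos : 0 < f s := lt_of_le_of_ne (hfr ⟨s, rfl⟩).1 (by
        rw [← hfs, Function.mem_support] at hs; exact hs.symm)
      refine tendsto_const_nhds.congr' ?_
      have := (tendsto_natCast_atTop_atTop (R := ℝ)).atTop_mul_const hpos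
      filter_upwards [this.eventually_ge_atTop 2] with m hm
      exact (Real.smoothTransition.one_of_one_le (by linarith)).symm
    · rw [indicator_of_notMem hs]
      have h0 : f s = 0 := by
        rw [← hfs] at hs; exact Function.notMem_support.1 hs
      refine tendsto_const_nhds.congr fun m => ?_
      rw [h0, mul_zero]
      exact (Real.smoothTransition.zero_of_nonpos (by norm_num)).symm

/-- Finite measures on `[0, T')` are determined by their values on test functions. -/
theorem measure_eq_of_testFunctions {T' : ℝ} {μ ν : Measure ℝ} [IsFiniteMeasure μ]
    [IsFiniteMeasure ν] (hμ : μ (Ico 0 T')ᶜ = 0) (hν : ν (Ico 0 T')ᶜ = 0)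
    (h : ∀ φ : 𝓓(halfLine T', ℝ), ∫ s, φ s ∂μ = ∫ s, φ s ∂ν) : μ = ν := by
  refine Real.measure_ext_Ioo_rat fun a b => ?_
  obtain ⟨φ, hφ1, hφ⟩ := exists_smooth_approx_indicator (a := a) (b := b) (T' := T')
  have hmeas : MeasurableSet (Ioo (a : ℝ) b ∩ Iio T') := measurableSet_Ioo.inter measurableSet_Iio
  have hlim : ∀ (ρ : Measure ℝ) [IsFiniteMeasure ρ], Tendsto (fun m => ∫ s, φ m s ∂ρ) atTop
      (𝓝 (ρ.real (Ioo (a : ℝ) b ∩ Iio T'))) := by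
    intro ρ _
    have h1 := tendsto_integral_of_dominated_convergence (μ := ρ) (F := fun m s => φ m s)
      (fun _ => (1 : ℝ)) (fun m => (φ m).continuous.aestronglyMeasurable) (integrable_const _)
      (fun m => Eventually.of_forall fun s => hφ1 m s) (Eventually.of_forall hφ)
    rwa [integral_indicator_const _ hmeas, smul_eq_mul, mul_one] at h1
  have heq := tendsto_nhds_unique ((hlim μ).congr fun m => h (φ m)) (hlim ν)
  have hnull : ∀ {ρ : Measure ℝ}, ρ (Ico 0 T')ᶜ = 0 →
      ρ (Ioo (a : ℝ) b ∩ Iio T') = ρ (Ioo (a : ℝ) b) := fun hρ =>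
    measure_inter_conull (measure_mono_null (compl_subset_compl.2 Ico_subset_Iio_self) hρ)
  rw [← hnull hμ, ← hnull hν]
  exact (measureReal_eq_measureReal_iff).1 heq

theorem regularDist_apply {T' : ℝ} {x : ℝ → ℝ} (hx : IntegrableOn x (Ioo 0 T'))
    (φ : 𝓓(halfLine T', ℝ)) : regularDist T' x φ = ∫ s in Ioo 0 T', φ s * x s := by
  have h1 : Integrable ((Ioo 0 T').indicator x) := (integrable_indicator_iff measurableSet_Ioo).2 hx
  have h2 : regularDist T' x φ = TestFunction.integralAgainstBilinCLM
    (ContinuousLinearMap.mul ℝ ℝ) volume ((Ioo 0 T').indicator x) φ := rfl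
  rw [h2, TestFunction.integralAgainstBilinCLM_eq_integral
    (h1.locallyIntegrable.locallyIntegrableOn _), ← integral_indicator measurableSet_Ioo]
  refine integral_congr_ae (Eventually.of_forall fun s => ?_)
  by_cases hs : s ∈ Ioo 0 T' <;> simp [hs]

theorem regularDist_congr {T' : ℝ} {x y : ℝ → ℝ} (h : EqOn x y (Ioo 0 T')) :
    regularDist T' x = regularDist T' y := by
  have : (Ioo 0 T').indicator x = (Ioo 0 T').indicator y := indicator_congr h
  ext φ
  change TestFunction.integralAgainstBilinCLM (ContinuousLinearMap.mul ℝ ℝ) volume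
    ((Ioo 0 T').indicator x) φ = TestFunction.integralAgainstBilinCLM
    (ContinuousLinearMap.mul ℝ ℝ) volume ((Ioo 0 T').indicator y) φ
  rw [this]

/-- Testing with functions supported in `(0, T')` gives equality almost everywhere, and continuity
upgrades it. -/
theorem eqOn_of_regularDist_eq {T' : ℝ} {x y : ℝ → ℝ} (hx : IntegrableOn x (Ioo 0 T'))
    (hy : IntegrableOn y (Ioo 0 T')) (hxc : ContinuousOn x (Ioo 0 T'))
    (hyc : ContinuousOn y (Ioo 0 T')) (h : regularDist T' x = regularDist T' y) :
    EqOn x y (Ioo 0 T') := by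
  have hae := isOpen_Ioo.ae_eq_zero_of_integral_contDiff_smul_eq_zero
    (f := fun s => x s - y s) (μ := volume.restrict (Ioo 0 T')) (U := Ioo 0 T')
    ((hx.sub hy).locallyIntegrable.locallyIntegrableOn _) (fun g hg hgc hgs => by
      have h1 : regularDist T' x ⟨g, hg, hgc, hgs.trans Ioo_subset_Iio_self⟩ =
        regularDist T' y ⟨g, hg, hgc, hgs.trans Ioo_subset_Iio_self⟩ := by rw [h]
      rw [regularDist_apply hx, regularDist_apply hy] at h1
      change ∫ s in Ioo 0 T', g s * x s = ∫ s in Ioo 0 T', g s * y s at h1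
      have hmul : ∀ {z : ℝ → ℝ}, IntegrableOn z (Ioo 0 T') →
          Integrable (fun s => g s * z s) (volume.restrict (Ioo 0 T')) := fun hz => by
        obtain ⟨C, hC⟩ := hgc.exists_bound_of_continuous hg.continuous
        exact Integrable.bdd_mul hz hg.continuous.aestronglyMeasurable
          (Eventually.of_forall hC)
      simp only [smul_eq_mul, mul_sub]
      rw [integral_sub (hmul hx) (hmul hy), h1, sub_self])
  refine Measure.eqOn_Ioo_of_ae_eq volume ?_ hxc hyc
  filter_upwards [hae, ae_restrict_mem measurableSet_Ioo] with s h1 h2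
  exact sub_eq_zero.1 (h1 h2)

theorem deltaPlus_apply {T' a : ℝ} {x : ℝ → ℝ} (hx : IntegrableOn x (Ioo 0 T'))
    (φ : 𝓓(halfLine T', ℝ)) :
    deltaPlus T' a x φ = a * φ 0 + ∫ s in Ioo 0 T', φ s * x s := by
  rw [← regularDist_apply hx]
  rfl

/-- The positive part of the signed measure `a δ + x(s) ds` on `[0, T')`. -/
noncomputable def posMeasure (T' a : ℝ) (x : ℝ → ℝ) : Measure ℝ :=
  a.toNNReal • Measure.dirac 0 +
    (volume.restrict (Ioo 0 T')).withDensity fun s => ((x s).toNNReal : ENNReal)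

theorem isFiniteMeasure_posMeasure {T' a : ℝ} {x : ℝ → ℝ} (hx : IntegrableOn x (Ioo 0 T')) :
    IsFiniteMeasure (posMeasure T' a x) := by
  have : IsFiniteMeasure
      ((volume.restrict (Ioo 0 T')).withDensity fun s => ((x s).toNNReal : ENNReal)) :=
    isFiniteMeasure_withDensity_ofReal hx.hasFiniteIntegral
  unfold posMeasure
  infer_instance

theorem posMeasure_compl {T' a : ℝ} (hT : 0 < T') (x : ℝ → ℝ) :
    posMeasure T' a x (Ico 0 T')ᶜ = 0 := by
  have h1 : (volume.restrict (Ioo 0 T')).withDensity (fun s => ((x s).toNNReal : ENNReal))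
      (Ico 0 T')ᶜ = 0 := by
    refine withDensity_absolutelyContinuous _ _ ?_
    rw [Measure.restrict_apply measurableSet_Ico.compl]
    have : (Ico 0 T')ᶜ ∩ Ioo 0 T' = ∅ := by
      ext s
      simp only [mem_inter_iff, mem_compl_iff, mem_Ico, mem_Ioo, mem_empty_iff_false, iff_false]
      exact fun h => h.1 ⟨h.2.1.le, h.2.2⟩
    rw [this, measure_empty]
  rw [posMeasure, Measure.add_apply, h1, add_zero, Measure.smul_apply,
    Measure.dirac_apply' _ measurableSet_Ico.compl]
  simp [hT]

/-- Positive parts of `(a, x)` and of `(-a, -x)` form a Jordan-type decomposition, so the difference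
recovers the signed measure `a δ + x ds`. -/
theorem integral_posMeasure_sub {T' a : ℝ} {x g : ℝ → ℝ} (hx : IntegrableOn x (Ioo 0 T'))
    (hg : AEStronglyMeasurable g (volume.restrict (Ioo 0 T')))
    (hgx : IntegrableOn (fun s => g s * x s) (Ioo 0 T')) :
    Integrable g (posMeasure T' a x) ∧
      ∫ s, g s ∂(posMeasure T' a x) - ∫ s, g s ∂(posMeasure T' (-a) fun s => -x s) =
        a * g 0 + ∫ s in Ioo 0 T', g s * x s := by
  have hint : ∀ {z : ℝ → ℝ}, IntegrableOn z (Ioo 0 T') →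
      IntegrableOn (fun s => g s * z s) (Ioo 0 T') →
      IntegrableOn (fun s => (z s).toNNReal • g s) (Ioo 0 T') ∧ ∀ b : ℝ,
      Integrable g (posMeasure T' b z) ∧ ∫ s, g s ∂(posMeasure T' b z) =
        max b 0 * g 0 + ∫ s in Ioo 0 T', (z s).toNNReal • g s := by
    intro z hz hgz
    have hm : AEMeasurable (fun s => (z s).toNNReal) (volume.restrict (Ioo 0 T')) :=
      hz.aemeasurable.real_toNNReal
    have h1 : IntegrableOn (fun s => (z s).toNNReal • g s) (Ioo 0 T') := by
      refine Integrable.mono hgz (hm.aestronglyMeasurable.smul hg)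
        (Eventually.of_forall fun s => ?_)
      rw [NNReal.smul_def, smul_eq_mul, norm_mul, norm_mul, mul_comm ‖g s‖, Real.coe_toNNReal']
      refine mul_le_mul_of_nonneg_right ?_ (norm_nonneg _)
      rw [Real.norm_eq_abs, Real.norm_eq_abs, abs_of_nonneg (le_max_right _ _)]
      exact max_le (le_abs_self _) (abs_nonneg _)
    refine ⟨h1, fun b => ?_⟩
    have h2 : Integrable g
        ((volume.restrict (Ioo 0 T')).withDensity fun s => ((z s).toNNReal : ENNReal)) :=
      (integrable_withDensity_iff_integrable_smul₀ hm).2 h1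
    have h3 : Integrable g (b.toNNReal • Measure.dirac (0 : ℝ)) :=
      (integrable_dirac (by simp)).smul_measure_nnreal
    refine ⟨h3.add_measure h2, ?_⟩
    rw [posMeasure, integral_add_measure h3 h2, integral_smul_nnreal_measure, integral_dirac,
      integral_withDensity_eq_integral_smul₀ hm, NNReal.smul_def, smul_eq_mul, Real.coe_toNNReal']
  obtain ⟨i1, e1⟩ := hint hx hgx
  obtain ⟨i2, e2⟩ := hint hx.neg (by
    refine hgx.neg.congr (Eventually.of_forall fun s => ?_)
    simp)
  refine ⟨(e1 a).1, ?_⟩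
  have e3 : ∫ s, g s ∂(posMeasure T' (-a) fun s => -x s) = _ := (e2 (-a)).2
  rw [(e1 a).2, e3]
  have h4 : (∫ s in Ioo 0 T', g s * x s) = (∫ s in Ioo 0 T', (x s).toNNReal • g s) -
      ∫ s in Ioo 0 T', ((-x) s).toNNReal • g s := by
    rw [← integral_sub i1 i2]
    refine integral_congr_ae (Eventually.of_forall fun s => ?_)
    simp only [NNReal.smul_def, smul_eq_mul, Real.coe_toNNReal', Pi.neg_apply]
    rcases le_total (x s) 0 with h | h
    · rw [max_eq_right h, max_eq_left (by linarith)]; ring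
    · rw [max_eq_left h, max_eq_right (by linarith)]; ring
  rw [h4]
  rcases le_total a 0 with h | h
  · rw [max_eq_right h, max_eq_left (by linarith)]; ring
  · rw [max_eq_left h, max_eq_right (by linarith)]; ring

theorem representedBy_posMeasure {T' a : ℝ} (hT : 0 < T') {x : ℝ → ℝ}
    (hx : IntegrableOn x (Ioo 0 T')) :
    RepresentedBy (deltaPlus T' a x) (posMeasure T' a x) (posMeasure T' (-a) fun s => -x s) where
  finite₁ := isFiniteMeasure_posMeasure hx
  finite₂ := isFiniteMeasure_posMeasure hx.neg
  supp₁ := posMeasure_compl hT x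
  supp₂ := posMeasure_compl hT _
  apply_eq φ := by
    obtain ⟨C, hC⟩ := φ.hasCompactSupport.exists_bound_of_continuous φ.continuous
    rw [deltaPlus_apply hx, (integral_posMeasure_sub hx φ.continuous.aestronglyMeasurable
      (Integrable.bdd_mul hx φ.continuous.aestronglyMeasurable (Eventually.of_forall hC))).2]

/-- Written as equality of sums, uniqueness of the signed measure needs positive measures only. -/
theorem RepresentedBy.add_eq_add {T' : ℝ} {u : 𝓓'(halfLine T', ℝ)} {μ₁ μ₂ ν₁ ν₂ : Measure ℝ}
    (hμ : RepresentedBy u μ₁ μ₂) (hν : RepresentedBy u ν₁ ν₂) : μ₁ + ν₂ = ν₁ + μ₂ := by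
  have := hμ.finite₁
  have := hμ.finite₂
  have := hν.finite₁
  have := hν.finite₂
  refine measure_eq_of_testFunctions (T' := T') ?_ ?_ fun φ => ?_
  · rw [Measure.add_apply, hμ.supp₁, hν.supp₂, add_zero]
  · rw [Measure.add_apply, hν.supp₁, hμ.supp₂, add_zero]
  · have hi : ∀ (ρ : Measure ℝ) [IsFiniteMeasure ρ], Integrable (fun s => φ s) ρ := fun ρ _ =>
      φ.continuous.integrable_of_hasCompactSupport φ.hasCompactSupport
    rw [integral_add_measure (hi _) (hi _), integral_add_measure (hi _) (hi _)]
    have h1 := hμ.apply_eq φ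
    have h2 := hν.apply_eq φ
    linarith

/-! ### The distributional equation as a pointwise one. -/

namespace VolterraData

variable {P : VolterraData} {T' : ℝ}

theorem integrableOn_K (hP : P.Standing T') {i : ℕ} (hi : i ∈ Finset.Icc 1 P.n) {t : ℝ}
    (ht : t ∈ Icc 0 T') (μ : Measure ℝ) [IsFiniteMeasure μ] :
    IntegrableOn (fun s => P.K i t s) (Ico (P.α (i - 1) t) (P.α i t)) μ :=
  ((Standing.continuousOn_slice (hP.K_cont i hi) ht).integrableOn_compact isCompact_Icc).mono_set
    Ico_subset_Icc_self

/-- Additivity in the measure makes the left-hand side depend on the distribution alone, not on the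
chosen decomposition. -/
theorem volterra_sub_eq_of_representedBy (hP : P.Standing T') {u : 𝓓'(halfLine T', ℝ)}
    {μ₁ μ₂ ν₁ ν₂ : Measure ℝ} (hμ : RepresentedBy u μ₁ μ₂) (hν : RepresentedBy u ν₁ ν₂) {t : ℝ}
    (ht : t ∈ Icc 0 T') :
    P.volterra μ₁ t - P.volterra μ₂ t = P.volterra ν₁ t - P.volterra ν₂ t := by
  have := hμ.finite₁
  have := hμ.finite₂
  have := hν.finite₁
  have := hν.finite₂
  have hadd : ∀ (ρ σ : Measure ℝ) [IsFiniteMeasure ρ] [IsFiniteMeasure σ],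
      P.volterra (ρ + σ) t = P.volterra ρ t + P.volterra σ t := by
    intro ρ σ _ _
    rw [volterra, volterra, volterra, ← Finset.sum_add_distrib]
    refine Finset.sum_congr rfl fun i hi => ?_
    rw [Measure.restrict_add, integral_add_measure (integrableOn_K hP hi ht ρ)
      (integrableOn_K hP hi ht σ)]
  have h := congrArg (fun ρ => P.volterra ρ t) (hμ.add_eq_add hν)
  simp only [hadd] at h
  linarith

/-- For `t > 0` the point `0` lies in the half-open first sector and in no other, so the mass `a`
meets `K_1` only. For the density the choice of end points is immaterial. -/
theorem volterra_posMeasure_sub (hP : P.Standing T') {x : ℝ → ℝ}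
    (hx : IntegrableOn x (Ioc 0 T')) (a : ℝ) {t : ℝ} (ht : t ∈ Ioo 0 T') :
    P.volterra (posMeasure T' a x) t - P.volterra (posMeasure T' (-a) fun s => -x s) t =
      a * P.K 1 t 0
        + ∑ i ∈ Finset.Icc 1 P.n, ∫ s in (P.α (i - 1) t)..(P.α i t), P.K i t s * x s := by
  have ht' := Ioo_subset_Icc_self ht
  have hx' : IntegrableOn x (Ioo 0 T') := hx.mono_set Ioo_subset_Ioc_self
  have key : ∀ i ∈ Finset.Icc 1 P.n,
      (∫ s in Ico (P.α (i - 1) t) (P.α i t), P.K i t s ∂(posMeasure T' a x)) -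
        (∫ s in Ico (P.α (i - 1) t) (P.α i t), P.K i t s ∂(posMeasure T' (-a) fun s => -x s)) =
      (if i = 1 then a * P.K 1 t 0 else 0) +
        ∫ s in (P.α (i - 1) t)..(P.α i t), P.K i t s * x s := by
    intro i hi
    have hi' := Finset.mem_Icc.1 hi
    set S := Ico (P.α (i - 1) t) (P.α i t) with hS
    have hmS : MeasurableSet S := measurableSet_Ico
    have hle := hP.α_mono (i := i - 1) (by omega) hi'.2 ht'
    have hI := hP.integrableOn_mul hi'.2 (hP.K_cont i hi) hx ht'
    have hmul : ∀ s, S.indicator (P.K i t) s * x s = S.indicator (fun s => P.K i t s * x s) s :=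
      fun s => (indicator_mul_left S (P.K i t) x).symm
    rw [← integral_indicator hmS, ← integral_indicator hmS]
    have hmeas : AEStronglyMeasurable (S.indicator (P.K i t)) (volume.restrict (Ioo 0 T')) := by
      refine AEStronglyMeasurable.restrict ?_
      rw [aestronglyMeasurable_indicator_iff hmS]
      exact ((Standing.continuousOn_slice (hP.K_cont i hi) ht').mono
        Ico_subset_Icc_self).aestronglyMeasurable hmS
    have hIS : IntegrableOn (fun s => P.K i t s * x s) S := by
      rw [hS, integrableOn_Ico_iff_integrableOn_Ioo]
      exact hI.mono_set Ioo_subset_Ioc_self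
    have hgx : IntegrableOn (fun s => S.indicator (P.K i t) s * x s) (Ioo 0 T') := by
      simp only [hmul]
      exact ((integrable_indicator_iff hmS).2 hIS).integrableOn
    rw [(integral_posMeasure_sub hx' hmeas hgx).2]
    congr 1
    · split_ifs with h
      · subst h
        rw [indicator_of_mem]
        exact ⟨(hP.α_zero t ht').le, hP.α_pos le_rfl hi'.2 ⟨ht.1, ht.2.le⟩⟩
      · rw [indicator_of_notMem, mul_zero]
        exact fun h0 => absurd h0.1
          (not_le.2 (hP.α_pos (i := i - 1) (by omega) (by omega) ⟨ht.1, ht.2.le⟩))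
    · simp only [hmul]
      rw [setIntegral_indicator hmS, intervalIntegral.integral_of_le hle,
        integral_Ioc_eq_integral_Ioo]
      refine setIntegral_congr_set (Filter.EventuallyEq.trans ?_ Ioo_ae_eq_Ico.symm)
      have h1 : (Ioo 0 T' ∩ S : Set ℝ) =ᵐ[volume] (Ici 0 ∩ S : Set ℝ) := by
        have : Ioo 0 T' ∩ S = Ioi 0 ∩ S := by
          ext s
          refine ⟨fun h => ⟨h.1.1, h.2⟩, fun h => ⟨⟨h.1, ?_⟩, h.2⟩⟩
          exact h.2.2.trans_le ((hP.α_le_self hi'.2 ht').trans ht.2.le)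
        rw [this]
        exact ae_eq_set_inter Ioi_ae_eq_Ici (ae_eq_refl _)
      have h2 : (Ici 0 ∩ S : Set ℝ) = S :=
        inter_eq_self_of_subset_right fun s hs => (hP.α_nonneg (by omega) ht').trans hs.1
      rw [h2] at h1
      exact h1
  rw [volterra, volterra, ← Finset.sum_sub_distrib, Finset.sum_congr rfl key,
    Finset.sum_add_distrib, Finset.sum_ite_eq' (Finset.Icc 1 P.n) 1,
    if_pos (by simpa using hP.n_pos)]

/-- The equation in the sense of distributions is the pointwise one on `(0, T')`. -/
theorem isSolution_deltaPlus_iff (hP : P.Standing T') {x : ℝ → ℝ}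
    (hx : IntegrableOn x (Ioc 0 T')) (a : ℝ) :
    P.IsSolution (deltaPlus T' a x) ↔ ∀ t ∈ Ioo 0 T', a * P.K 1 t 0
      + ∑ i ∈ Finset.Icc 1 P.n, ∫ s in (P.α (i - 1) t)..(P.α i t), P.K i t s * x s = P.f t := by
  have hx' : IntegrableOn x (Ioo 0 T') := hx.mono_set Ioo_subset_Ioc_self
  have hrep := representedBy_posMeasure (a := a) hP.T'_pos hx'
  constructor
  · rintro ⟨μ₁, μ₂, hμ, hsol⟩
    have h1 : EqOn (fun t => P.volterra μ₁ t - P.volterra μ₂ t) (fun t => a * P.K 1 t 0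
        + ∑ i ∈ Finset.Icc 1 P.n, ∫ s in (P.α (i - 1) t)..(P.α i t), P.K i t s * x s)
        (Ioo 0 T') := fun t ht => by
      simp only
      rw [volterra_sub_eq_of_representedBy hP hμ hrep (Ioo_subset_Icc_self ht),
        volterra_posMeasure_sub hP hx a ht]
    rw [regularDist_congr h1] at hsol
    have hc := hP.continuousOn_lhs hx a
    exact eqOn_of_regularDist_eq (hc.integrableOn_Icc.mono_set Ioo_subset_Icc_self)
      (hP.f_continuousOn.integrableOn_Icc.mono_set Ioo_subset_Icc_self)
      (hc.mono Ioo_subset_Icc_self) (hP.f_continuousOn.mono Ioo_subset_Icc_self) hsol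
  · intro h
    refine ⟨_, _, hrep, regularDist_congr fun t ht => ?_⟩
    rw [volterra_posMeasure_sub hP hx a ht, h t ht]

end VolterraData

/-! ### Assembly of the family of solutions. -/

namespace VolterraData

variable {P : VolterraData} {T' ε q : ℝ} {Nstar : ℕ}

theorem F_add_pow_mul_eq_rhs_iff (hP : P.Standing T') (hD : P.CondD T' ε q Nstar)
    {x w : ℝ → ℝ} (hx : IntegrableOn x (Ioc 0 T')) (hw : IntegrableOn w (Ioc 0 T')) {t : ℝ}
    (ht : t ∈ Ioc 0 T') :
    P.F (fun s => x s + s ^ Nstar * w s) t = P.rhs t ↔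
      w t + P.MK Nstar w t = P.γ Nstar x t := by
  have ht' : t ∈ Icc 0 T' := ⟨ht.1.le, ht.2⟩
  have hK := hD.Kn_ne_zero t ht'
  rw [hP.F_add hx (integrableOn_pow_mul Nstar hw) ht', F_pow_mul ht.1.ne' hK, γ,
    eq_div_iff (mul_ne_zero (pow_ne_zero _ ht.1.ne') hK)]
  constructor <;> intro h <;> linarith

end VolterraData

theorem theorem2 (P : VolterraData) (T' ε q : ℝ) (N Nstar ν : ℕ) (j k : Fin ν → ℕ)
    (hP : P.Standing T') (hB : P.CondB T' N) (hC : P.CondC N j k) (hD : P.CondD T' ε q Nstar)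
    (hN : Nstar < N) (hf : P.f 0 ≠ 0) (hK : P.K 1 0 0 ≠ 0) :
    ∃ (p : (Fin (∑ i, k i) → ℝ) →ᵃ[ℝ] (Fin (N + 1) → ℝ[X]))
      (v x : (Fin (∑ i, k i) → ℝ) → ℝ → ℝ),
      -- the regular part of the solution is `x = x̂ + t^{N*} v`
      (∀ c t, x c t = logPower (p c) t + t ^ Nstar * v c t) ∧
      -- distinct values of the constants give distinct solutions
      Function.Injective (fun c => deltaPlus T' P.a (x c)) ∧
      ∀ c,
        ContinuousOn (v c) (Icc 0 T') ∧
        IntegrableOn (x c) (Ioc 0 T') ∧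
        -- the equation holds in the sense of distributions, and pointwise on `(0, T']`
        P.IsSolution (deltaPlus T' P.a (x c)) ∧
        (∀ t ∈ Ioc 0 T', P.a * P.K 1 t 0
          + ∑ i ∈ Finset.Icc 1 P.n, ∫ s in (P.α (i - 1) t)..(P.α i t), P.K i t s * x c s
          = P.f t) ∧
        -- `x̂` solves the equation for the regular part asymptotically
        (fun t => P.F (logPower (p c)) t - P.rhs t) =o[𝓝[>] 0] (fun t => t ^ (N - 1)) ∧
        -- `v` is unique and is the limit of the successive approximations
        (∀ w : ℝ → ℝ, ContinuousOn w (Icc 0 T') →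
          P.IsSolution (deltaPlus T' P.a (fun t => logPower (p c) t + t ^ Nstar * w t)) →
          EqOn w (v c) (Icc 0 T')) ∧
        TendstoUniformlyOn (P.approx Nstar (logPower (p c))) (v c) atTop (Ioc 0 T') ∧
        -- the asymptotic estimate
        (fun t => x c t - logPower (p c) t) =O[𝓝[>] 0] (fun t => t ^ Nstar) := by
  have hT := hP.T'_pos
  have hN1 : 1 ≤ N := by omega
  obtain ⟨p, hpF, hpne⟩ := VolterraData.exists_asymptotic_family hP hB hC hN1
  have hlI : ∀ c, IntegrableOn (logPower (p c)) (Ioc 0 T') := fun c => integrableOn_logPower _ hT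
  have hlc : ∀ c, ContinuousOn (logPower (p c)) (Ioc 0 T') := fun c =>
    (continuousOn_logPower _).mono fun t ht => ht.1
  have hFo : ∀ c, (fun t => P.F (logPower (p c)) t - P.rhs t) =o[𝓝[>] 0] fun t => t ^ (N - 1) :=
    fun c => isLittleO_of_mem_logBigO (by rw [Nat.sub_add_cancel hN1]; exact hpF c)
  have hpow : (fun t : ℝ => t ^ (N - 1)) =O[𝓝[>] 0] fun t => t ^ Nstar := by
    refine IsBigO.of_bound 1 ?_
    filter_upwards [Ioo_mem_nhdsGT (zero_lt_one' ℝ)] with t ht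
    rw [one_mul, Real.norm_of_nonneg (pow_nonneg ht.1.le _),
      Real.norm_of_nonneg (pow_nonneg ht.1.le _)]
    exact pow_le_pow_of_le_one ht.1.le ht.2.le (by omega)
  choose v hvc hvlim hveq using fun c => VolterraData.exists_limit_approx hP hD
    (VolterraData.vanishing_γ hP hD (hlI c) (hlc c) ((hFo c).trans_isBigO hpow))
  have hIoc : ∀ {w : ℝ → ℝ}, ContinuousOn w (Icc 0 T') → IntegrableOn w (Ioc 0 T') := fun hw =>
    hw.integrableOn_Icc.mono_set Ioc_subset_Icc_self
  have hxI : ∀ c {w : ℝ → ℝ}, ContinuousOn w (Icc 0 T') →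
      IntegrableOn (fun t => logPower (p c) t + t ^ Nstar * w t) (Ioc 0 T') := fun c _ hw =>
    (hlI c).add (VolterraData.integrableOn_pow_mul Nstar (hIoc hw))
  have hxc : ∀ c {w : ℝ → ℝ}, ContinuousOn w (Icc 0 T') →
      ContinuousOn (fun t => logPower (p c) t + t ^ Nstar * w t) (Ioc 0 T') := fun c _ hw =>
    (hlc c).add ((continuousOn_pow Nstar).mul (hw.mono Ioc_subset_Icc_self))
  have hvO : ∀ c, (fun t => t ^ Nstar * v c t) =O[𝓝[>] 0] fun t => t ^ Nstar := fun c => by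
    simpa using (isBigO_refl (fun t : ℝ => t ^ Nstar) (𝓝[>] 0)).mul
      ((hP.tendsto_nhdsGT (hvc c)).isBigO_one ℝ)
  have hpt : ∀ c, ∀ t ∈ Icc 0 T', P.a * P.K 1 t 0
      + ∑ i ∈ Finset.Icc 1 P.n, ∫ s in (P.α (i - 1) t)..(P.α i t),
        P.K i t s * (logPower (p c) s + s ^ Nstar * v c s) = P.f t := fun c t ht =>
    hP.lhs_eq_of_F_eq hK (hxI c (hvc c)) (hxc c (hvc c)) (fun s hs =>
      (VolterraData.F_add_pow_mul_eq_rhs_iff hP hD (hlI c) (hIoc (hvc c)) ⟨hs.1, hs.2.le⟩).2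
        (hveq c s ⟨hs.1, hs.2.le⟩)) ht
  refine ⟨p, v, fun c t => logPower (p c) t + t ^ Nstar * v c t, fun c t => rfl, ?_, fun c =>
    ⟨hvc c, hxI c (hvc c), ?_, fun t ht => hpt c t ⟨ht.1.le, ht.2⟩, hFo c, ?_, hvlim c, ?_⟩⟩
  · intro c c' hcc
    by_contra hne
    obtain ⟨m, hm0, hml, hmne⟩ := hpne c c' hne
    -- The first differing order is a zero of `B`, and none of these lie at or beyond `N*`.
    have hmN : (m : ℕ) < Nstar := not_le.1 fun h => hD.B_ne_zero hP h hm0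
    have hE := eqOn_of_regularDist_eq ((hxI c (hvc c)).mono_set Ioo_subset_Ioc_self)
      ((hxI c' (hvc c')).mono_set Ioo_subset_Ioc_self)
      ((hxc c (hvc c)).mono Ioo_subset_Ioc_self) ((hxc c' (hvc c')).mono Ioo_subset_Ioc_self)
      (add_left_cancel (a := P.a • Distribution.delta 0) hcc)
    -- Equal solutions would give `x̂_c - x̂_c' = t^{N*}(v_c' - v_c) = O(t^{N*})`, which is
    -- impossible when the leading order is below `N*`.
    refine logPower_not_isBigO (x := p c - p c') (i := m)
      (fun l hl => sub_eq_zero.2 (hml l hl)) (sub_ne_zero.2 hmne) hmN ?_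
    refine ((hvO c').sub (hvO c)).congr' ?_ EventuallyEq.rfl
    filter_upwards [hP.Ioo_mem_nhdsGT] with t ht
    have h1 := hE ht
    have h2 := congrFun (logPower_add (p c - p c') (p c')) t
    rw [sub_add_cancel] at h2
    simp only at h1
    linarith
  · exact (VolterraData.isSolution_deltaPlus_iff hP (hxI c (hvc c)) P.a).2 fun t ht =>
      hpt c t (Ioo_subset_Icc_self ht)
  · intro w hw hsol
    have h1 := (VolterraData.isSolution_deltaPlus_iff hP (hxI c hw) P.a).1 hsol
    refine VolterraData.eqOn_of_add_MK_eq hP hD hw (hvc c) (fun t ht => ?_)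
      fun t ht => hveq c t ⟨ht.1, ht.2.le⟩
    exact (VolterraData.F_add_pow_mul_eq_rhs_iff hP hD (hlI c) (hIoc hw) ⟨ht.1, ht.2.le⟩).1
      (hP.F_eq_of_lhs_eq (hxI c hw) (hxc c hw) h1 ht)
  · simpa using hvO c
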